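/- Let $Cl_{n,0}(\mathbb Z)$ be the associative $\mathbb Z$-algebra with generators $x_1,\dots,x_n$ and relations $x_i^2=1$, $x_ix_j=-x_jx_i$ $(i\ne j)$. An element $\sum_{A\subseteq\{1,\dots,n\}}a_A x_A$, where $x_A$ is the product of the $x_i$, $i\in A$, in increasing order of $i$, is given by its vector of $2^n$ integer coefficients $a_A$. Let $\omega$ be the exponent of matrix multiplication, i.e. the infimum of the real $\tau$ such that the rank over $\mathbb Q$ of the tensor of $N\times N$ matrix multiplication is $O(N^\tau)$. Running times are bit costs on a random access machine, and $O^*$ suppresses factors polynomial in $n$ (respectively in $m$). Theorem. Multiplication in $Cl_{n,0}(\mathbb Z)$ of elements whose coefficients have $\mathrm{poly}(n)$ bits can be performed in time $O^*(2^{\omega n/2})$. As usual, since $\omega$ is an infimum, this means: 1. for every real $\tau>\omega$ there is an algorithm which, given $n$ and the coefficient vectors of $a,b\in Cl_{n,0}(\mathbb Z)$, computes the coefficient vector of $ab$, and which, for every polynomial $p$, runs in time $O^*(2^{\tau n/2})$ on all inputs whose coefficients have at most $p(n)$ bits; 2. moreover, for every real $\tau$ such that $2^m\times 2^m$ integer matrices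 with entries of $\mathrm{poly}(m)$ bits can be multiplied in time $O^*(2^{\tau m})$ on the same machine, multiplication in $Cl_{n,0}(\mathbb Z)$ of elements with coefficients of $\mathrm{poly}(n)$ bits can be performed in time $O^*(2^{\tau n/2})$ (the same $\tau$). In both running times the algorithm does not depend on the polynomial that bounds the number of bits; the suppressed polynomial factor may depend on it. -/

import Mathlib

/-! ### A random access machine with bit costs

Programs are structured programs over integer registers `x₀, x₁, …` and integer arrays
`M₀, M₁, …` with computed addresses.  Every evaluation is charged by the bit lengths of the
integers involved (addresses included), and every binary operation by the product of the bit
lengths of its operands, which is at least the schoolbook bit cost. -/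

namespace RAM

/-- Binary operations; `lt` returns `1` or `0`. -/
inductive Op where
  | add | sub | mul | div | mod | lt

/-- Value of an operation (`div` and `mod` are Euclidean; `a / 0 = 0` and `a % 0 = a`). -/
def Op.eval : Op → ℤ → ℤ → ℤ
  | .add, a, b => a + b
  | .sub, a, b => a - b
  | .mul, a, b => a * b
  | .div, a, b => a / b
  | .mod, a, b => a % b
  | .lt, a, b => if a < b then 1 else 0

/-- Expressions: literals, registers, array cells with computed address, operations. -/
inductive Expr where
  | lit (c : ℤ)
  | reg (x : ℕ)
  | cell (a : ℕ) (i : Expr)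
  | bin (o : Op) (e₁ e₂ : Expr)

/-- Commands.  Conditions hold when their value is nonzero. -/
inductive Cmd where
  | skip
  | assign (x : ℕ) (e : Expr)
  | store (a : ℕ) (i e : Expr)
  | seq (c₁ c₂ : Cmd)
  | ite (e : Expr) (c₁ c₂ : Cmd)
  | loop (e : Expr) (c : Cmd)

/-- Contents of the registers and of the arrays. -/
structure State where
  reg : ℕ → ℤ
  arr : ℕ → ℤ → ℤ

/-- Number of binary digits of the absolute value of an integer. -/
def bits (z : ℤ) : ℕ := z.natAbs.size

def Expr.eval (s : State) : Expr → ℤ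
  | .lit c => c
  | .reg x => s.reg x
  | .cell a i => s.arr a (i.eval s)
  | .bin o e₁ e₂ => o.eval (e₁.eval s) (e₂.eval s)

def Expr.cost (s : State) : Expr → ℕ
  | .lit c => 1 + bits c
  | .reg x => 1 + bits (s.reg x)
  | .cell a i => 1 + i.cost s + bits (s.arr a (i.eval s))
  | .bin _ e₁ e₂ => e₁.cost s + e₂.cost s + (bits (e₁.eval s) + 1) * (bits (e₂.eval s) + 1)

/-- `Exec c s t s'`: started in state `s`, the program `c` halts in state `s'` after
time exactly `t`. -/
inductive Exec : Cmd → State → ℕ → State → Prop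
  | skip (s : State) : Exec .skip s 1 s
  | assign (s : State) (x : ℕ) (e : Expr) :
      Exec (.assign x e) s (1 + e.cost s) ⟨Function.update s.reg x (e.eval s), s.arr⟩
  | store (s : State) (a : ℕ) (i e : Expr) :
      Exec (.store a i e) s (1 + i.cost s + e.cost s)
        ⟨s.reg, Function.update s.arr a (Function.update (s.arr a) (i.eval s) (e.eval s))⟩
  | seq {c₁ c₂ : Cmd} {s₀ s₁ s₂ : State} {t₁ t₂ : ℕ}
      (h₁ : Exec c₁ s₀ t₁ s₁) (h₂ : Exec c₂ s₁ t₂ s₂) : Exec (.seq c₁ c₂) s₀ (t₁ + t₂) s₂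
  | ite_true {e : Expr} {c₁ c₂ : Cmd} {s s' : State} {t : ℕ}
      (he : e.eval s ≠ 0) (h : Exec c₁ s t s') : Exec (.ite e c₁ c₂) s (1 + e.cost s + t) s'
  | ite_false {e : Expr} {c₁ c₂ : Cmd} {s s' : State} {t : ℕ}
      (he : e.eval s = 0) (h : Exec c₂ s t s') : Exec (.ite e c₁ c₂) s (1 + e.cost s + t) s'
  | loop_stop {e : Expr} {c : Cmd} {s : State}
      (he : e.eval s = 0) : Exec (.loop e c) s (1 + e.cost s) s
  | loop_step {e : Expr} {c : Cmd} {s₀ s₁ s₂ : State} {t₁ t₂ : ℕ}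
      (he : e.eval s₀ ≠ 0) (h₁ : Exec c s₀ t₁ s₁) (h₂ : Exec (.loop e c) s₁ t₂ s₂) :
      Exec (.loop e c) s₀ (1 + e.cost s₀ + t₁ + t₂) s₂

/-- An array that holds `v i` at address `addr i` (for injective `addr`) and `0` elsewhere. -/
def place {ι : Type} [Fintype ι] (addr : ι → ℕ) (v : ι → ℤ) : ℤ → ℤ :=
  fun z => ∑ i, if (addr i : ℤ) = z then v i else 0

/-- Initial state: a size parameter in register `0`, the operands in arrays `0` and `1`,
and zeros everywhere else. -/
def input {ι : Type} [Fintype ι] (n : ℕ) (addr : ι → ℕ) (v w : ι → ℤ) : State where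
  reg := fun x => if x = 0 then (n : ℤ) else 0
  arr := fun a => if a = 0 then place addr v else if a = 1 then place addr w else 0

end RAM

/-! ### The Clifford algebra `Cl_{n,0}(ℤ)` -/

/-- The quadratic form `∑ vᵢ²` on `ℤⁿ`. -/
noncomputable abbrev sumSquaresForm (n : ℕ) : QuadraticForm ℤ (Fin n → ℤ) :=
  QuadraticMap.weightedSumSquares ℤ (fun _ : Fin n => (1 : ℤ))

/-- `Cl_{n,0}(ℤ)`: generators `x₀, …, xₙ₋₁` with `xᵢ² = 1` and `xᵢxⱼ = -xⱼxᵢ` for `i ≠ j`. -/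
abbrev Cl (n : ℕ) : Type := CliffordAlgebra (sumSquaresForm n)

/-- The generator `xᵢ`. -/
noncomputable def Cl.gen {n : ℕ} (i : Fin n) : Cl n :=
  CliffordAlgebra.ι (sumSquaresForm n) (Pi.single i 1)

/-- The basis element `x_A`, the product of the `xᵢ`, `i ∈ A`, in increasing order. -/
noncomputable def Cl.monomial {n : ℕ} (A : Finset (Fin n)) : Cl n :=
  ((A.sort (· ≤ ·)).map Cl.gen).prod

/-- The element `∑ A, f A · x_A` with coefficients `f`. -/
noncomputable def Cl.ofCoeffs {n : ℕ} (f : Finset (Fin n) → ℤ) : Cl n :=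
  ∑ A, f A • Cl.monomial A

/-- The address of the coefficient at `x_A`: the characteristic vector of `A` in binary. -/
def subsetAddr {n : ℕ} (A : Finset (Fin n)) : ℕ := ∑ i ∈ A, 2 ^ (i : ℕ)

/-- Multiplication in `Cl_{n,0}(ℤ)` of elements whose coefficients have polynomially many bits
can be performed in time `O*(2^(τ n / 2))`: one program, given `n` and the two coefficient
vectors, computes the coefficient vector of the product into array `2`. -/
def CliffordMulInTime (τ : ℝ) : Prop :=
  ∃ P : RAM.Cmd, ∀ p : Polynomial ℕ, ∃ q : Polynomial ℕ,
    ∀ (n : ℕ) (f g : Finset (Fin n) → ℤ),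
      (∀ A, RAM.bits (f A) ≤ p.eval n) → (∀ A, RAM.bits (g A) ≤ p.eval n) →
      ∃ (t : ℕ) (s : RAM.State),
        RAM.Exec P (RAM.input n subsetAddr f g) t s ∧
        Cl.ofCoeffs (fun C : Finset (Fin n) => s.arr 2 (subsetAddr C)) =
          Cl.ofCoeffs f * Cl.ofCoeffs g ∧
        (t : ℝ) ≤ ((q.eval n : ℕ) : ℝ) * (2 : ℝ) ^ (τ * n / 2)

/-! ### Matrix multiplication -/

/-- There is a bilinear algorithm over `ℚ` that multiplies `N × N` matrices with `r`
multiplications, that is, the tensor `⟨N, N, N⟩` is a sum of `r` tensors of rank at most one. -/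
def HasBilinearMatMul (N r : ℕ) : Prop :=
  ∃ α β γ : Fin r → Matrix (Fin N) (Fin N) ℚ, ∀ A B : Matrix (Fin N) (Fin N) ℚ,
    A * B = ∑ k, ((∑ i, ∑ j, α k i j * A i j) * (∑ i, ∑ j, β k i j * B i j)) • γ k

/-- The rank of the matrix multiplication tensor `⟨N, N, N⟩` over `ℚ`. -/
noncomputable def matMulRank (N : ℕ) : ℕ := sInf {r | HasBilinearMatMul N r}

/-- The exponent of matrix multiplication `ω`. -/
noncomputable def matMulExponent : ℝ :=
  sInf {τ : ℝ | (fun N : ℕ => (matMulRank N : ℝ)) =O[Filter.atTop] (fun N : ℕ => (N : ℝ) ^ τ)}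

/-- Row-major address of the entry `(i, j)` of an `N × N` matrix. -/
def entryAddr {N : ℕ} (ij : Fin N × Fin N) : ℕ := ij.1 * N + ij.2

/-- Multiplication of `2^m × 2^m` integer matrices whose entries have `poly(m)` bits can be
performed in time `O*(2^(τ m))`: one program, given `m` and the two matrices, computes their
product into array `2`. -/
def IntMatMulInTime (τ : ℝ) : Prop :=
  ∃ P : RAM.Cmd, ∀ p : Polynomial ℕ, ∃ q : Polynomial ℕ,
    ∀ (m : ℕ) (A B : Matrix (Fin (2 ^ m)) (Fin (2 ^ m)) ℤ),
      (∀ i j, RAM.bits (A i j) ≤ p.eval m) → (∀ i j, RAM.bits (B i j) ≤ p.eval m) →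
      ∃ (t : ℕ) (s : RAM.State),
        RAM.Exec P
          (RAM.input m entryAddr (fun ij => A ij.1 ij.2) (fun ij => B ij.1 ij.2)) t s ∧
        (∀ i j, s.arr 2 (entryAddr (i, j)) = (A * B) i j) ∧
        (t : ℝ) ≤ ((q.eval m : ℕ) : ℝ) * (2 : ℝ) ^ (τ * m)

/-!
Clifford algebras embed into matrix algebras.  Concretely, the Pauli matrices
`1`, `X`, `XZ`, `Z` form a basis of the `2 × 2` matrices, and tensor products of them ("Pauli
strings") of length `l` form a basis of the `2 ^ l × 2 ^ l` matrices.  By the Jordan-Wigner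
construction, the generators of `Cl_{n,0}(ℤ)` are represented by anticommuting Pauli strings, two
generators for each tensor factor.  One generator of each such pair comes out with square `-1`,
which is repaired by multiplying it with a commuting square root of `-1` in one additional tensor
factor.  Every monomial `x_A` then corresponds, up to a sign, to a Pauli string of length about
`n / 2`, and different monomials to different strings (`stringIndex`, `stringSign`).  Since
products of monomials and of strings follow the same rule (`stringSign_mul_digitProd`,
`Cl.ofCoeffs_mul_ofCoeffs`), the coefficients of a product of Clifford elements can be read off
from the product of two matrices given in the Pauli basis (`stringSign_mul_pauliConv`).

For the exponent `ω`, take one matrix format `2 ^ e` with a bilinear algorithm of rank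
`r ≤ 2 ^ (τ e)`; it exists for every `τ > ω` since the gap absorbs constant factors
(`exists_bilinear_of_matMulExponent_lt`).  Written in the Pauli basis and with denominators
cleared (`HasBilinearMatMul.exists_pauli`), it is a trilinear identity for the structure constants
`tr (P Q Tᵀ)` of strings of length `e`.  These constants are multiplicative in the tensor factors,
so the `k`-th Kronecker power of the identity multiplies strings of length `e k`
(`sum_kronPow_mul_eq_pauliConv`).  It uses `r ^ k` multiplications, about `2 ^ (τ n / 2)` for
`e k` about `n / 2`.  Yates' algorithm applies the Kronecker powers of the three coefficient
matrices to a vector one factor at a time, in `k` sweeps over at most `r ^ k` numbers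
(`yates_eq_sum`), and all numbers stay polynomially long (`abs_yates_le`).

For the reduction to integer matrix multiplication, the same program is run with `e = 1`, with
the transform between the Pauli basis and matrix entries as coefficient matrices, and with the
given program for matrices in the place of the entrywise multiplication
(`sum_kronPow_matrix_eq_pauliConv`, `isMid_matrixProg`).  Both parts are instances of
`cliffordMulInTime_of_isMid`.  In both, `2 ≤ τ`, so that the `2 ^ n` steps for reading and writing
coefficients do not matter.

All loops of the programs are counting loops that fill one array (`RAM.forStore`), and all numbers
have at most `B` bits for a bound `B` known beforehand, so running times are counted as numbers of
rounds times `(B + 1) ^ 2` times a factor that depends only on the program text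
(`RAM.Cmd.factor`).
-/

/-! ### Cost of expressions -/

namespace RAM

theorem bits_le_iff {z : ℤ} {B : ℕ} : bits z ≤ B ↔ z.natAbs < 2 ^ B := Nat.size_le

theorem bits_le_of_abs {z : ℤ} {B : ℕ} (h : |z| < 2 ^ B) : bits z ≤ B := by
  rw [bits_le_iff]
  zify
  exact h

theorem natAbs_lt_of_bits (z : ℤ) : z.natAbs < 2 ^ bits z := bits_le_iff.1 le_rfl

theorem bits_natCast_le {m B : ℕ} (h : m < 2 ^ B) : bits (m : ℤ) ≤ B := by
  rwa [bits_le_iff, Int.natAbs_natCast]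

@[simp] theorem bits_zero : bits 0 = 0 := by simp [bits]

theorem bits_one : bits 1 = 1 := by simp [bits]

theorem bits_eval_op (o : Op) (a b : ℤ) : bits (o.eval a b) ≤ bits a + bits b + 1 := by
  have ha := natAbs_lt_of_bits a
  have hb := natAbs_lt_of_bits b
  have h1 : (1 : ℕ) ≤ 2 ^ bits a := Nat.one_le_two_pow
  have h2 : (1 : ℕ) ≤ 2 ^ bits b := Nat.one_le_two_pow
  rw [bits_le_iff, pow_succ, pow_add]
  have hadd : a.natAbs + b.natAbs < 2 ^ bits a * 2 ^ bits b * 2 := by nlinarith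
  cases o with
  | add => exact (Int.natAbs_add_le a b).trans_lt hadd
  | sub => exact (Int.natAbs_sub_le a b).trans_lt hadd
  | mul =>
    simp only [Op.eval, Int.natAbs_mul]
    nlinarith [Nat.mul_lt_mul'' ha hb]
  | div => exact (Int.natAbs_ediv_le_natAbs a b).trans_lt (by nlinarith)
  | mod =>
    simp only [Op.eval]
    rcases eq_or_ne b 0 with rfl | h0
    · simp only [Int.emod_zero]; nlinarith
    · have h3 := Int.emod_nonneg a h0
      have h4 := Int.emod_lt_abs a h0
      rw [Int.abs_eq_natAbs] at h4
      have : (a % b).natAbs < b.natAbs := by omega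
      nlinarith
  | lt =>
    simp only [Op.eval]
    split_ifs
    · simp; nlinarith
    · simp

/-- Syntactic factor in the bound `Expr.bits_eval_le` for the size of the value. -/
def Expr.weight : Expr → ℕ
  | .lit c => bits c + 1
  | .reg _ => 1
  | .cell _ i => 1 + i.weight
  | .bin _ e₁ e₂ => e₁.weight + e₂.weight + 1

/-- Syntactic factor in the bound `Expr.cost_le` for the cost of an evaluation. -/
def Expr.costFactor : Expr → ℕ
  | .lit c => 1 + bits c
  | .reg _ => 1
  | .cell _ i => 1 + i.costFactor
  | .bin _ e₁ e₂ => e₁.costFactor + e₂.costFactor + (e₁.weight + 1) * (e₂.weight + 1)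

/-- All registers and cells read in the evaluation of an expression hold at most `B` bits. -/
def Expr.Small (B : ℕ) (s : State) : Expr → Prop
  | .lit _ => True
  | .reg x => bits (s.reg x) ≤ B
  | .cell a i => i.Small B s ∧ bits (s.arr a (i.eval s)) ≤ B
  | .bin _ e₁ e₂ => e₁.Small B s ∧ e₂.Small B s

theorem Expr.bits_eval_le {B : ℕ} {s : State} :
    ∀ {e : Expr}, e.Small B s → bits (e.eval s) ≤ e.weight * (B + 1)
  | .lit c, _ => by simp only [eval, weight]; nlinarith [Nat.zero_le (bits c)]
  | .reg x, h => by simp only [eval, weight]; have : bits (s.reg x) ≤ B := h; omega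
  | .cell a i, h => by
    simp only [eval, weight]
    have := h.2
    nlinarith [Nat.zero_le (i.weight * (B + 1))]
  | .bin o e₁ e₂, h => by
    simp only [eval, weight]
    have h1 := bits_eval_le h.1
    have h2 := bits_eval_le h.2
    have := bits_eval_op o (e₁.eval s) (e₂.eval s)
    nlinarith

theorem Expr.cost_le {B : ℕ} {s : State} :
    ∀ {e : Expr}, e.Small B s → e.cost s ≤ e.costFactor * (B + 1) ^ 2
  | .lit c, _ => Nat.le_mul_of_pos_right _ (by positivity)
  | .reg x, h => by
    simp only [cost, costFactor]
    have : bits (s.reg x) ≤ B := h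
    nlinarith
  | .cell a i, h => by
    simp only [cost, costFactor]
    have h1 := cost_le h.1
    have h2 := h.2
    nlinarith
  | .bin o e₁ e₂, h => by
    simp only [cost, costFactor]
    have h1 := cost_le h.1
    have h2 := cost_le h.2
    have h3 : bits (e₁.eval s) + 1 ≤ (e₁.weight + 1) * (B + 1) := by
      nlinarith [bits_eval_le h.1]
    have h4 : bits (e₂.eval s) + 1 ≤ (e₂.weight + 1) * (B + 1) := by
      nlinarith [bits_eval_le h.2]
    nlinarith [Nat.mul_le_mul h3 h4]

/-- All registers and arrays mentioned in an expression have numbers below `100`. -/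
def Expr.Low : Expr → Prop
  | .lit _ => True
  | .reg x => x < 100
  | .cell a i => a < 100 ∧ i.Low
  | .bin _ e₁ e₂ => e₁.Low ∧ e₂.Low

/-- All registers and arrays with numbers below `100` hold integers of at most `B` bits. -/
structure State.Bounded (s : State) (B : ℕ) : Prop where
  reg : ∀ x < 100, bits (s.reg x) ≤ B
  arr : ∀ a < 100, ∀ z, bits (s.arr a z) ≤ B

theorem Expr.Low.small {B : ℕ} {s : State} (hs : s.Bounded B) :
    ∀ {e : Expr}, e.Low → e.Small B s
  | .lit _, _ => trivial
  | .reg x, h => hs.reg x h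
  | .cell a _, h => ⟨small hs h.2, hs.arr a h.1 _⟩
  | .bin _ _ _, h => ⟨small hs h.1, small hs h.2⟩

theorem State.Bounded.update_reg {s : State} {B : ℕ} (hs : s.Bounded B) (x : ℕ) {v : ℤ}
    (hv : bits v ≤ B) : State.Bounded ⟨Function.update s.reg x v, s.arr⟩ B where
  reg y hy := by
    by_cases h : y = x
    · subst h; simpa using hv
    · simpa [h] using hs.reg y hy
  arr := hs.arr

theorem State.Bounded.update_arr {s : State} {B : ℕ} (hs : s.Bounded B) (b : ℕ) {f : ℤ → ℤ}
    (hf : ∀ z, bits (f z) ≤ B) : State.Bounded ⟨s.reg, Function.update s.arr b f⟩ B where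
  reg := hs.reg
  arr a ha z := by
    by_cases h : a = b
    · subst h; simpa using hf z
    · simpa [h] using hs.arr a ha z

/-! ### Timed runs and a counting loop -/

/-- Started in `s`, the program `c` halts in `s'` after time at most `T`. -/
def Runs (c : Cmd) (s : State) (T : ℕ) (s' : State) : Prop := ∃ t ≤ T, Exec c s t s'

theorem Runs.seq {c₁ c₂ : Cmd} {s₀ s₁ s₂ : State} {T₁ T₂ : ℕ} (h₁ : Runs c₁ s₀ T₁ s₁)
    (h₂ : Runs c₂ s₁ T₂ s₂) : Runs (.seq c₁ c₂) s₀ (T₁ + T₂) s₂ := by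
  obtain ⟨t₁, ht₁, e₁⟩ := h₁
  obtain ⟨t₂, ht₂, e₂⟩ := h₂
  exact ⟨_, add_le_add ht₁ ht₂, .seq e₁ e₂⟩

theorem Runs.mono {c : Cmd} {s s' : State} {T T' : ℕ} (h : Runs c s T s') (hT : T ≤ T') :
    Runs c s T' s' := by
  obtain ⟨t, ht, e⟩ := h
  exact ⟨t, ht.trans hT, e⟩

/-- Syntactic factor in running times.  For a program without nested loops whose loops are
counting loops, the time is at most this factor times the number of rounds times the square of
the number of bits. -/
def Cmd.factor : Cmd → ℕ
  | .skip => 1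
  | .assign _ e => 1 + e.costFactor
  | .store _ i e => 1 + i.costFactor + e.costFactor
  | .seq c₁ c₂ => c₁.factor + c₂.factor
  | .ite e c₁ c₂ => 1 + e.costFactor + c₁.factor + c₂.factor
  | .loop e c => 30 + e.costFactor + c.factor

theorem Runs.seq_factor {c₁ c₂ : Cmd} {s₀ s₁ s₂ : State} {X : ℕ}
    (h₁ : Runs c₁ s₀ (c₁.factor * X) s₁) (h₂ : Runs c₂ s₁ (c₂.factor * X) s₂) :
    Runs (.seq c₁ c₂) s₀ ((Cmd.seq c₁ c₂).factor * X) s₂ := by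
  rw [Cmd.factor, add_mul]
  exact h₁.seq h₂

/-- The state `s` with the register `x` set to `v`. -/
def State.set (s : State) (x : ℕ) (v : ℤ) : State := ⟨Function.update s.reg x v, s.arr⟩

@[simp] theorem State.set_reg (s : State) (x : ℕ) (v : ℤ) (y : ℕ) :
    (s.set x v).reg y = if y = x then v else s.reg y := by
  simp [State.set, Function.update_apply]

@[simp] theorem State.set_arr (s : State) (x : ℕ) (v : ℤ) : (s.set x v).arr = s.arr := rfl

theorem runs_assign {s : State} {B X : ℕ} {e : Expr} (hX : (B + 1) ^ 2 ≤ X) (x : ℕ) {v : ℤ}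
    (he : e.Small B s) (hv : e.eval s = v) :
    Runs (.assign x e) s ((Cmd.assign x e).factor * X) (s.set x v) := by
  refine ⟨_, ?_, hv ▸ Exec.assign s x e⟩
  rw [Cmd.factor]
  have := Expr.cost_le he
  have hB : 1 ≤ (B + 1) ^ 2 := Nat.one_le_pow _ _ (by omega)
  nlinarith [Nat.mul_le_mul_left e.costFactor hX]

/-- The state `s` with the counter `r₅` set to `j` and the array `b` replaced by `f`. -/
def State.step (s : State) (j b : ℕ) (f : ℤ → ℤ) : State :=
  ⟨Function.update s.reg 5 j, Function.update s.arr b f⟩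

@[simp] theorem State.step_reg (s : State) (j b : ℕ) (f : ℤ → ℤ) (x : ℕ) :
    (s.step j b f).reg x = if x = 5 then (j : ℤ) else s.reg x := by
  simp [State.step, Function.update_apply]

@[simp] theorem State.step_arr (s : State) (j b : ℕ) (f : ℤ → ℤ) (a : ℕ) :
    (s.step j b f).arr a = if a = b then f else s.arr a := by
  simp [State.step, Function.update_apply]

theorem State.Bounded.set {s : State} {B : ℕ} (hs : s.Bounded B) (x : ℕ) {v : ℤ}
    (hv : bits v ≤ B) : (s.set x v).Bounded B :=
  hs.update_reg x hv

theorem State.Bounded.step {s : State} {B : ℕ} (hs : s.Bounded B) {j : ℕ} (hj : bits j ≤ B)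
    {b : ℕ} {f : ℤ → ℤ} (hf : ∀ z, bits (f z) ≤ B) : (s.step j b f).Bounded B :=
  (hs.update_reg 5 hj).update_arr b hf

/-- `for r₅ = 0, …, r_len - 1 do M_b[ea] := ev`. -/
def forStore (len b : ℕ) (ea ev : Expr) : Cmd :=
  .seq (.assign 5 (.lit 0))
    (.loop (.bin .lt (.reg 5) (.reg len))
      (.seq (.store b ea ev) (.assign 5 (.bin .add (.reg 5) (.lit 1)))))

theorem le_factor_forStore (len b : ℕ) (ea ev : Expr) :
    ea.costFactor + ev.costFactor + 30 ≤ (forStore len b ea ev).factor := by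
  simp only [forStore, Cmd.factor]
  omega

/-- The effect of `forStore`: if `F j` is the content of the array after `j` rounds, the
final content is `F N`. -/
theorem forStore_runs {s : State} {len b B N : ℕ} {ea ev : Expr} (hlen : len ≠ 5)
    (hN : s.reg len = N) (hNB : bits N ≤ B) (F : ℕ → ℤ → ℤ) (h0 : F 0 = s.arr b)
    (hstep : ∀ j < N, F (j + 1) = Function.update (F j)
      (ea.eval (s.step j b (F j)))
      (ev.eval (s.step j b (F j))))
    (hea : ∀ j < N, ea.Small B (s.step j b (F j)))
    (hev : ∀ j < N, ev.Small B (s.step j b (F j))) :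
    Runs (forStore len b ea ev) s ((N + 1) * (ea.costFactor + ev.costFactor + 30) * (B + 1) ^ 2)
      (s.step N b (F N)) := by
  let st : ℕ → State := fun j => s.step j b (F j)
  have hbits : ∀ j ≤ N, bits (j : ℤ) ≤ B := fun j hj => by
    rw [bits_le_iff, Int.natAbs_natCast] at hNB ⊢
    omega
  have hcond : ∀ j ≤ N, (Expr.bin .lt (.reg 5) (.reg len)).Small B (st j) := fun j hj => by
    simp [Expr.Small, st, hlen, hN, hNB, hbits j hj]
  have hinc : ∀ j < N, (Expr.bin .add (.reg 5) (.lit 1)).Small B (st j) := fun j hj => by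
    simp [Expr.Small, st, hbits j hj.le]
  have hb1 : bits (1 : ℤ) = 1 := bits_one
  have main : ∀ d j, j + d = N → Runs (.loop (.bin .lt (.reg 5) (.reg len))
      (.seq (.store b ea ev) (.assign 5 (.bin .add (.reg 5) (.lit 1))))) (st j)
      (((d + 1) * (ea.costFactor + ev.costFactor + 20)) * (B + 1) ^ 2) (st N) := by
    intro d
    induction d with
    | zero =>
      intro j hj
      obtain rfl : j = N := by omega
      refine ⟨_, ?_, Exec.loop_stop (by simp [Expr.eval, Op.eval, st, hlen, hN])⟩
      have := Expr.cost_le (hcond j le_rfl)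
      simp only [Expr.costFactor, Expr.weight] at this
      nlinarith [Nat.zero_le ((ea.costFactor + ev.costFactor) * (B + 1) ^ 2)]
    | succ d ih =>
      intro j hj
      have hjN : j < N := by omega
      obtain ⟨t, ht, e⟩ := ih (j + 1) (by omega)
      have e1 := Exec.store (st j) b ea ev
      have e2 := Exec.assign (s := ⟨(st j).reg, Function.update (st j).arr b
        (Function.update ((st j).arr b) (ea.eval (st j)) (ev.eval (st j)))⟩) (x := 5)
        (e := .bin .add (.reg 5) (.lit 1))
      have hst : (⟨Function.update (st j).reg 5 ((Expr.bin .add (.reg 5) (.lit 1)).eval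
          ⟨(st j).reg, Function.update (st j).arr b
            (Function.update ((st j).arr b) (ea.eval (st j)) (ev.eval (st j)))⟩),
          Function.update (st j).arr b
            (Function.update ((st j).arr b) (ea.eval (st j)) (ev.eval (st j)))⟩ : State)
          = st (j + 1) := by
        simp [st, Expr.eval, Op.eval, hstep j hjN, State.step]
      rw [hst] at e2
      have hne : (Expr.bin .lt (.reg 5) (.reg len)).eval (st j) ≠ 0 := by
        simp [Expr.eval, Op.eval, st, hlen, hN, hjN]
      refine ⟨_, ?_, Exec.loop_step hne (Exec.seq e1 e2) e⟩
      have c1 := Expr.cost_le (hcond j hjN.le)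
      have c2 := Expr.cost_le (hinc j hjN)
      have c3 := Expr.cost_le (hea j hjN)
      have c4 := Expr.cost_le (hev j hjN)
      have c5 : (Expr.bin .add (.reg 5) (.lit 1)).cost ⟨(st j).reg,
          Function.update (st j).arr b (Function.update ((st j).arr b) (ea.eval (st j))
            (ev.eval (st j)))⟩ = (Expr.bin .add (.reg 5) (.lit 1)).cost (st j) := rfl
      rw [c5]
      simp only [Expr.costFactor, Expr.weight, hb1] at c1 c2
      have hB : 1 ≤ (B + 1) ^ 2 := Nat.one_le_pow _ _ (by omega)
      change _ ≤ _ at c3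
      change _ ≤ _ at c4
      have : st j = s.step j b (F j) := rfl
      rw [← this] at c3 c4
      nlinarith
  have e0 := Exec.assign s 5 (.lit 0)
  obtain ⟨t, ht, e⟩ := main N 0 (by omega)
  have hst0 : (⟨Function.update s.reg 5 ((Expr.lit 0).eval s), s.arr⟩ : State) = st 0 := by
    simp [st, Expr.eval, h0, State.step]
  rw [hst0] at e0
  refine ⟨_, ?_, Exec.seq e0 e⟩
  have hB : 1 ≤ (B + 1) ^ 2 := Nat.one_le_pow _ _ (by omega)
  have hN1 : 1 ≤ (N + 1) * (B + 1) ^ 2 := Nat.mul_pos (by omega) (by omega)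
  simp only [Expr.cost, bits_zero]
  nlinarith

/-- The array holding `v i` at address `i` for `i < j` and `0` elsewhere. -/
def table (v : ℕ → ℤ) (j : ℕ) : ℤ → ℤ := fun z => if 0 ≤ z ∧ z < j then v z.toNat else 0

theorem table_natCast (v : ℕ → ℤ) (j i : ℕ) : table v j (i : ℤ) = if i < j then v i else 0 := by
  simp [table]

theorem table_of_lt (v : ℕ → ℤ) {j i : ℕ} (h : i < j) : table v j (i : ℤ) = v i := by
  simp [table_natCast, h]

theorem bits_table {v : ℕ → ℤ} {N B : ℕ} (hv : ∀ i < N, bits (v i) ≤ B) {j : ℕ} (hj : j ≤ N)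
    (z : ℤ) : bits (table v j z) ≤ B := by
  unfold table
  split_ifs with h
  · exact hv _ (by omega)
  · simp

theorem table_succ (v : ℕ → ℤ) (j : ℕ) :
    table v (j + 1) = Function.update (table v j) (j : ℤ) (v j) := by
  funext z
  by_cases h : z = j
  · subst h; simp [table]
  · simp only [Function.update_of_ne h, table]
    congr 1
    simp only [Nat.cast_add, Nat.cast_one, eq_iff_iff]
    omega

/-- The array that holds `v i` at address `addr i` for `i < j` (for `addr` injective) and `0`
elsewhere. -/
def scatter (addr : ℕ → ℕ) (v : ℕ → ℤ) (j : ℕ) : ℤ → ℤ :=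
  fun z => ∑ i ∈ Finset.range j, if (addr i : ℤ) = z then v i else 0

theorem scatter_natCast (addr : ℕ → ℕ) (v : ℕ → ℤ) (j w : ℕ) :
    scatter addr v j (w : ℤ) = ∑ i ∈ Finset.range j, if addr i = w then v i else 0 := by
  simp [scatter]

theorem scatter_succ {addr : ℕ → ℕ} {v : ℕ → ℤ} {j N : ℕ} (hj : j < N)
    (hinj : Set.InjOn addr (Set.Iio N)) :
    scatter addr v (j + 1) = Function.update (scatter addr v j) (addr j : ℤ) (v j) := by
  funext z
  by_cases h : z = addr j
  · subst h
    simp only [scatter, Finset.sum_range_succ, Function.update_self, if_true]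
    rw [Finset.sum_eq_zero, zero_add]
    intro i hi
    rw [Finset.mem_range] at hi
    rw [if_neg]
    intro hh
    have := hinj (show i ∈ Set.Iio N from hi.trans hj) hj (by exact_mod_cast hh)
    omega
  · simp [scatter, Finset.sum_range_succ, Function.update_of_ne h, Ne.symm h]

theorem bits_scatter {addr : ℕ → ℕ} {v : ℕ → ℤ} {N B : ℕ} (hinj : Set.InjOn addr (Set.Iio N))
    (hv : ∀ i < N, bits (v i) ≤ B) :
    ∀ {j : ℕ}, j ≤ N → ∀ z, bits (scatter addr v j z) ≤ B := by
  intro j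
  induction j with
  | zero => intro _ z; simp [scatter]
  | succ j ih =>
    intro hj z
    rw [scatter_succ hj hinj, Function.update_apply]
    split_ifs
    · exact hv j hj
    · exact ih (by omega) z

theorem mul_factor_le {N B X : ℕ} (hX : (N + 1) * (B + 1) ^ 2 ≤ X) (len b : ℕ) (ea ev : Expr) :
    (N + 1) * (ea.costFactor + ev.costFactor + 30) * (B + 1) ^ 2 ≤
      (forStore len b ea ev).factor * X := by
  rw [mul_comm (N + 1), mul_assoc]
  exact Nat.mul_le_mul (le_factor_forStore len b ea ev) hX

/-- A `forStore` loop with address `r₅` tabulates a function. -/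
theorem fill_runs {s : State} {len b B N X : ℕ} {ev : Expr} (hs : s.Bounded B)
    (hX : (N + 1) * (B + 1) ^ 2 ≤ X) (hlen : len ≠ 5)
    (hN : s.reg len = N) (hlen' : len < 100) (hev : ev.Low) (h0 : s.arr b = 0) (v : ℕ → ℤ)
    (hv : ∀ j < N, bits (v j) ≤ B)
    (he : ∀ j < N, ev.eval (s.step j b (table v j)) = v j) :
    Runs (forStore len b (.reg 5) ev) s ((forStore len b (.reg 5) ev).factor * X)
      (s.step N b (table v N)) ∧
    (s.step N b (table v N)).Bounded B := by
  have hNB : bits N ≤ B := hN ▸ hs.reg len hlen'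
  have hB : ∀ j ≤ N, (s.step j b (table v j)).Bounded B := fun j hj => by
    refine hs.step ?_ (bits_table hv hj)
    rw [bits_le_iff, Int.natAbs_natCast] at hNB ⊢
    omega
  refine ⟨(forStore_runs hlen hN hNB (table v) ?_ ?_ ?_ ?_).mono (mul_factor_le hX _ _ _ _),
    hB N le_rfl⟩
  · rw [h0]; funext z
    simp only [table, Pi.zero_apply, Nat.cast_zero]
    rw [if_neg (by omega)]
  · intro j hj
    rw [he j hj, table_succ]
    simp [Expr.eval]
  · intro j hj
    exact Expr.Low.small (hB j hj.le) (by simp [Expr.Low])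
  · intro j hj
    exact Expr.Low.small (hB j hj.le) hev

/-- A `forStore` loop with computed addresses. -/
theorem scatter_runs {s : State} {len b B N X : ℕ} {ea ev : Expr} (hs : s.Bounded B)
    (hX : (N + 1) * (B + 1) ^ 2 ≤ X) (hlen : len ≠ 5) (hN : s.reg len = N) (hlen' : len < 100)
    (hea : ea.Low) (h0 : s.arr b = 0)
    (addr : ℕ → ℕ) (hinj : Set.InjOn addr (Set.Iio N)) (v : ℕ → ℤ)
    (hv : ∀ j < N, bits (v j) ≤ B)
    (ha : ∀ j < N, ea.eval (s.step j b (scatter addr v j)) = addr j)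
    (he : ∀ j < N, ev.eval (s.step j b (scatter addr v j)) = v j)
    (hev : ∀ j < N, (s.step j b (scatter addr v j)).Bounded B →
      ev.Small B (s.step j b (scatter addr v j))) :
    Runs (forStore len b ea ev) s ((forStore len b ea ev).factor * X)
      (s.step N b (scatter addr v N)) ∧
    (s.step N b (scatter addr v N)).Bounded B := by
  have hNB : bits N ≤ B := hN ▸ hs.reg len hlen'
  have hB : ∀ j ≤ N, (s.step j b (scatter addr v j)).Bounded B := fun j hj => by
    refine hs.step ?_ (bits_scatter hinj hv hj)
    rw [bits_le_iff, Int.natAbs_natCast] at hNB ⊢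
    omega
  refine ⟨(forStore_runs hlen hN hNB (scatter addr v) ?_ ?_ ?_ ?_).mono (mul_factor_le hX _ _ _ _),
    hB N le_rfl⟩
  · rw [h0]; funext z; simp [scatter]
  · intro j hj
    rw [he j hj, ha j hj, scatter_succ hj hinj]
  · intro j hj
    exact Expr.Low.small (hB j hj.le) hea
  · intro j hj
    exact hev j hj (hB j hj.le)

/-! ### Notation for expressions -/

instance : Add Expr := ⟨.bin .add⟩
instance : Sub Expr := ⟨.bin .sub⟩
instance : Mul Expr := ⟨.bin .mul⟩
instance : Div Expr := ⟨.bin .div⟩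
instance : Mod Expr := ⟨.bin .mod⟩
instance (n : ℕ) : OfNat Expr n := ⟨.lit n⟩

/-- `1` if the two values are equal, else `0`. -/
def Expr.isEq (a b : Expr) : Expr := 1 - .bin .lt a b - .bin .lt b a

/-- `f 0 + ⋯ + f (n - 1)`. -/
def Expr.sum (f : ℕ → Expr) : ℕ → Expr
  | 0 => 0
  | n + 1 => Expr.sum f n + f n

namespace Expr

variable (s : State) (a b : Expr)

@[simp] theorem eval_add : (a + b).eval s = a.eval s + b.eval s := rfl
@[simp] theorem eval_sub : (a - b).eval s = a.eval s - b.eval s := rfl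
@[simp] theorem eval_mul : (a * b).eval s = a.eval s * b.eval s := rfl
@[simp] theorem eval_div : (a / b).eval s = a.eval s / b.eval s := rfl
@[simp] theorem eval_mod : (a % b).eval s = a.eval s % b.eval s := rfl
@[simp] theorem eval_lt : (bin .lt a b).eval s = if a.eval s < b.eval s then 1 else 0 := rfl
@[simp] theorem eval_ofNat (n : ℕ) : (ofNat(n) : Expr).eval s = (n : ℤ) := rfl
@[simp] theorem eval_lit (c : ℤ) : (lit c).eval s = c := rfl
@[simp] theorem eval_reg (x : ℕ) : (reg x).eval s = s.reg x := rfl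
@[simp] theorem eval_cell (x : ℕ) : (cell x a).eval s = s.arr x (a.eval s) := rfl
@[simp] theorem low_add : (a + b).Low ↔ a.Low ∧ b.Low := Iff.rfl
@[simp] theorem low_sub : (a - b).Low ↔ a.Low ∧ b.Low := Iff.rfl
@[simp] theorem low_mul : (a * b).Low ↔ a.Low ∧ b.Low := Iff.rfl
@[simp] theorem low_div : (a / b).Low ↔ a.Low ∧ b.Low := Iff.rfl
@[simp] theorem low_mod : (a % b).Low ↔ a.Low ∧ b.Low := Iff.rfl
@[simp] theorem low_lt : (bin .lt a b).Low ↔ a.Low ∧ b.Low := Iff.rfl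
@[simp] theorem low_ofNat (n : ℕ) : (ofNat(n) : Expr).Low := trivial
@[simp] theorem low_lit (c : ℤ) : (lit c).Low := trivial
@[simp] theorem low_reg (x : ℕ) : (reg x).Low ↔ x < 100 := Iff.rfl
@[simp] theorem low_cell (x : ℕ) : (cell x a).Low ↔ x < 100 ∧ a.Low := Iff.rfl

@[simp] theorem eval_isEq : (isEq a b).eval s = if a.eval s = b.eval s then 1 else 0 := by
  simp only [isEq, eval_sub, eval_lt, eval_ofNat]
  split_ifs <;> first | rfl | omega

@[simp] theorem low_isEq : (isEq a b).Low ↔ a.Low ∧ b.Low := by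
  simp only [isEq, low_sub, low_lt, low_ofNat]; tauto

@[simp] theorem eval_sum (f : ℕ → Expr) (n : ℕ) :
    (Expr.sum f n).eval s = ∑ i ∈ Finset.range n, (f i).eval s := by
  induction n with
  | zero => simp [Expr.sum]
  | succ n ih => rw [Expr.sum, eval_add, ih, Finset.sum_range_succ]

theorem low_sum {f : ℕ → Expr} (hf : ∀ i, (f i).Low) (n : ℕ) : (Expr.sum f n).Low := by
  induction n with
  | zero => simp [Expr.sum]
  | succ n ih => exact ⟨ih, hf n⟩

end Expr

/-! ### Running a program on shifted registers and arrays -/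

/-- The same expression in the registers and arrays with numbers `d, d + 1, …`. -/
def Expr.shift (d : ℕ) : Expr → Expr
  | .lit c => .lit c
  | .reg x => .reg (x + d)
  | .cell a i => .cell (a + d) (i.shift d)
  | .bin o e₁ e₂ => .bin o (e₁.shift d) (e₂.shift d)

/-- The same program working on the registers and arrays with numbers `d, d + 1, …`. -/
def Cmd.shift (d : ℕ) : Cmd → Cmd
  | .skip => .skip
  | .assign x e => .assign (x + d) (e.shift d)
  | .store a i e => .store (a + d) (i.shift d) (e.shift d)
  | .seq c₁ c₂ => .seq (c₁.shift d) (c₂.shift d)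
  | .ite e c₁ c₂ => .ite (e.shift d) (c₁.shift d) (c₂.shift d)
  | .loop e c => .loop (e.shift d) (c.shift d)

/-- The state `u` on the registers and arrays with numbers `d, d + 1, …`, and `s` below. -/
def State.graft (d : ℕ) (s u : State) : State where
  reg x := if x < d then s.reg x else u.reg (x - d)
  arr a := if a < d then s.arr a else u.arr (a - d)

theorem Expr.eval_shift (d : ℕ) (s u : State) :
    ∀ e : Expr, (e.shift d).eval (s.graft d u) = e.eval u
  | .lit c => rfl
  | .reg x => by simp [shift, eval, State.graft]
  | .cell a i => by simp [shift, eval, eval_shift d s u i]; simp [State.graft]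
  | .bin o e₁ e₂ => by simp [shift, eval, eval_shift d s u]

theorem Expr.cost_shift (d : ℕ) (s u : State) :
    ∀ e : Expr, (e.shift d).cost (s.graft d u) = e.cost u
  | .lit c => rfl
  | .reg x => by simp [shift, cost, State.graft]
  | .cell a i => by simp [shift, cost, cost_shift d s u i, eval_shift]; simp [State.graft]
  | .bin o e₁ e₂ => by simp [shift, cost, cost_shift d s u, eval_shift]

theorem State.graft_update_reg (d : ℕ) (s u : State) (x : ℕ) (v : ℤ) :
    (⟨Function.update (s.graft d u).reg (x + d) v, (s.graft d u).arr⟩ : State) =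
      s.graft d ⟨Function.update u.reg x v, u.arr⟩ := by
  simp only [graft, State.mk.injEq, and_true]
  funext y
  simp only [Function.update_apply]
  split_ifs <;> first | rfl | omega

theorem State.graft_update_arr (d : ℕ) (s u : State) (a : ℕ) (f : ℤ → ℤ) :
    (⟨(s.graft d u).reg, Function.update (s.graft d u).arr (a + d) f⟩ : State) =
      s.graft d ⟨u.reg, Function.update u.arr a f⟩ := by
  simp only [graft, State.mk.injEq, true_and]
  funext y
  simp only [Function.update_apply]
  split_ifs <;> first | rfl | omega

theorem Exec.shift {c : Cmd} {u u' : State} {t : ℕ} (h : Exec c u t u') (d : ℕ) (s : State) :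
    Exec (c.shift d) (s.graft d u) t (s.graft d u') := by
  induction h with
  | skip u => exact .skip _
  | assign u x e =>
    have := Exec.assign (s.graft d u) (x + d) (e.shift d)
    rwa [State.graft_update_reg, Expr.eval_shift, Expr.cost_shift] at this
  | store u a i e =>
    have := Exec.store (s.graft d u) (a + d) (i.shift d) (e.shift d)
    rw [State.graft_update_arr] at this
    simp only [Expr.eval_shift, Expr.cost_shift] at this
    have harr : (s.graft d u).arr (a + d) = u.arr a := by simp [State.graft]
    rwa [harr] at this
  | seq _ _ ih₁ ih₂ => exact .seq ih₁ ih₂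
  | ite_true he _ ih =>
    rw [← Expr.cost_shift d s]
    exact .ite_true (by rwa [Expr.eval_shift]) ih
  | ite_false he _ ih =>
    rw [← Expr.cost_shift d s]
    exact .ite_false (by rwa [Expr.eval_shift]) ih
  | loop_stop he =>
    rw [← Expr.cost_shift d s]
    refine Exec.loop_stop ?_
    rwa [Expr.eval_shift]
  | loop_step he _ _ ih₁ ih₂ =>
    rw [← Expr.cost_shift d s]
    exact .loop_step (by rwa [Expr.eval_shift]) ih₁ ih₂

/-- A run of time `t` changes at most `t` cells of an array. -/
theorem Exec.card_changed_le {c : Cmd} {s s' : State} {t : ℕ} (h : Exec c s t s') (a : ℕ) :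
    ∃ Z : Finset ℤ, Z.card ≤ t ∧ ∀ z ∉ Z, s'.arr a z = s.arr a z := by
  induction h with
  | skip s => exact ⟨∅, by simp, fun _ _ => rfl⟩
  | assign s x e => exact ⟨∅, by simp, fun _ _ => rfl⟩
  | store s b i e =>
    refine ⟨{i.eval s}, by simp; omega, fun z hz => ?_⟩
    rw [Finset.mem_singleton] at hz
    by_cases hab : a = b
    · subst hab; simp [hz]
    · simp [hab]
  | seq _ _ ih₁ ih₂ =>
    obtain ⟨Z₁, c₁, h₁⟩ := ih₁
    obtain ⟨Z₂, c₂, h₂⟩ := ih₂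
    refine ⟨Z₁ ∪ Z₂, (Finset.card_union_le _ _).trans (by omega), fun z hz => ?_⟩
    rw [Finset.mem_union, not_or] at hz
    rw [h₂ z hz.2, h₁ z hz.1]
  | ite_true _ _ ih =>
    obtain ⟨Z, c, h⟩ := ih
    exact ⟨Z, by omega, h⟩
  | ite_false _ _ ih =>
    obtain ⟨Z, c, h⟩ := ih
    exact ⟨Z, by omega, h⟩
  | loop_stop _ => exact ⟨∅, by simp, fun _ _ => rfl⟩
  | loop_step _ _ _ ih₁ ih₂ =>
    obtain ⟨Z₁, c₁, h₁⟩ := ih₁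
    obtain ⟨Z₂, c₂, h₂⟩ := ih₂
    refine ⟨Z₁ ∪ Z₂, (Finset.card_union_le _ _).trans (by omega), fun z hz => ?_⟩
    rw [Finset.mem_union, not_or] at hz
    rw [h₂ z hz.2, h₁ z hz.1]

end RAM

/-! ### Products over digits -/

open Finset in
theorem sum_range_mul_eq {M : Type*} [AddCommMonoid M] (a b : ℕ) (F : ℕ → M) :
    ∑ i ∈ range (a * b), F i = ∑ i ∈ range a, ∑ j ∈ range b, F (i * b + j) := by
  induction a with
  | zero => simp
  | succ a ih => rw [add_mul, one_mul, sum_range_add, ih, sum_range_succ]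

/-- The entry `(i, j)` of the `k`-fold Kronecker power of the `R × S` matrix `M`: the product of
`M i' j'` over the digits `i'` of `i` in base `R` and the digits `j'` of `j` in base `S`. -/
def kronPow (M : ℕ → ℕ → ℤ) (R S : ℕ) : ℕ → ℕ → ℕ → ℤ
  | 0, _, _ => 1
  | k + 1, i, j => M (i % R) (j % S) * kronPow M R S k (i / R) (j / S)

/-- The product of `f x' y' z'` over the `k` lowest digits `x'`, `y'`, `z'` of `x`, `y`, `z` in
bases `a`, `b`, `c`. -/
def digitProd (f : ℕ → ℕ → ℕ → ℤ) (a b c : ℕ) : ℕ → ℕ → ℕ → ℕ → ℤ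
  | 0, _, _, _ => 1
  | k + 1, x, y, z => f (x % a) (y % b) (z % c) * digitProd f a b c k (x / a) (y / b) (z / c)

theorem mul_add_div_of_lt {i R x : ℕ} (hx : x < R) : (i * R + x) / R = i := by
  rw [Nat.add_div_of_dvd_right (Nat.dvd_mul_left R i), Nat.div_eq_of_lt hx,
    Nat.mul_div_cancel _ (by omega), add_zero]

theorem digitProd_add (f : ℕ → ℕ → ℕ → ℤ) (a b c k l x y z : ℕ) :
    digitProd f a b c (k + l) x y z =
      digitProd f a b c k x y z * digitProd f a b c l (x / a ^ k) (y / b ^ k) (z / c ^ k) := by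
  induction k generalizing x y z with
  | zero => simp [digitProd]
  | succ k ih =>
    rw [show k + 1 + l = (k + l) + 1 by omega, digitProd, digitProd, ih]
    simp only [Nat.div_div_eq_div_mul, pow_succ', mul_assoc]

theorem digitProd_mod (f : ℕ → ℕ → ℕ → ℤ) (a b c k x y z : ℕ) :
    digitProd f a b c k (x % a ^ k) (y % b ^ k) (z % c ^ k) = digitProd f a b c k x y z := by
  induction k generalizing x y z with
  | zero => simp [digitProd]
  | succ k ih =>
    rw [digitProd, digitProd, ← ih (x / a) (y / b) (z / c)]
    simp only [pow_succ', Nat.mod_mul_right_mod, Nat.mod_mul_right_div_self]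

/-- Grouping digits into blocks of `e`. -/
theorem digitProd_mul (f : ℕ → ℕ → ℕ → ℤ) (a b c e k x y z : ℕ) :
    digitProd f a b c (e * k) x y z =
      digitProd (digitProd f a b c e) (a ^ e) (b ^ e) (c ^ e) k x y z := by
  induction k generalizing x y z with
  | zero => rfl
  | succ k ih =>
    rw [mul_add, mul_one, add_comm, digitProd_add, digitProd, digitProd_mod, ih]

/-- Kronecker powers of a trilinear identity. -/
theorem sum_kronPow_mul (α β γ : ℕ → ℕ → ℤ) (f : ℕ → ℕ → ℕ → ℤ) (R S : ℕ) (D : ℤ) (hS : 0 < S)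
    (h : ∀ x < S, ∀ y < S, ∀ z < S, ∑ i ∈ Finset.range R, γ z i * (α i x * β i y) = D * f x y z)
    (k x y z : ℕ) :
    ∑ i ∈ Finset.range (R ^ k),
        kronPow γ S R k z i * (kronPow α R S k i x * kronPow β R S k i y) =
      D ^ k * digitProd f S S S k x y z := by
  induction k generalizing x y z with
  | zero => simp [kronPow, digitProd]
  | succ k ih =>
    rw [pow_succ R, sum_range_mul_eq]
    have : ∀ i ∈ Finset.range (R ^ k), ∀ j ∈ Finset.range R,
        kronPow γ S R (k + 1) z (i * R + j) * (kronPow α R S (k + 1) (i * R + j) x *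
          kronPow β R S (k + 1) (i * R + j) y) =
        (γ (z % S) j * (α j (x % S) * β j (y % S))) * (kronPow γ S R k (z / S) i *
          (kronPow α R S k i (x / S) * kronPow β R S k i (y / S))) := by
      intro i _ j hj
      rw [Finset.mem_range] at hj
      simp only [kronPow, Nat.mul_add_mod_of_lt hj, mul_add_div_of_lt hj]
      ring
    rw [Finset.sum_congr rfl fun i hi => Finset.sum_congr rfl (this i hi)]
    simp_rw [← Finset.sum_mul]
    rw [← Finset.mul_sum, ih, h _ (Nat.mod_lt _ hS) _ (Nat.mod_lt _ hS) _ (Nat.mod_lt _ hS),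
      digitProd]
    ring

/-! ### Yates' algorithm -/

/-- The vector after `l` of the `k` levels of Yates' algorithm, which applies the Kronecker
power of the `R × S` matrix `M` to `u`.  One level consumes the highest base-`S` digit of the
index and produces its lowest base-`R` digit. -/
def yates (M : ℕ → ℕ → ℤ) (R S k : ℕ) (u : ℕ → ℤ) : ℕ → ℕ → ℤ
  | 0, x => u x
  | l + 1, x =>
    if x < R ^ (l + 1) * S ^ (k - (l + 1)) then
      ∑ y ∈ Finset.range S, M (x % R) y *
        yates M R S k u l (y * (R ^ l * S ^ (k - (l + 1))) + x / R)
    else 0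

theorem yates_eq_sum_of_le (M : ℕ → ℕ → ℤ) (R S k : ℕ) (u : ℕ → ℤ) {l h i : ℕ} (hl : l ≤ k)
    (hh : h < S ^ (k - l)) (hi : i < R ^ l) :
    yates M R S k u l (h * R ^ l + i) =
      ∑ j ∈ Finset.range (S ^ l), kronPow M R S l i j * u (j * S ^ (k - l) + h) := by
  induction l generalizing h i with
  | zero => simp [yates, kronPow, show i = 0 by simpa using hi]
  | succ l ih =>
    have hR : 0 < R := by
      rcases Nat.eq_zero_or_pos R with rfl | h0
      · simp at hi
      · exact h0
    have hlt : h * R ^ (l + 1) + i < R ^ (l + 1) * S ^ (k - (l + 1)) := by nlinarith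
    have hmod : (h * R ^ (l + 1) + i) % R = i % R := by
      rw [pow_succ, ← mul_assoc, Nat.mul_add_mod_self_right]
    have hdiv : (h * R ^ (l + 1) + i) / R = h * R ^ l + i / R := by
      rw [pow_succ, ← mul_assoc, Nat.add_div_of_dvd_right (Nat.dvd_mul_left _ _),
        Nat.mul_div_cancel _ hR]
    have hiR : i / R < R ^ l := by
      rw [Nat.div_lt_iff_lt_mul hR, ← pow_succ]
      exact hi
    rw [yates, if_pos hlt, hmod, hdiv, pow_succ S l, sum_range_mul_eq, Finset.sum_comm]
    refine Finset.sum_congr rfl fun y hy => ?_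
    rw [Finset.mem_range] at hy
    have hS : S ^ (k - l) = S * S ^ (k - (l + 1)) := by
      rw [← pow_succ']; congr 1; omega
    rw [show y * (R ^ l * S ^ (k - (l + 1))) + (h * R ^ l + i / R) =
      (y * S ^ (k - (l + 1)) + h) * R ^ l + i / R by ring,
      ih (by omega) (by rw [hS]; nlinarith) hiR, Finset.mul_sum]
    refine Finset.sum_congr rfl fun j _ => ?_
    rw [kronPow, Nat.mul_add_mod_of_lt hy, mul_add_div_of_lt hy, hS, mul_assoc]
    congr 3
    ring

theorem yates_eq_sum (M : ℕ → ℕ → ℤ) (R S k : ℕ) (u : ℕ → ℤ) {x : ℕ} (hx : x < R ^ k) :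
    yates M R S k u k x = ∑ j ∈ Finset.range (S ^ k), kronPow M R S k x j * u j := by
  have := yates_eq_sum_of_le M R S k u le_rfl (h := 0) (by simp) hx
  simpa using this

theorem abs_yates_le {M : ℕ → ℕ → ℤ} {R S H : ℕ} (hR : 0 < R)
    (hM : ∀ x < R, ∑ y ∈ Finset.range S, |M x y| ≤ H) (k : ℕ) {u : ℕ → ℤ} {U : ℤ}
    (hu : ∀ x, |u x| ≤ U) (l x : ℕ) : |yates M R S k u l x| ≤ (H : ℤ) ^ l * U := by
  have hU : 0 ≤ U := (abs_nonneg _).trans (hu 0)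
  induction l generalizing x with
  | zero => simpa [yates] using hu x
  | succ l ih =>
    rw [yates]
    split_ifs
    · refine (Finset.abs_sum_le_sum_abs _ _).trans ?_
      calc _ ≤ ∑ y ∈ Finset.range S, |M (x % R) y| * ((H : ℤ) ^ l * U) := by
            refine Finset.sum_le_sum fun y _ => ?_
            rw [abs_mul]
            exact mul_le_mul_of_nonneg_left (ih _) (abs_nonneg _)
        _ ≤ H * ((H : ℤ) ^ l * U) := by
            rw [← Finset.sum_mul]
            exact mul_le_mul_of_nonneg_right (hM _ (Nat.mod_lt _ hR)) (by positivity)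
        _ = _ := by ring
    · simp; positivity

/-! ### Pauli matrices -/

/-- The entry `(r, c)` of the `d`-th of the four matrices `1`, `X`, `XZ`, `Z`, where `X` swaps
the two coordinates and `Z` changes the sign of the second one. -/
def pauli (d r c : ℕ) : ℤ :=
  if d = 0 then (if r = c then 1 else 0)
  else if d = 1 then (if r = c then 0 else 1)
  else if d = 2 then (if r = c then 0 else if r = 0 then -1 else 1)
  else (if r = c then (if r = 0 then 1 else -1) else 0)

/-- `tr (P Q Tᵀ)` for three of the four matrices `pauli`.  Up to the factor `2`, this is the
coefficient at `T` of the product `P Q`. -/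
def pauliTrace (x y z : ℕ) : ℤ :=
  ∑ r ∈ Finset.range 2, ∑ s ∈ Finset.range 2, ∑ c ∈ Finset.range 2,
    pauli z r c * (pauli x r s * pauli y s c)

/-- The trace formula for tensor products of Pauli matrices. -/
theorem digitProd_pauliTrace (e x y z : ℕ) :
    digitProd pauliTrace 4 4 4 e x y z =
      ∑ r ∈ Finset.range (2 ^ e), ∑ s ∈ Finset.range (2 ^ e), ∑ c ∈ Finset.range (2 ^ e),
        digitProd pauli 4 2 2 e z r c *
          (digitProd pauli 4 2 2 e x r s * digitProd pauli 4 2 2 e y s c) := by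
  induction e generalizing x y z with
  | zero => simp [digitProd]
  | succ e ih =>
    have hd : ∀ w i j : ℕ, ∀ p ∈ Finset.range 2, ∀ q ∈ Finset.range 2,
        digitProd pauli 4 2 2 (e + 1) w (i * 2 + p) (j * 2 + q) =
          pauli (w % 4) p q * digitProd pauli 4 2 2 e (w / 4) i j := by
      intro w i j p hp q hq
      rw [Finset.mem_range] at hp hq
      rw [digitProd, Nat.mul_add_mod_of_lt hp, Nat.mul_add_mod_of_lt hq, mul_add_div_of_lt hp,
        mul_add_div_of_lt hq]
    rw [digitProd, ih, pow_succ]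
    simp only [sum_range_mul_eq]
    have h0 : 0 ∈ Finset.range 2 := by simp
    have h1 : 1 ∈ Finset.range 2 := by simp
    simp only [Finset.mul_sum, pauliTrace, Finset.sum_range_succ _ 1, Finset.sum_range_one,
      hd _ _ _ _ h0 _ h0, hd _ _ _ _ h0 _ h1, hd _ _ _ _ h1 _ h0, hd _ _ _ _ h1 _ h1,
      ← Finset.sum_add_distrib]
    refine Finset.sum_congr rfl fun r _ => Finset.sum_congr rfl fun s _ =>
      Finset.sum_congr rfl fun c _ => ?_
    ring

/-! ### Signed Pauli strings of the monomials -/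

/-- Parity of the number of binary digits `1`. -/
def parity (a : ℕ) : ℕ := if a = 0 then 0 else (parity (a / 2) + a % 2) % 2

/-- Number, modulo `4`, of the binary digits `1` in odd positions. -/
def oddCount (a : ℕ) : ℕ := if a = 0 then 0 else (oddCount (a / 4) + a % 4 / 2) % 4

/-- Right multiplication by `Z ^ p` on the indices of Pauli matrices. -/
def twist (d p : ℕ) : ℕ := d + p * (3 - 2 * d) - p * (2 * d - 3)

/-- The index of the Pauli string of `x_A` without its lowest digit. -/
def pauliIndex (a : ℕ) : ℕ :=
  if a = 0 then 0 else 4 * pauliIndex (a / 4) + twist (a % 4) (parity (a / 4))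

/-- The index of the Pauli string that represents `x_A` up to sign, for `a` the characteristic
number of `A`.  The generators are `x_{2l} = 1 ⊗ Z ⊗ ⋯ ⊗ Z ⊗ X ⊗ 1 ⊗ ⋯` and
`x_{2l+1} = XZ ⊗ Z ⊗ ⋯ ⊗ Z ⊗ XZ ⊗ 1 ⊗ ⋯`, so the first factor, a square root of `-1`,
takes care of the sign of the square of `XZ`. -/
def stringIndex (a : ℕ) : ℕ := 4 * pauliIndex a + 2 * (oddCount a % 2)

/-- The sign that goes with `stringIndex`. -/
def stringSign (a : ℕ) : ℤ := 1 - 2 * (oddCount a / 2 : ℕ)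

/-- The sign in `x_A x_B = ± x_{A ∆ B}`, in terms of characteristic numbers. -/
def mulSign (a b : ℕ) : ℤ :=
  if a = 0 then 1 else (-1) ^ (parity (a / 2) * (b % 2)) * mulSign (a / 2) (b / 2)

/-- Number of odd positions at which both numbers have the binary digit `1`. -/
def oddCommon (a b : ℕ) : ℕ :=
  if a = 0 then 0 else oddCommon (a / 4) (b / 4) + (a % 4 / 2) * (b % 4 / 2)

theorem parity_eq (a : ℕ) : parity a = (parity (a / 2) + a % 2) % 2 := by
  rcases eq_or_ne a 0 with rfl | h
  · simp [parity]
  · conv_lhs => rw [parity, if_neg h]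

theorem oddCount_eq (a : ℕ) : oddCount a = (oddCount (a / 4) + a % 4 / 2) % 4 := by
  rcases eq_or_ne a 0 with rfl | h
  · simp [oddCount]
  · conv_lhs => rw [oddCount, if_neg h]

theorem pauliIndex_eq (a : ℕ) :
    pauliIndex a = 4 * pauliIndex (a / 4) + twist (a % 4) (parity (a / 4)) := by
  rcases eq_or_ne a 0 with rfl | h
  · simp [pauliIndex, parity, twist]
  · conv_lhs => rw [pauliIndex, if_neg h]

theorem mulSign_eq (a b : ℕ) :
    mulSign a b = (-1) ^ (parity (a / 2) * (b % 2)) * mulSign (a / 2) (b / 2) := by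
  rcases eq_or_ne a 0 with rfl | h
  · simp [mulSign, parity]
  · conv_lhs => rw [mulSign, if_neg h]

theorem oddCommon_eq (a b : ℕ) :
    oddCommon a b = oddCommon (a / 4) (b / 4) + (a % 4 / 2) * (b % 4 / 2) := by
  rcases eq_or_ne a 0 with rfl | h
  · simp [oddCommon]
  · conv_lhs => rw [oddCommon, if_neg h]

theorem parity_lt (a : ℕ) : parity a < 2 := by
  rw [parity_eq]; exact Nat.mod_lt _ (by norm_num)

theorem oddCount_lt (a : ℕ) : oddCount a < 4 := by
  rw [oddCount_eq]; exact Nat.mod_lt _ (by norm_num)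

theorem twist_zero (d : ℕ) : twist d 0 = d := by simp [twist]

theorem twist_one {d : ℕ} (h : d < 4) : twist d 1 = 3 - d := by simp only [twist]; omega

theorem twist_lt {d p : ℕ} (hd : d < 4) (hp : p < 2) : twist d p < 4 := by
  interval_cases p
  · rw [twist_zero]; omega
  · rw [twist_one hd]; omega

theorem xor_mod_four (a b : ℕ) : (a ^^^ b) % 4 = (a % 4) ^^^ (b % 4) :=
  Nat.xor_mod_two_pow (n := 2)

theorem xor_div_four (a b : ℕ) : (a ^^^ b) / 4 = (a / 4) ^^^ (b / 4) :=
  Nat.xor_div_two_pow (n := 2)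

theorem parity_xor (a b : ℕ) : parity (a ^^^ b) = (parity a + parity b) % 2 := by
  induction a using Nat.strong_induction_on generalizing b with
  | _ a ih =>
    rcases eq_or_ne a 0 with rfl | h
    · have := parity_lt b
      rw [Nat.zero_xor, show parity 0 = 0 by simp [parity]]
      omega
    · rw [parity_eq (a ^^^ b), parity_eq a, parity_eq b, Nat.xor_div_two, ih _ (by omega),
        Nat.xor_mod_two_eq]
      omega

theorem oddCount_xor (a b : ℕ) :
    (oddCount a + oddCount b) % 4 = (oddCount (a ^^^ b) + 2 * oddCommon a b) % 4 := by
  induction a using Nat.strong_induction_on generalizing b with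
  | _ a ih =>
    rcases eq_or_ne a 0 with rfl | h
    · rw [Nat.zero_xor, oddCount, oddCommon, if_pos rfl, if_pos rfl]
      omega
    · have hdig : ∀ d < 4, ∀ d' < 4, d / 2 + d' / 2 = (d ^^^ d') / 2 + 2 * (d / 2 * (d' / 2)) := by
        decide
      have h1 := hdig (a % 4) (by omega) (b % 4) (by omega)
      have h2 := ih (a / 4) (by omega) (b / 4)
      rw [oddCount_eq a, oddCount_eq b, oddCount_eq (a ^^^ b), oddCommon_eq, xor_mod_four,
        xor_div_four, mul_add]
      omega

theorem mulSign_eq_four (a b : ℕ) :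
    mulSign a b = (-1) ^ (((parity (a / 4) + a % 4 / 2) % 2) * (b % 4 % 2) +
      parity (a / 4) * (b % 4 / 2)) * mulSign (a / 4) (b / 4) := by
  rw [mulSign_eq, mulSign_eq (a / 2), parity_eq (a / 2)]
  simp only [Nat.div_div_eq_div_mul]
  rw [show a / 2 % 2 = a % 4 / 2 by omega, show b / 2 % 2 = b % 4 / 2 by omega,
    show b % 4 % 2 = b % 2 by omega, pow_add]
  ring

/-- Multiplication of two Pauli matrices, each with a factor `Z` or not. -/
theorem pauliTrace_twist : ∀ p < 2, ∀ p' < 2, ∀ d < 4, ∀ d' < 4, ∀ d'' < 4,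
    pauliTrace (twist d p) (twist d' p') (twist d'' ((p + p') % 2)) =
      if d'' = d ^^^ d' then 2 * (-1) ^ ((((p + d / 2) % 2) * (d' % 2) + p * (d' / 2)) +
        d / 2 * (d' / 2)) else 0 := by
  decide

theorem digitProd_pauliIndex (m : ℕ) {a b c : ℕ} (ha : a < 4 ^ m) (hb : b < 4 ^ m)
    (hc : c < 4 ^ m) :
    digitProd pauliTrace 4 4 4 m (pauliIndex a) (pauliIndex b) (pauliIndex c) =
      if c = a ^^^ b then 2 ^ m * (mulSign a b * (-1) ^ oddCommon a b) else 0 := by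
  induction m generalizing a b c with
  | zero =>
    obtain rfl : a = 0 := by simpa using ha
    obtain rfl : b = 0 := by simpa using hb
    obtain rfl : c = 0 := by simpa using hc
    simp [digitProd, mulSign, oddCommon]
  | succ m ih =>
    have hmod : ∀ a, pauliIndex a % 4 = twist (a % 4) (parity (a / 4)) := fun a => by
      have := twist_lt (Nat.mod_lt a (by norm_num : 4 > 0)) (parity_lt (a / 4))
      rw [pauliIndex_eq]; omega
    have hdiv : ∀ a, pauliIndex a / 4 = pauliIndex (a / 4) := fun a => by
      have := twist_lt (Nat.mod_lt a (by norm_num : 4 > 0)) (parity_lt (a / 4))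
      rw [pauliIndex_eq]; omega
    rw [pow_succ] at ha hb hc
    rw [digitProd, hdiv, hdiv, hdiv, ih (by omega) (by omega) (by omega)]
    by_cases h : c / 4 = a / 4 ^^^ b / 4
    · rw [if_pos h, hmod, hmod, hmod, h, parity_xor,
        pauliTrace_twist _ (parity_lt _) _ (parity_lt _) _ (Nat.mod_lt _ (by norm_num)) _
          (Nat.mod_lt _ (by norm_num)) _ (Nat.mod_lt _ (by norm_num))]
      by_cases h' : c % 4 = a % 4 ^^^ b % 4
      · have hc' : c = a ^^^ b := by
          have h1 := xor_mod_four a b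
          have h2 := xor_div_four a b
          omega
        rw [if_pos h', if_pos hc', mulSign_eq_four a b, oddCommon_eq a b, pow_add _ _ (_ * _)]
        ring
      · have hc' : c ≠ a ^^^ b := by rintro rfl; exact h' (xor_mod_four a b)
        rw [if_neg h', if_neg hc', zero_mul]
    · have hc' : c ≠ a ^^^ b := by rintro rfl; exact h (xor_div_four a b)
      rw [if_neg h, if_neg hc', mul_zero]

/-- The structure constants of the Clifford algebra agree with those of Pauli strings. -/
theorem stringSign_mul_digitProd (m : ℕ) {a b c : ℕ} (ha : a < 4 ^ m) (hb : b < 4 ^ m)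
    (hc : c < 4 ^ m) :
    stringSign c * (stringSign a * stringSign b *
        digitProd pauliTrace 4 4 4 (m + 1) (stringIndex a) (stringIndex b) (stringIndex c)) =
      if c = a ^^^ b then 2 ^ (m + 1) * mulSign a b else 0 := by
  have hmod : ∀ a, stringIndex a % 4 = 2 * (oddCount a % 2) := fun a => by
    unfold stringIndex; omega
  have hdiv : ∀ a, stringIndex a / 4 = pauliIndex a := fun a => by
    unfold stringIndex; omega
  rw [digitProd, hdiv, hdiv, hdiv, digitProd_pauliIndex m ha hb hc]
  by_cases h : c = a ^^^ b
  · rw [if_pos h, if_pos h, hmod, hmod, hmod]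
    -- the first tensor factor: powers of a square root of `-1`
    have key : ∀ x < 4, ∀ y < 4, ∀ z < 4, ∀ t < 2, (x + y) % 4 = (z + 2 * t) % 4 →
        (1 - 2 * ((z / 2 : ℕ) : ℤ)) * ((1 - 2 * ((x / 2 : ℕ) : ℤ)) * (1 - 2 * ((y / 2 : ℕ) : ℤ)) *
          pauliTrace (2 * (x % 2)) (2 * (y % 2)) (2 * (z % 2))) = 2 * (-1) ^ t := by
      decide
    have hx := oddCount_xor a b
    rw [← h] at hx
    have := key _ (oddCount_lt a) _ (oddCount_lt b) _ (oddCount_lt c) (oddCommon a b % 2)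
      (Nat.mod_lt _ (by norm_num)) (by omega)
    have hsq : (-1 : ℤ) ^ oddCommon a b * (-1) ^ oddCommon a b = 1 := by
      rw [← mul_pow]; simp
    have hpow : (-1 : ℤ) ^ (oddCommon a b % 2) = (-1) ^ oddCommon a b :=
      (neg_one_pow_eq_pow_mod_two _).symm
    rw [hpow] at this
    unfold stringSign
    calc _ = ((1 - 2 * ((oddCount c / 2 : ℕ) : ℤ)) * ((1 - 2 * ((oddCount a / 2 : ℕ) : ℤ)) *
          (1 - 2 * ((oddCount b / 2 : ℕ) : ℤ)) * pauliTrace (2 * (oddCount a % 2))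
          (2 * (oddCount b % 2)) (2 * (oddCount c % 2)))) *
          (2 ^ m * (mulSign a b * (-1) ^ oddCommon a b)) := by ring
      _ = 2 ^ (m + 1) * mulSign a b * ((-1 : ℤ) ^ oddCommon a b * (-1) ^ oddCommon a b) := by
          rw [this]; ring
      _ = _ := by rw [hsq, mul_one]
  · rw [if_neg h, if_neg h]; ring

theorem pauliIndex_injective : Function.Injective pauliIndex := by
  have main : ∀ m, ∀ a < 4 ^ m, ∀ b < 4 ^ m, pauliIndex a = pauliIndex b → a = b := by
    intro m
    induction m with
    | zero => intro a ha b hb _; simp at ha hb; omega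
    | succ m ih =>
      intro a ha b hb hab
      rw [pow_succ] at ha hb
      rw [pauliIndex_eq a, pauliIndex_eq b] at hab
      have h1 := twist_lt (Nat.mod_lt a (by norm_num : 4 > 0)) (parity_lt (a / 4))
      have h2 := twist_lt (Nat.mod_lt b (by norm_num : 4 > 0)) (parity_lt (b / 4))
      have h4 : a / 4 = b / 4 := ih _ (by omega) _ (by omega) (by omega)
      rw [h4] at hab
      have hp := parity_lt (b / 4)
      interval_cases parity (b / 4)
      · rw [twist_zero, twist_zero] at hab; omega
      · rw [twist_one (by omega), twist_one (by omega)] at hab; omega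
  intro a b
  have h : ∀ x : ℕ, x < 4 ^ x := fun x => Nat.lt_pow_self (by norm_num)
  exact main (a + b) a ((h a).trans_le (Nat.pow_le_pow_right (by norm_num) (by omega))) b
    ((h b).trans_le (Nat.pow_le_pow_right (by norm_num) (by omega)))

theorem stringIndex_injective : Function.Injective stringIndex := fun a b h => by
  apply pauliIndex_injective
  unfold stringIndex at h
  omega

theorem pauliIndex_lt (m : ℕ) {a : ℕ} (ha : a < 4 ^ m) : pauliIndex a < 4 ^ m := by
  induction m generalizing a with
  | zero =>
    obtain rfl : a = 0 := by simpa using ha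
    simp [pauliIndex]
  | succ m ih =>
    rw [pow_succ] at ha ⊢
    have := ih (a := a / 4) (by omega)
    have h1 := twist_lt (Nat.mod_lt a (by norm_num : 4 > 0)) (parity_lt (a / 4))
    rw [pauliIndex_eq]
    omega

theorem stringIndex_lt (m : ℕ) {a : ℕ} (ha : a < 4 ^ m) : stringIndex a < 4 ^ (m + 1) := by
  have := pauliIndex_lt m ha
  rw [pow_succ]
  unfold stringIndex
  omega

/-! ### Products of monomials in the Clifford algebra -/

/-- The product of the `gᵢ` for which the `i`-th binary digit of `a` is `1`, in increasing order
of `i`. -/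
def bitProd {R : Type*} [Monoid R] : List R → ℕ → R
  | [], _ => 1
  | g :: l, a => g ^ (a % 2) * bitProd l (a / 2)

theorem bitProd_mul_of_anticomm {R : Type*} [Ring R] {g : R} :
    ∀ {l : List R} {a : ℕ}, (∀ x ∈ l, x * g = -(g * x)) → a < 2 ^ l.length →
      bitProd l a * g = (-1 : ℤ) ^ parity a • (g * bitProd l a)
  | [], a, _, ha => by
    obtain rfl : a = 0 := by simpa using ha
    simp [bitProd, parity]
  | x :: l, a, hl, ha => by
    rw [List.length_cons, pow_succ] at ha
    have ih := bitProd_mul_of_anticomm (g := g) (l := l) (a := a / 2)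
      (fun y hy => hl y (by simp [hy])) (by omega)
    have hx := hl x (by simp)
    rw [bitProd, mul_assoc, ih, parity_eq a, ← neg_one_pow_eq_pow_mod_two, pow_add,
      mul_smul_comm, mul_smul, ← mul_assoc (x ^ _), ← mul_assoc g]
    congr 1
    rcases Nat.mod_two_eq_zero_or_one a with h | h
    · simp [h]
    · simp [h, hx]

/-- The multiplication rule for products of anticommuting square roots of `1`. -/
theorem bitProd_mul_bitProd {R : Type*} [Ring R] :
    ∀ {l : List R} {a b : ℕ}, l.Pairwise (fun x y => y * x = -(x * y)) → (∀ x ∈ l, x * x = 1) →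
      a < 2 ^ l.length → bitProd l a * bitProd l b = mulSign a b • bitProd l (a ^^^ b)
  | [], a, b, _, _, ha => by
    obtain rfl : a = 0 := by simpa using ha
    simp [bitProd, mulSign]
  | g :: l, a, b, hl, hsq, ha => by
    rw [List.length_cons, pow_succ] at ha
    rw [List.pairwise_cons] at hl
    have ih := bitProd_mul_bitProd (b := b / 2) (a := a / 2) hl.2
      (fun y hy => hsq y (by simp [hy])) (by omega)
    have hg : g * g = 1 := hsq g (by simp)
    have hc := bitProd_mul_of_anticomm (g := g) (a := a / 2) hl.1 (by omega)
    have hc' : bitProd l (a / 2) * g ^ (b % 2) =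
        (-1 : ℤ) ^ (parity (a / 2) * (b % 2)) • (g ^ (b % 2) * bitProd l (a / 2)) := by
      rcases Nat.mod_two_eq_zero_or_one b with h | h
      · simp [h]
      · simp [h, hc]
    have hp : g ^ (a % 2) * g ^ (b % 2) = g ^ ((a ^^^ b) % 2) := by
      rw [Nat.xor_mod_two_eq, Nat.add_mod]
      rcases Nat.mod_two_eq_zero_or_one a with h | h <;>
        rcases Nat.mod_two_eq_zero_or_one b with h' | h' <;> simp [h, h', hg]
    simp only [bitProd]
    rw [mulSign_eq, Nat.xor_div_two, ← hp]
    calc _ = g ^ (a % 2) * (bitProd l (a / 2) * g ^ (b % 2)) * bitProd l (b / 2) := by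
          simp only [mul_assoc]
      _ = (-1 : ℤ) ^ (parity (a / 2) * (b % 2)) •
          (g ^ (a % 2) * g ^ (b % 2) * (bitProd l (a / 2) * bitProd l (b / 2))) := by
          rw [hc', mul_smul_comm, smul_mul_assoc]
          simp only [mul_assoc]
      _ = _ := by rw [ih, mul_smul_comm, smul_smul]

theorem Cl.gen_mul_self {n : ℕ} (i : Fin n) : Cl.gen i * Cl.gen i = 1 := by
  rw [Cl.gen, CliffordAlgebra.ι_sq_scalar, QuadraticMap.weightedSumSquares_apply]
  simp [Pi.single_apply]

theorem Cl.gen_mul_gen {n : ℕ} {i j : Fin n} (h : i ≠ j) :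
    Cl.gen j * Cl.gen i = -(Cl.gen i * Cl.gen j) := by
  rw [eq_neg_iff_add_eq_zero, Cl.gen, Cl.gen, CliffordAlgebra.ι_mul_ι_add_swap,
    QuadraticMap.polar]
  simp only [QuadraticMap.weightedSumSquares_apply, smul_eq_mul, one_mul, Pi.add_apply,
    ← Finset.sum_sub_distrib]
  rw [Finset.sum_eq_zero, map_zero]
  intro x _
  by_cases h1 : x = i
  · subst h1; simp [h]
  · simp [Pi.single_apply, h1]

/-- The number whose binary digits say which members of a list satisfy `p`. -/
def listCode {ι : Type*} (p : ι → Prop) [DecidablePred p] : List ι → ℕ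
  | [] => 0
  | i :: l => (if p i then 1 else 0) + 2 * listCode p l

theorem prod_map_filter_eq_bitProd {ι R : Type*} [Monoid R] (p : ι → Prop) [DecidablePred p]
    (g : ι → R) : ∀ l : List ι,
      ((l.filter (fun i => decide (p i))).map g).prod = bitProd (l.map g) (listCode p l)
  | [] => by simp [bitProd]
  | i :: l => by
    have ih := prod_map_filter_eq_bitProd p g l
    by_cases h : p i
    · simp only [List.filter_cons, h, decide_true, if_true, List.map_cons, List.prod_cons, ih,
        listCode, bitProd]
      rw [show (1 + 2 * listCode p l) % 2 = 1 by omega,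
        show (1 + 2 * listCode p l) / 2 = listCode p l by omega, pow_one]
    · simp only [List.filter_cons, h, decide_false, Bool.false_eq_true, if_false, ih, listCode,
        bitProd, List.map_cons]
      rw [show (0 + 2 * listCode p l) % 2 = 0 by omega,
        show (0 + 2 * listCode p l) / 2 = listCode p l by omega, pow_zero, one_mul]

theorem listCode_map {ι κ : Type*} (p : κ → Prop) [DecidablePred p] (f : ι → κ) :
    ∀ l : List ι, listCode p (l.map f) = listCode (fun i => p (f i)) l
  | [] => rfl
  | i :: l => by rw [List.map_cons, listCode, listCode, listCode_map p f l]

theorem listCode_finRange :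
    ∀ {n : ℕ} (p : Fin n → Prop) [DecidablePred p],
      listCode p (List.finRange n) = ∑ i : Fin n, if p i then 2 ^ (i : ℕ) else 0
  | 0, p, _ => rfl
  | n + 1, p, _ => by
    rw [List.finRange_succ, listCode, listCode_map, listCode_finRange, Fin.sum_univ_succ,
      Finset.mul_sum]
    simp [pow_succ', mul_ite]

theorem Cl.monomial_eq_bitProd {n : ℕ} (A : Finset (Fin n)) :
    Cl.monomial A = bitProd ((List.finRange n).map Cl.gen) (subsetAddr A) := by
  have hsort : A.sort (· ≤ ·) = (List.finRange n).filter (fun i => decide (i ∈ A)) := by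
    refine List.Perm.eq_of_pairwise' (r := (· ≤ ·)) (Finset.pairwise_sort A _) ?_ ?_
    · exact ((List.pairwise_le_finRange n).filter _)
    · rw [List.perm_ext_iff_of_nodup (Finset.sort_nodup _ _) ((List.nodup_finRange n).filter _)]
      simp
  rw [Cl.monomial, hsort, prod_map_filter_eq_bitProd (fun i => i ∈ A), listCode_finRange]
  simp [subsetAddr]

theorem subsetAddr_lt {n : ℕ} (A : Finset (Fin n)) : subsetAddr A < 2 ^ n := by
  have := Nat.geomSum_lt (m := 2) (n := n) (s := A.map Fin.valEmbedding) le_rfl (by simp)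
  rwa [Finset.sum_map] at this

theorem subsetAddr_injective {n : ℕ} : Function.Injective (subsetAddr (n := n)) := by
  intro A B h
  apply Finset.map_injective Fin.valEmbedding
  apply Finset.geomSum_injective (n := 2) le_rfl
  simpa [Finset.sum_map, subsetAddr] using h

theorem image_subsetAddr (n : ℕ) :
    (Finset.univ : Finset (Finset (Fin n))).image subsetAddr = Finset.range (2 ^ n) := by
  apply Finset.eq_of_subset_of_card_le
  · intro a ha
    obtain ⟨A, -, rfl⟩ := Finset.mem_image.1 ha
    exact Finset.mem_range.2 (subsetAddr_lt A)
  · rw [Finset.card_image_of_injective _ subsetAddr_injective]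
    simp

theorem sum_subsetAddr {M : Type*} [AddCommMonoid M] (n : ℕ) (F : ℕ → M) :
    ∑ A : Finset (Fin n), F (subsetAddr A) = ∑ a ∈ Finset.range (2 ^ n), F a := by
  rw [← image_subsetAddr, Finset.sum_image (fun _ _ _ _ h => subsetAddr_injective h)]

theorem Cl.ofCoeffs_subsetAddr {n : ℕ} (F : ℕ → ℤ) :
    Cl.ofCoeffs (fun A : Finset (Fin n) => F (subsetAddr A)) =
      ∑ a ∈ Finset.range (2 ^ n), F a • bitProd ((List.finRange n).map Cl.gen) a := by
  rw [← sum_subsetAddr n, Cl.ofCoeffs]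
  simp only [Cl.monomial_eq_bitProd]

/-- Multiplication in the Clifford algebra in terms of coefficient vectors. -/
theorem Cl.ofCoeffs_mul_ofCoeffs {n : ℕ} (F G H : ℕ → ℤ)
    (h : ∀ c < 2 ^ n, H c = ∑ a ∈ Finset.range (2 ^ n), ∑ b ∈ Finset.range (2 ^ n),
      F a * G b * if c = a ^^^ b then mulSign a b else 0) :
    Cl.ofCoeffs (fun C : Finset (Fin n) => H (subsetAddr C)) =
      Cl.ofCoeffs (fun A : Finset (Fin n) => F (subsetAddr A)) *
        Cl.ofCoeffs (fun B : Finset (Fin n) => G (subsetAddr B)) := by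
  set l := (List.finRange n).map (Cl.gen (n := n)) with hl
  have hlen : l.length = n := by simp [hl]
  have hpair : l.Pairwise (fun x y => y * x = -(x * y)) := by
    rw [hl, List.pairwise_map]
    exact (List.nodup_finRange n).imp fun hij => Cl.gen_mul_gen hij
  have hsq : ∀ x ∈ l, x * x = 1 := by
    intro x hx
    obtain ⟨i, -, rfl⟩ := List.mem_map.1 hx
    exact Cl.gen_mul_self i
  rw [Cl.ofCoeffs_subsetAddr, Cl.ofCoeffs_subsetAddr, Cl.ofCoeffs_subsetAddr, ← hl,
    Finset.sum_mul_sum]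
  rw [Finset.sum_congr rfl fun c hc => by rw [h c (Finset.mem_range.1 hc)]]
  simp only [Finset.sum_smul]
  rw [Finset.sum_comm]
  refine Finset.sum_congr rfl fun a ha => ?_
  rw [Finset.sum_comm]
  refine Finset.sum_congr rfl fun b hb => ?_
  rw [Finset.mem_range] at ha hb
  rw [Finset.sum_eq_single_of_mem (a ^^^ b) (Finset.mem_range.2 (Nat.xor_lt_two_pow ha hb))
    (fun c _ hc => by simp [hc]), if_pos rfl, smul_mul_smul_comm,
    bitProd_mul_bitProd hpair hsq (by rwa [hlen]), smul_smul]

/-! ### Bilinear complexity of matrix multiplication -/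

theorem hasBilinearMatMul_cube (N : ℕ) : HasBilinearMatMul N (N ^ 3) := by
  have e : Fin (N ^ 3) ≃ Fin N × Fin N × Fin N :=
    (Fintype.equivFinOfCardEq (by simp; ring)).symm
  refine ⟨fun k => Matrix.single (e k).1 (e k).2.1 1, fun k => Matrix.single (e k).2.1 (e k).2.2 1,
    fun k => Matrix.single (e k).1 (e k).2.2 1, fun A B => ?_⟩
  rw [e.sum_comp (fun x : Fin N × Fin N × Fin N =>
    ((∑ i, ∑ j, Matrix.single x.1 x.2.1 (1 : ℚ) i j * A i j) *
      (∑ i, ∑ j, Matrix.single x.2.1 x.2.2 (1 : ℚ) i j * B i j)) •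
        Matrix.single x.1 x.2.2 (1 : ℚ))]
  have key : ∀ (a b : Fin N) (M : Matrix (Fin N) (Fin N) ℚ),
      ∑ i, ∑ j, Matrix.single a b (1 : ℚ) i j * M i j = M a b := by
    intro a b M
    rw [Finset.sum_eq_single a (fun i _ hi => by simp [hi.symm])
      (by simp), Finset.sum_eq_single b (fun i _ hi => by simp [hi.symm])
      (by simp)]
    simp
  simp only [key, Fintype.sum_prod_type]
  ext i j
  simp only [Matrix.mul_apply, Matrix.sum_apply, Matrix.smul_apply, smul_eq_mul]
  symm
  rw [Finset.sum_eq_single i (fun x _ hx => by simp [hx]) (by simp)]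
  refine Finset.sum_congr rfl fun x _ => ?_
  rw [Finset.sum_eq_single j (fun y _ hy => by simp [hy]) (by simp)]
  simp

theorem hasBilinearMatMul_matMulRank (N : ℕ) : HasBilinearMatMul N (matMulRank N) :=
  Nat.sInf_mem (s := {r | HasBilinearMatMul N r}) ⟨_, hasBilinearMatMul_cube N⟩

/-- The rank of `⟨N, N, N⟩` is at least `N²`, since the matrices `γ k` span all matrices. -/
theorem HasBilinearMatMul.sq_le {N r : ℕ} (h : HasBilinearMatMul N r) : N ^ 2 ≤ r := by
  obtain ⟨α, β, γ, h⟩ := h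
  have htop : Submodule.span ℚ (Set.range γ) = ⊤ := by
    rw [eq_top_iff]
    rintro A -
    rw [← mul_one A, h A 1]
    exact Submodule.sum_mem _ fun k _ =>
      Submodule.smul_mem _ _ (Submodule.subset_span (Set.mem_range_self k))
  have := finrank_range_le_card (R := ℚ) γ
  rw [Set.finrank, htop, finrank_top, Module.finrank_matrix] at this
  simpa [sq] using this

open Filter in
/-- Since `τ` exceeds `ω`, the constant factor in the bound for the rank disappears for large
matrices; one matrix format is enough. -/
theorem exists_bilinear_of_matMulExponent_lt {τ : ℝ} (hτ : matMulExponent < τ) :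
    ∃ e r : ℕ, 0 < e ∧ HasBilinearMatMul (2 ^ e) r ∧ (r : ℝ) ≤ (2 : ℝ) ^ (τ * e) := by
  have hne : {τ : ℝ | (fun N : ℕ => (matMulRank N : ℝ)) =O[atTop]
      (fun N : ℕ => (N : ℝ) ^ τ)}.Nonempty := by
    refine ⟨3, Asymptotics.IsBigO.of_bound 1 (Eventually.of_forall fun N => ?_)⟩
    have h1 : matMulRank N ≤ N ^ 3 := Nat.sInf_le (hasBilinearMatMul_cube N)
    have h2 : (matMulRank N : ℝ) ≤ (N : ℝ) ^ 3 := by exact_mod_cast h1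
    rw [Real.norm_natCast, one_mul]
    refine h2.trans (le_trans ?_ (le_abs_self _))
    rw [← Real.rpow_natCast]
    norm_num
  obtain ⟨σ, hσ, hστ⟩ := exists_lt_of_csInf_lt hne hτ
  obtain ⟨C, hC⟩ := hσ.bound
  have htwo : Tendsto (fun e : ℕ => 2 ^ e) atTop (atTop : Filter ℕ) :=
    tendsto_pow_atTop_atTop_of_one_lt (by norm_num)
  have hgrow : Tendsto (fun e : ℕ => ((2 : ℝ) ^ (τ - σ)) ^ e) atTop atTop :=
    tendsto_pow_atTop_atTop_of_one_lt (Real.one_lt_rpow (by norm_num) (by linarith))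
  obtain ⟨e, ⟨he1, he2⟩, he3⟩ :=
    (((htwo.eventually hC).and (hgrow.eventually_ge_atTop C)).and (eventually_gt_atTop 0)).exists
  refine ⟨e, matMulRank (2 ^ e), he3, hasBilinearMatMul_matMulRank _, ?_⟩
  rw [Real.norm_natCast, Real.norm_of_nonneg (by positivity)] at he1
  refine he1.trans ?_
  have h2 : (0 : ℝ) < 2 := by norm_num
  have hcast : ((2 ^ e : ℕ) : ℝ) ^ σ = (2 : ℝ) ^ (σ * e) := by
    rw [Nat.cast_pow, Nat.cast_ofNat, ← Real.rpow_natCast, ← Real.rpow_mul h2.le, mul_comm]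
  rw [hcast]
  calc C * (2 : ℝ) ^ (σ * e) ≤ ((2 : ℝ) ^ (τ - σ)) ^ e * (2 : ℝ) ^ (σ * e) :=
        mul_le_mul_of_nonneg_right he2 (by positivity)
    _ = (2 : ℝ) ^ (τ * e) := by
        rw [← Real.rpow_natCast, ← Real.rpow_mul h2.le, ← Real.rpow_add h2]
        congr 1; ring

theorem exists_common_denominator {ι : Type*} [Finite ι] (φ : ι → ℚ) :
    ∃ d : ℕ, 0 < d ∧ ∃ ψ : ι → ℤ, ∀ i, (ψ i : ℚ) = d * φ i := by
  cases nonempty_fintype ι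
  refine ⟨∏ i, (φ i).den, Finset.prod_pos fun i _ => (φ i).pos,
    fun i => (φ i).num * ((∏ j, (φ j).den) / (φ i).den : ℕ), fun i => ?_⟩
  have hdvd : (φ i).den ∣ ∏ j, (φ j).den := Finset.dvd_prod_of_mem _ (Finset.mem_univ i)
  have hpos : ((φ i).den : ℚ) ≠ 0 := by exact_mod_cast (φ i).den_nz
  rw [Int.cast_mul, Int.cast_natCast, Nat.cast_div hdvd hpos]
  conv_rhs => rw [← Rat.num_div_den (φ i)]
  field_simp

/-- A bilinear algorithm for matrices, in the basis of Pauli strings and with integer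
coefficients. -/
theorem HasBilinearMatMul.exists_pauli {e r : ℕ} (h : HasBilinearMatMul (2 ^ e) r) :
    ∃ (α β γ : ℕ → ℕ → ℤ) (D : ℕ), 0 < D ∧ ∀ x < 4 ^ e, ∀ y < 4 ^ e, ∀ z < 4 ^ e,
      ∑ i ∈ Finset.range r, γ z i * (α i x * β i y) =
        D * digitProd pauliTrace 4 4 4 e x y z := by
  obtain ⟨a, b, c, h⟩ := h
  let E : ℕ → Matrix (Fin (2 ^ e)) (Fin (2 ^ e)) ℚ :=
    fun w => Matrix.of fun i j => (digitProd pauli 4 2 2 e w i j : ℚ)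
  obtain ⟨d₁, hd₁, α, hα⟩ := exists_common_denominator
    (fun q : Fin r × Fin (4 ^ e) => ∑ i, ∑ j, a q.1 i j * E q.2 i j)
  obtain ⟨d₂, hd₂, β, hβ⟩ := exists_common_denominator
    (fun q : Fin r × Fin (4 ^ e) => ∑ i, ∑ j, b q.1 i j * E q.2 i j)
  obtain ⟨d₃, hd₃, γ, hγ⟩ := exists_common_denominator
    (fun q : Fin r × Fin (4 ^ e) => ∑ i, ∑ j, E q.2 i j * c q.1 i j)
  refine ⟨fun i x => if hi : i < r ∧ x < 4 ^ e then α (⟨i, hi.1⟩, ⟨x, hi.2⟩) else 0,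
    fun i x => if hi : i < r ∧ x < 4 ^ e then β (⟨i, hi.1⟩, ⟨x, hi.2⟩) else 0,
    fun x i => if hi : i < r ∧ x < 4 ^ e then γ (⟨i, hi.1⟩, ⟨x, hi.2⟩) else 0,
    d₃ * (d₁ * d₂), by positivity, fun x hx y hy z hz => ?_⟩
  have htrace : (digitProd pauliTrace 4 4 4 e x y z : ℚ) =
      ∑ i, ∑ j, E z i j * (E x * E y) i j := by
    rw [digitProd_pauliTrace]
    push_cast
    simp only [Finset.sum_range, Matrix.mul_apply, Finset.mul_sum, E, Matrix.of_apply]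
    exact Finset.sum_congr rfl fun i _ => Finset.sum_comm
  have hexp : ∑ i, ∑ j, E z i j * (E x * E y) i j =
      ∑ k, (∑ i, ∑ j, E z i j * c k i j) *
        ((∑ i, ∑ j, a k i j * E x i j) * (∑ i, ∑ j, b k i j * E y i j)) := by
    have hcomm : ∀ F : Fin (2 ^ e) → Fin (2 ^ e) → Fin r → ℚ,
        ∑ i, ∑ j, ∑ k, F i j k = ∑ k, ∑ i, ∑ j, F i j k := fun F => by
      rw [Finset.sum_comm]
      exact (Finset.sum_congr rfl fun i _ => Finset.sum_comm).trans
        (Finset.sum_comm.trans (Finset.sum_congr rfl fun k _ => Finset.sum_comm))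
    rw [h]
    simp only [Matrix.sum_apply, Matrix.smul_apply, smul_eq_mul,
      Finset.mul_sum (s := (Finset.univ : Finset (Fin r)))]
    rw [hcomm]
    refine Finset.sum_congr rfl fun k _ => ?_
    generalize ∑ i, ∑ j, a k i j * E x i j = p
    generalize ∑ i, ∑ j, b k i j * E y i j = q
    rw [Finset.sum_mul]
    refine Finset.sum_congr rfl fun i _ => ?_
    rw [Finset.sum_mul]
    refine Finset.sum_congr rfl fun j _ => ?_
    ring
  have hq : ((∑ i ∈ Finset.range r,
      (if hi : i < r ∧ z < 4 ^ e then γ (⟨i, hi.1⟩, ⟨z, hi.2⟩) else 0) *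
      ((if hi : i < r ∧ x < 4 ^ e then α (⟨i, hi.1⟩, ⟨x, hi.2⟩) else 0) *
      (if hi : i < r ∧ y < 4 ^ e then β (⟨i, hi.1⟩, ⟨y, hi.2⟩) else 0)) : ℤ) : ℚ) =
      ((d₃ * (d₁ * d₂) : ℕ) * digitProd pauliTrace 4 4 4 e x y z : ℤ) := by
    push_cast
    rw [htrace, hexp, Finset.sum_range, Finset.mul_sum]
    refine Finset.sum_congr rfl fun i _ => ?_
    rw [dif_pos ⟨i.2, hz⟩, dif_pos ⟨i.2, hx⟩, dif_pos ⟨i.2, hy⟩, hα, hβ, hγ]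
    ring
  exact_mod_cast hq

/-! ### Interleaving rows and columns -/

/-- The number whose base-`4` digits are the binary digits of `x`. -/
def spread (x : ℕ) : ℕ := if x = 0 then 0 else 4 * spread (x / 2) + x % 2

/-- The number whose base-`4` digits are pairs of binary digits of `r` and `c`. -/
def interleave (r c : ℕ) : ℕ := 2 * spread r + spread c

theorem spread_eq (x : ℕ) : spread x = 4 * spread (x / 2) + x % 2 := by
  rcases eq_or_ne x 0 with rfl | h
  · simp [spread]
  · conv_lhs => rw [spread, if_neg h]

theorem interleave_mod (r c : ℕ) : interleave r c % 4 = 2 * (r % 2) + c % 2 := by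
  rw [interleave, spread_eq r, spread_eq c]; omega

theorem interleave_div (r c : ℕ) : interleave r c / 4 = interleave (r / 2) (c / 2) := by
  rw [interleave, interleave, spread_eq r, spread_eq c]; omega

theorem spread_lt (k : ℕ) {x : ℕ} (hx : x < 2 ^ k) : 3 * spread x < 4 ^ k := by
  induction k generalizing x with
  | zero =>
    obtain rfl : x = 0 := by simpa using hx
    simp [spread]
  | succ k ih =>
    rw [pow_succ] at hx ⊢
    have := ih (x := x / 2) (by omega)
    rw [spread_eq]
    omega

theorem interleave_lt (k : ℕ) {r c : ℕ} (hr : r < 2 ^ k) (hc : c < 2 ^ k) :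
    interleave r c < 4 ^ k := by
  have := spread_lt k hr
  have := spread_lt k hc
  rw [interleave]; omega

theorem interleave_injective (k : ℕ) {r c r' c' : ℕ} (hr : r < 2 ^ k) (hc : c < 2 ^ k)
    (hr' : r' < 2 ^ k) (hc' : c' < 2 ^ k) (h : interleave r c = interleave r' c') :
    r = r' ∧ c = c' := by
  induction k generalizing r c r' c' with
  | zero => simp at hr hc hr' hc'; omega
  | succ k ih =>
    rw [pow_succ] at hr hc hr' hc'
    have h1 := interleave_mod r c
    have h2 := interleave_div r c
    rw [h, interleave_mod] at h1
    rw [h, interleave_div] at h2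
    have := ih (r := r' / 2) (c := c' / 2) (r' := r / 2) (c' := c / 2) (by omega) (by omega)
      (by omega) (by omega) h2
    omega

theorem mul_add_lt_of_lt {N r c : ℕ} (hr : r < N) (hc : c < N) : r * N + c < N * N := by
  nlinarith

theorem interleave_divMod_injOn (k : ℕ) :
    Set.InjOn (fun z => interleave (z / 2 ^ k) (z % 2 ^ k)) (Set.Iio (2 ^ k * 2 ^ k)) := by
  intro z hz z' hz' h
  have hpos : 0 < 2 ^ k := by positivity
  obtain ⟨h1, h2⟩ := interleave_injective k ((Nat.div_lt_iff_lt_mul hpos).2 hz)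
    (Nat.mod_lt _ hpos) ((Nat.div_lt_iff_lt_mul hpos).2 hz') (Nat.mod_lt _ hpos) h
  rw [← Nat.div_add_mod z (2 ^ k), ← Nat.div_add_mod z' (2 ^ k), h1, h2]

/-- The `4 × 4` matrix that turns coordinates in the Pauli basis into matrix entries. -/
def pauliToEntry (i x : ℕ) : ℤ := pauli x (i / 2) (i % 2)

theorem pauliToEntry_interleave (r c : ℕ) (x : ℕ) :
    pauliToEntry (interleave r c % 4) x = pauli x (r % 2) (c % 2) := by
  rw [pauliToEntry, interleave_mod]
  congr 1 <;> omega

theorem kronPow_pauliToEntry (k r c x : ℕ) :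
    kronPow pauliToEntry 4 4 k (interleave r c) x = digitProd pauli 4 2 2 k x r c := by
  induction k generalizing r c x with
  | zero => rfl
  | succ k ih => rw [kronPow, digitProd, interleave_div, ih, pauliToEntry_interleave]

theorem kronPow_pauliToEntry_transpose (k r c x : ℕ) :
    kronPow (fun x i => pauliToEntry i x) 4 4 k x (interleave r c) =
      digitProd pauli 4 2 2 k x r c := by
  induction k generalizing r c x with
  | zero => rfl
  | succ k ih => rw [kronPow, digitProd, interleave_div, ih, pauliToEntry_interleave]

/-! ### Products in the Pauli basis -/

section

open Finset

/-- The product of `∑ u x P_x` and `∑ v y P_y`, with `P_x` the Pauli strings of length `k`: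
`2 ^ k` times its coefficient at `P_z`. -/
def pauliConv (k : ℕ) (u v : ℕ → ℤ) (z : ℕ) : ℤ :=
  ∑ x ∈ range (4 ^ k), ∑ y ∈ range (4 ^ k), u x * v y * digitProd pauliTrace 4 4 4 k x y z

/-- The product in the Pauli basis from a bilinear algorithm for strings of length `e`. -/
theorem sum_kronPow_mul_eq_pauliConv {α β γ : ℕ → ℕ → ℤ} {e R : ℕ} {D : ℤ}
    (h : ∀ x < 4 ^ e, ∀ y < 4 ^ e, ∀ z < 4 ^ e,
      ∑ i ∈ range R, γ z i * (α i x * β i y) = D * digitProd pauliTrace 4 4 4 e x y z)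
    (k : ℕ) (u v : ℕ → ℤ) (z : ℕ) :
    ∑ i ∈ range (R ^ k), kronPow γ (4 ^ e) R k z i *
        ((∑ x ∈ range ((4 ^ e) ^ k), kronPow α R (4 ^ e) k i x * u x) *
          ∑ y ∈ range ((4 ^ e) ^ k), kronPow β R (4 ^ e) k i y * v y) =
      D ^ k * pauliConv (e * k) u v z := by
  have key := sum_kronPow_mul α β γ _ R (4 ^ e) D (by positivity) h k
  simp only [pauliConv, sum_mul_sum, digitProd_mul]
  simp only [mul_sum]
  rw [sum_comm, pow_mul]
  refine sum_congr rfl fun x _ => ?_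
  rw [sum_comm]
  refine sum_congr rfl fun y _ => ?_
  rw [mul_left_comm, ← key, mul_sum]
  refine sum_congr rfl fun i _ => ?_
  ring

/-- The product in the Pauli basis from a product of matrices. -/
theorem sum_kronPow_matrix_eq_pauliConv (k : ℕ) (u v : ℕ → ℤ) (z : ℕ) :
    ∑ r ∈ range (2 ^ k), ∑ c ∈ range (2 ^ k),
        kronPow (fun x i => pauliToEntry i x) 4 4 k z (interleave r c) *
          ∑ s ∈ range (2 ^ k),
            (∑ x ∈ range (4 ^ k), kronPow pauliToEntry 4 4 k (interleave r s) x * u x) *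
              ∑ y ∈ range (4 ^ k), kronPow pauliToEntry 4 4 k (interleave s c) y * v y =
      pauliConv k u v z := by
  simp only [kronPow_pauliToEntry, kronPow_pauliToEntry_transpose, pauliConv,
    digitProd_pauliTrace]
  have hcomm : ∀ (F : ℕ → ℕ → ℕ → ℕ → ℕ → ℤ) (a b c d e : Finset ℕ),
      ∑ i ∈ a, ∑ j ∈ b, ∑ l ∈ c, ∑ x ∈ d, ∑ y ∈ e, F i j l x y =
        ∑ x ∈ d, ∑ y ∈ e, ∑ i ∈ a, ∑ j ∈ b, ∑ l ∈ c, F i j l x y := by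
    intro F a b c d e
    simp only [← sum_product']
    exact sum_bij' (fun p _ => (p.2.2.2.1, p.2.2.2.2, p.1, p.2.1, p.2.2.1))
      (fun p _ => (p.2.2.1, p.2.2.2.1, p.2.2.2.2, p.1, p.2.1))
      (by simp +contextual) (by simp +contextual) (by simp) (by simp) (by simp)
  simp only [sum_mul_sum]
  simp only [mul_sum]
  rw [hcomm]
  refine sum_congr rfl fun x _ => sum_congr rfl fun y _ => sum_congr rfl fun r _ => ?_
  rw [sum_comm]
  refine sum_congr rfl fun s _ => sum_congr rfl fun c _ => ?_
  ring

theorem sum_range_scatter {N M : ℕ} (addr : ℕ → ℕ) (w : ℕ → ℤ) (K : ℕ → ℤ)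
    (haddr : ∀ a < N, addr a < M) :
    ∑ x ∈ range M, (∑ a ∈ range N, if addr a = x then w a else 0) * K x =
      ∑ a ∈ range N, w a * K (addr a) := by
  simp only [sum_mul]
  rw [sum_comm]
  refine sum_congr rfl fun a ha => ?_
  rw [sum_eq_single_of_mem (addr a) (mem_range.2 (haddr a (mem_range.1 ha)))
    (fun x _ hx => by simp [hx.symm]), if_pos rfl]

/-- The coefficients of the Clifford product are read off from the product of the signed Pauli
strings. -/
theorem stringSign_mul_pauliConv {n m : ℕ} (hn : 2 ^ n ≤ 4 ^ m) (F G : ℕ → ℤ) {c : ℕ}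
    (hc : c < 2 ^ n) :
    stringSign c * pauliConv (m + 1)
        (fun x => ∑ a ∈ range (2 ^ n), if stringIndex a = x then stringSign a * F a else 0)
        (fun y => ∑ b ∈ range (2 ^ n), if stringIndex b = y then stringSign b * G b else 0)
        (stringIndex c) =
      2 ^ (m + 1) * ∑ a ∈ range (2 ^ n), ∑ b ∈ range (2 ^ n),
        F a * G b * if c = a ^^^ b then mulSign a b else 0 := by
  have hlt : ∀ a < 2 ^ n, stringIndex a < 4 ^ (m + 1) := fun a ha =>
    stringIndex_lt m (ha.trans_le hn)
  unfold pauliConv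
  simp only [mul_assoc, ← mul_sum]
  rw [sum_range_scatter _ _ _ hlt, mul_sum, mul_sum]
  refine sum_congr rfl fun a ha => ?_
  rw [sum_range_scatter _ _ _ hlt, mul_sum, mul_sum, mul_sum, mul_sum]
  refine sum_congr rfl fun b hb => ?_
  have := stringSign_mul_digitProd m ((mem_range.1 ha).trans_le hn)
    ((mem_range.1 hb).trans_le hn) (hc.trans_le hn)
  calc _ = F a * G b * (stringSign c * (stringSign a * stringSign b *
        digitProd pauliTrace 4 4 4 (m + 1) (stringIndex a) (stringIndex b) (stringIndex c))) := by
        ring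
    _ = _ := by
        rw [this]
        split_ifs <;> ring

/-! ### Matrix multiplication takes at least quadratic time -/

theorem eval_le_mul_pow (q : Polynomial ℕ) (m : ℕ) :
    q.eval m ≤ q.eval 1 * (m + 1) ^ q.natDegree := by
  rw [Polynomial.eval_eq_sum_range, Polynomial.eval_eq_sum_range, sum_mul]
  refine sum_le_sum fun i hi => ?_
  rw [one_pow, mul_one]
  refine Nat.mul_le_mul_left _ ((Nat.pow_le_pow_left (Nat.le_succ m) i).trans ?_)
  exact Nat.pow_le_pow_right (by omega) (by rw [mem_range] at hi; omega)

theorem entryAddr_injective {N : ℕ} : Function.Injective (entryAddr (N := N)) := by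
  rintro ⟨i, j⟩ ⟨i', j'⟩ h
  simp only [entryAddr] at h
  have hN : 0 < N := i.pos
  have h1 : (i : ℕ) = i' := by
    have := congrArg (· / N) h
    simpa only [mul_add_div_of_lt j.2, mul_add_div_of_lt j'.2] using this
  have h2 : (j : ℕ) = j' := by rw [h1] at h; omega
  rw [Fin.ext h1, Fin.ext h2]

open Filter Topology in
/-- All `4 ^ m` entries of a product can be nonzero, and each of them has to be written.  So the
`2 ^ n` steps that handle the coefficient vectors of Clifford elements fit into the time
`2 ^ (τ n / 2)`. -/
theorem two_le_of_intMatMulInTime {τ : ℝ} (h : IntMatMulInTime τ) : 2 ≤ τ := by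
  obtain ⟨P, hP⟩ := h
  obtain ⟨q, hq⟩ := hP 1
  -- the product of two all-ones matrices has no zero entry, so all cells have to be written
  have key : ∀ m : ℕ, (4 : ℝ) ^ m ≤ (q.eval m : ℕ) * (2 : ℝ) ^ (τ * m) := by
    intro m
    obtain ⟨t, s, hex, hs, ht⟩ := hq m (Matrix.of fun _ _ => 1) (Matrix.of fun _ _ => 1)
      (by simp [RAM.bits_one]) (by simp [RAM.bits_one])
    obtain ⟨Z, hZ, hZ'⟩ := hex.card_changed_le 2
    have hsub : (univ : Finset (Fin (2 ^ m) × Fin (2 ^ m))).image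
        (fun x => (entryAddr x : ℤ)) ⊆ Z := by
      intro z hz
      obtain ⟨⟨i, j⟩, -, rfl⟩ := mem_image.1 hz
      by_contra hn
      have h1 := hZ' _ hn
      rw [hs] at h1
      simp [RAM.input, Matrix.mul_apply] at h1
    have hcard := (card_le_card hsub).trans hZ
    rw [card_image_of_injective _ (fun x y h => entryAddr_injective (Nat.cast_injective h))]
      at hcard
    simp only [card_univ, Fintype.card_prod, Fintype.card_fin, ← mul_pow] at hcard
    refine le_trans ?_ ht
    exact_mod_cast hcard
  by_contra hτ
  push Not at hτ
  have hb : 1 < (2 : ℝ) ^ (2 - τ) := Real.one_lt_rpow (by norm_num) (by linarith)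
  set b := (2 : ℝ) ^ (2 - τ) with hbdef
  have hle : ∀ m : ℕ, b ^ m ≤ (q.eval 1 : ℕ) * ((m + 1 : ℕ) : ℝ) ^ q.natDegree := by
    intro m
    have h1 : (4 : ℝ) ^ m = b ^ m * (2 : ℝ) ^ (τ * m) := by
      rw [hbdef, ← Real.rpow_natCast (_ ^ (2 - τ)), ← Real.rpow_mul (by norm_num),
        ← Real.rpow_add (by norm_num), show (4 : ℝ) = 2 ^ (2 : ℝ) by norm_num,
        ← Real.rpow_natCast, ← Real.rpow_mul (by norm_num)]
      congr 1; ring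
    have h2 : b ^ m ≤ (q.eval m : ℕ) := by
      have := key m
      rw [h1] at this
      exact le_of_mul_le_mul_right this (by positivity)
    exact h2.trans (by exact_mod_cast eval_le_mul_pow q m)
  have hlim : Tendsto (fun m : ℕ => ((q.eval 1 : ℕ) * b) *
      (((m + 1 : ℕ) : ℝ) ^ q.natDegree / b ^ (m + 1))) atTop (𝓝 (((q.eval 1 : ℕ) * b) * 0)) :=
    ((tendsto_pow_const_div_const_pow_of_one_lt q.natDegree hb).comp
      (tendsto_add_atTop_nat 1)).const_mul _
  rw [mul_zero] at hlim
  obtain ⟨m, hm⟩ := (hlim.eventually_lt_const one_pos).exists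
  have h0 : 0 < b := by linarith
  have h3 := hle m
  have : (q.eval 1 : ℕ) * b * (((m + 1 : ℕ) : ℝ) ^ q.natDegree / b ^ (m + 1)) =
      (q.eval 1 : ℕ) * ((m + 1 : ℕ) : ℝ) ^ q.natDegree / b ^ m := by
    rw [pow_succ]; field_simp
  rw [this, div_lt_one (by positivity)] at hm
  exact absurd hm (not_lt.2 h3)

end

/-! ### The phases of the program -/

namespace RAM

/-- State after the preparatory phase: the size parameters are in registers, and the arrays `3`,
`4`, `5` contain powers of `2`, `R` and `S`.

Here `n` is the number of generators and `k` the number of levels of Yates' algorithm; `R` is the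
number of multiplications and `S` the number of Pauli strings in one block, and `Q ^ k` is the
denominator in the end.  In the whole program, register `5` is the loop counter and register `8`
the length of the tables of powers; the arrays `7`, `8`, `9` tabulate `parity`, `oddCount` and
`pauliIndex`, the arrays `10` and `11` hold the operands as Pauli strings, `12` and `13` their
transforms, `14` the product of the transforms and `15` its transform. -/
structure Setup (s : State) (n k R S Q : ℕ) : Prop where
  reg0 : s.reg 0 = n
  reg1 : s.reg 1 = k
  reg2 : s.reg 2 = (2 ^ n : ℕ)
  reg3 : s.reg 3 = ((k + 1) * R ^ k : ℕ)
  reg4 : s.reg 4 = (R ^ k : ℕ)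
  reg6 : s.reg 6 = (Q ^ k : ℕ)
  arr3 : s.arr 3 = table (fun i => (2 ^ i : ℕ)) (n + k + 1)
  arr4 : s.arr 4 = table (fun i => (R ^ i : ℕ)) (n + k + 1)
  arr5 : s.arr 5 = table (fun i => (S ^ i : ℕ)) (n + k + 1)

theorem Setup.step {s : State} {n k R S Q : ℕ} (h : Setup s n k R S Q) (j : ℕ) {b : ℕ}
    (hb : b ≠ 3 ∧ b ≠ 4 ∧ b ≠ 5) (f : ℤ → ℤ) : Setup (s.step j b f) n k R S Q := by
  constructor <;> simp [h.reg0, h.reg1, h.reg2, h.reg3, h.reg4, h.reg6, h.arr3, h.arr4, h.arr5,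
    hb.1.symm, hb.2.1.symm, hb.2.2.symm]

theorem table_div {v : ℕ → ℤ} (hv : v 0 = 0) (j : ℕ) {d : ℕ} (hd : 1 < d) :
    table v j ((j : ℤ) / (d : ℤ)) = v (j / d) := by
  rw [← Int.natCast_div, table_natCast]
  split_ifs with h
  · rfl
  · rcases Nat.eq_zero_or_pos j with rfl | hj
    · simp [hv]
    · exact absurd (Nat.div_lt_self hj hd) h

/-- Tabulates the powers of `c` in the array `b`. -/
def powTable (b c : ℕ) : Cmd :=
  forStore 8 b (.reg 5) (.lit c * .cell b (.reg 5 - 1) + .bin .lt (.reg 5) 1)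

theorem powTable_runs {s : State} {B N X b : ℕ} (hs : s.Bounded B)
    (hX : (N + 1) * (B + 1) ^ 2 ≤ X) (hN : s.reg 8 = N) (hb : b < 100) (h0 : s.arr b = 0) (c : ℕ)
    (hc : ∀ j < N, c ^ j < 2 ^ B) :
    Runs (powTable b c) s ((powTable b c).factor * X)
      (s.step N b (table (fun i => (c ^ i : ℕ)) N)) ∧
    (s.step N b (table (fun i => (c ^ i : ℕ)) N)).Bounded B := by
  refine fill_runs hs hX (by norm_num) hN (by norm_num) (by simp [hb]) h0 _
    (fun j hj => bits_natCast_le (hc j hj)) fun j hj => ?_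
  rcases j with _ | j
  · simp [table]
  · have h1 : ((j + 1 : ℕ) : ℤ) - 1 = (j : ℤ) := by push_cast; ring
    simp only [Expr.eval_add, Expr.eval_mul, Expr.eval_lit, Expr.eval_cell, Expr.eval_sub,
      Expr.eval_reg, Expr.eval_lt, Expr.eval_ofNat, State.step_reg, State.step_arr, if_true,
      Nat.cast_one, h1, table_of_lt _ (Nat.lt_succ_self j)]
    rw [if_neg (by push_cast; omega)]
    push_cast
    ring

/-- Tabulates `parity`. -/
def parityTable : Cmd := forStore 2 7 (.reg 5) ((.cell 7 (.reg 5 / 2) + .reg 5 % 2) % 2)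

/-- Tabulates `oddCount`. -/
def oddCountTable : Cmd := forStore 2 8 (.reg 5) ((.cell 8 (.reg 5 / 4) + .reg 5 % 4 / 2) % 4)

/-- Tabulates `pauliIndex`. -/
def pauliIndexTable : Cmd :=
  forStore 2 9 (.reg 5) (4 * .cell 9 (.reg 5 / 4) +
    (.reg 5 % 4 + .cell 7 (.reg 5 / 4) * (3 - 2 * (.reg 5 % 4))))

theorem parityTable_runs {s : State} {B N X : ℕ} (hs : s.Bounded B)
    (hX : (N + 1) * (B + 1) ^ 2 ≤ X) (hN : s.reg 2 = N) (h0 : s.arr 7 = 0) (hB : 1 < B) :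
    Runs parityTable s (parityTable.factor * X)
      (s.step N 7 (table (fun a => parity a) N)) ∧
    (s.step N 7 (table (fun a => parity a) N)).Bounded B := by
  refine fill_runs hs hX (by norm_num) hN (by norm_num) (by simp) h0 _
    (fun j _ => bits_natCast_le ((parity_lt j).trans_le ?_)) fun j hj => ?_
  · exact Nat.le_self_pow (by omega) 2
  · have := table_div (v := fun a => (parity a : ℤ)) (by simp [parity]) j one_lt_two
    push_cast at this
    simp only [Expr.eval_add, Expr.eval_cell, Expr.eval_div, Expr.eval_mod, Expr.eval_reg,
      Expr.eval_ofNat, State.step_reg, State.step_arr, if_true, Nat.cast_ofNat, this]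
    rw [parity_eq j]
    push_cast
    rfl

theorem oddCountTable_runs {s : State} {B N X : ℕ} (hs : s.Bounded B)
    (hX : (N + 1) * (B + 1) ^ 2 ≤ X) (hN : s.reg 2 = N) (h0 : s.arr 8 = 0) (hB : 1 < B) :
    Runs oddCountTable s (oddCountTable.factor * X)
      (s.step N 8 (table (fun a => oddCount a) N)) ∧
    (s.step N 8 (table (fun a => oddCount a) N)).Bounded B := by
  refine fill_runs hs hX (by norm_num) hN (by norm_num) (by simp) h0 _
    (fun j _ => bits_natCast_le ((oddCount_lt j).trans_le ?_)) fun j hj => ?_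
  · exact (Nat.pow_le_pow_right (n := 2) two_pos hB :)
  · have := table_div (v := fun a => (oddCount a : ℤ)) (by simp [oddCount]) j
      (show 1 < 4 by norm_num)
    push_cast at this
    simp only [Expr.eval_add, Expr.eval_cell, Expr.eval_div, Expr.eval_mod, Expr.eval_reg,
      Expr.eval_ofNat, State.step_reg, State.step_arr, if_true, Nat.cast_ofNat, this]
    rw [oddCount_eq j]
    push_cast
    rfl

theorem twist_cast {d p : ℕ} (hd : d < 4) (hp : p < 2) :
    (twist d p : ℤ) = d + p * (3 - 2 * d) := by
  interval_cases p
  · rw [twist_zero]; simp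
  · rw [twist_one hd]; omega

theorem pauliIndexTable_runs {s : State} {B N X : ℕ} (hs : s.Bounded B)
    (hX : (N + 1) * (B + 1) ^ 2 ≤ X) (hN : s.reg 2 = N) (h0 : s.arr 9 = 0)
    (h7 : s.arr 7 = table (fun a => parity a) N) (hB : ∀ j < N, pauliIndex j < 2 ^ B) :
    Runs pauliIndexTable s (pauliIndexTable.factor * X)
      (s.step N 9 (table (fun a => pauliIndex a) N)) ∧
    (s.step N 9 (table (fun a => pauliIndex a) N)).Bounded B := by
  refine fill_runs hs hX (by norm_num) hN (by norm_num) (by simp) h0 _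
    (fun j hj => bits_natCast_le (hB j hj)) fun j hj => ?_
  have h9 := table_div (v := fun a => (pauliIndex a : ℤ)) (by simp [pauliIndex]) j
    (show 1 < 4 by norm_num)
  have h7' : table (fun a => (parity a : ℤ)) N ((j : ℤ) / 4) = parity (j / 4) := by
    rw [show (j : ℤ) / 4 = ((j / 4 : ℕ) : ℤ) by norm_cast]
    exact table_of_lt _ (by omega)
  push_cast at h9
  simp only [Expr.eval_add, Expr.eval_mul, Expr.eval_sub, Expr.eval_cell, Expr.eval_div,
    Expr.eval_mod, Expr.eval_reg, Expr.eval_ofNat, State.step_reg, State.step_arr, if_true,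
    Nat.cast_ofNat, h9]
  rw [if_neg (by norm_num), h7, h7', pauliIndex_eq j]
  push_cast
  rw [twist_cast (Nat.mod_lt _ (by norm_num)) (parity_lt _)]
  push_cast
  rfl

/-- The address of the Pauli string that belongs to the counter. -/
def stringIndexExpr : Expr := 4 * .cell 9 (.reg 5) + 2 * (.cell 8 (.reg 5) % 2)

/-- The sign of the Pauli string that belongs to the counter. -/
def stringSignExpr : Expr := 1 - 2 * (.cell 8 (.reg 5) / 2)

theorem eval_stringIndexExpr {s : State} {N j b : ℕ} {f : ℤ → ℤ} (hj : j < N)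
    (h8 : s.arr 8 = table (fun a => oddCount a) N)
    (h9 : s.arr 9 = table (fun a => pauliIndex a) N) (hb8 : b ≠ 8) (hb9 : b ≠ 9) :
    stringIndexExpr.eval (s.step j b f) = stringIndex j := by
  simp only [stringIndexExpr, Expr.eval_add, Expr.eval_mul, Expr.eval_cell, Expr.eval_mod,
    Expr.eval_reg, Expr.eval_ofNat, State.step_reg, State.step_arr, if_true, if_neg hb8.symm,
    if_neg hb9.symm, h8, h9, table_of_lt _ hj, stringIndex]
  push_cast
  rfl

theorem eval_stringSignExpr {s : State} {N j b : ℕ} {f : ℤ → ℤ} (hj : j < N)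
    (h8 : s.arr 8 = table (fun a => oddCount a) N) (hb8 : b ≠ 8) :
    stringSignExpr.eval (s.step j b f) = stringSign j := by
  simp only [stringSignExpr, Expr.eval_sub, Expr.eval_mul, Expr.eval_cell, Expr.eval_div,
    Expr.eval_reg, Expr.eval_ofNat, State.step_reg, State.step_arr, if_true, if_neg hb8.symm, h8,
    table_of_lt _ hj, stringSign]
  push_cast
  rfl

theorem low_stringIndexExpr : stringIndexExpr.Low := by simp [stringIndexExpr]

theorem low_stringSignExpr : stringSignExpr.Low := by simp [stringSignExpr]

theorem natAbs_stringSign_mul (a : ℕ) (z : ℤ) : (stringSign a * z).natAbs = z.natAbs := by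
  have := oddCount_lt a
  rw [Int.natAbs_mul]
  unfold stringSign
  interval_cases oddCount a <;> simp

/-- Writes the coefficients in the array `src` to the addresses of their Pauli strings. -/
def scatterStrings (src dst : ℕ) : Cmd :=
  forStore 2 dst stringIndexExpr (stringSignExpr * .cell src (.reg 5))

theorem scatterStrings_runs {s : State} {B N X src dst : ℕ} (hs : s.Bounded B)
    (hX : (N + 1) * (B + 1) ^ 2 ≤ X) (hN : s.reg 2 = N)
    (h8 : s.arr 8 = table (fun a => oddCount a) N)
    (h9 : s.arr 9 = table (fun a => pauliIndex a) N) (hdst : 9 < dst) (hsrc : src < 2)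
    (h0 : s.arr dst = 0) (F : ℕ → ℤ) (hF : ∀ j < N, s.arr src j = F j) :
    Runs (scatterStrings src dst) s ((scatterStrings src dst).factor * X)
      (s.step N dst (scatter stringIndex (fun a => stringSign a * F a) N)) ∧
    (s.step N dst (scatter stringIndex (fun a => stringSign a * F a) N)).Bounded B := by
  refine scatter_runs hs hX (by norm_num) hN (by norm_num) low_stringIndexExpr h0 _
    (stringIndex_injective.injOn) _ (fun j hj => ?_) (fun j hj => ?_) (fun j hj => ?_)
    (fun j hj hb => ?_)
  · rw [bits, natAbs_stringSign_mul, ← hF j hj]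
    exact hs.arr src (by omega) _
  · exact eval_stringIndexExpr hj h8 h9 (by omega) (by omega)
  · rw [Expr.eval_mul, eval_stringSignExpr hj h8 (by omega)]
    simp [show src ≠ dst by omega, hF j hj]
  · refine Expr.Low.small hb ?_
    simp [low_stringSignExpr]
    omega

/-- One entry in the table of all levels of Yates' algorithm. -/
def yatesExpr (M : ℕ → ℕ → ℤ) (R S pR pS src dst : ℕ) : Expr :=
  .bin .lt (.reg 5 / .reg 4) 1 * .cell src (.reg 5 % .reg 4) +
    .bin .lt 0 (.reg 5 / .reg 4) *
      .bin .lt (.reg 5 % .reg 4)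
        (.lit R * (.cell pR (.reg 5 / .reg 4 - 1) * .cell pS (.reg 1 - .reg 5 / .reg 4))) *
      Expr.sum (fun y =>
        Expr.sum (fun i => Expr.isEq (.reg 5 % .reg 4 % .lit R) (.lit i) * .lit (M i y)) R *
          .cell dst ((.reg 5 / .reg 4 - 1) * .reg 4 + (.lit y *
            (.cell pR (.reg 5 / .reg 4 - 1) * .cell pS (.reg 1 - .reg 5 / .reg 4)) +
              .reg 5 % .reg 4 / .lit R))) S

theorem low_yatesExpr (M : ℕ → ℕ → ℤ) (R S : ℕ) {pR pS src dst : ℕ}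
    (hlow : pR < 100 ∧ pS < 100 ∧ src < 100 ∧ dst < 100) :
    (yatesExpr M R S pR pS src dst).Low := by
  simp only [yatesExpr, Expr.low_add, Expr.low_mul, Expr.low_lt, Expr.low_div, Expr.low_mod,
    Expr.low_reg, Expr.low_cell, Expr.low_sub, Expr.low_ofNat, Expr.low_lit]
  refine ⟨⟨by norm_num, hlow.2.2.1, by norm_num⟩, ⟨⟨by norm_num, by norm_num, by simp, by
    simp [hlow]⟩, Expr.low_sum (fun y => ?_) S⟩⟩
  refine ⟨Expr.low_sum (fun i => by simp) R, ?_⟩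
  simp [hlow]

theorem eval_yatesExpr {s : State} {A k R S N pR pS src dst g : ℕ} {M : ℕ → ℕ → ℤ}
    (h1 : s.reg 1 = k) (h4 : s.reg 4 = A) (hR : 0 < R)
    (hpR : s.arr pR = table (fun i => (R ^ i : ℕ)) N)
    (hpS : s.arr pS = table (fun i => (S ^ i : ℕ)) N) (hN : k < N)
    (hA : ∀ l ≤ k, R ^ l * S ^ (k - l) ≤ A) (hne : pR ≠ dst ∧ pS ≠ dst ∧ src ≠ dst) (u : ℕ → ℤ)
    (hu : ∀ x < A, s.arr src x = u x) (hg : g < (k + 1) * A) :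
    (yatesExpr M R S pR pS src dst).eval
      (s.step g dst (table (fun g => yates M R S k u (g / A) (g % A)) g)) =
    yates M R S k u (g / A) (g % A) := by
  have hl : g / A ≤ k :=
    Nat.lt_succ_iff.1 (Nat.div_lt_of_lt_mul (by rwa [mul_comm] at hg))
  have hApos : 0 < A := Nat.pos_of_ne_zero (by rintro rfl; simp at hg)
  have hx : g % A < A := Nat.mod_lt _ hApos
  have hg' : g = g / A * A + g % A := by rw [mul_comm]; exact (Nat.div_add_mod g A).symm
  have ediv : (g : ℤ) / (A : ℤ) = ((g / A : ℕ) : ℤ) := by norm_cast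
  have emod : (g : ℤ) % (A : ℤ) = ((g % A : ℕ) : ℤ) := by norm_cast
  simp only [yatesExpr, Expr.eval_add, Expr.eval_mul, Expr.eval_sub, Expr.eval_cell,
    Expr.eval_div, Expr.eval_mod, Expr.eval_reg, Expr.eval_ofNat, Expr.eval_lt, Expr.eval_lit,
    Expr.eval_sum, Expr.eval_isEq, State.step_reg, State.step_arr, if_true, if_neg hne.1,
    if_neg hne.2.1, if_neg hne.2.2, hpR, hpS, h1, h4, ediv, emod, Nat.cast_one, Nat.cast_zero,
    show ¬ (4 = 5) by norm_num, show ¬ (1 = 5) by norm_num, if_false, hu _ hx]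
  generalize hlg : g / A = l at *
  generalize g % A = x at *
  rcases l with _ | l
  · simp [yates]
  · have e1 : ((l + 1 : ℕ) : ℤ) - 1 = (l : ℤ) := by push_cast; ring
    have e2 : (k : ℤ) - ((l + 1 : ℕ) : ℤ) = ((k - (l + 1) : ℕ) : ℤ) := by omega
    have e3 : ¬ (((l + 1 : ℕ) : ℤ) < 1) := by push_cast; omega
    have e4 : (0 : ℤ) < ((l + 1 : ℕ) : ℤ) := by push_cast; omega
    have e5 : (x : ℤ) % (R : ℤ) = ((x % R : ℕ) : ℤ) := by norm_cast
    have e6 : (x : ℤ) / (R : ℤ) = ((x / R : ℕ) : ℤ) := by norm_cast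
    simp only [e1, e2, e3, e4, e5, e6, if_false, if_true, zero_mul, zero_add, one_mul,
      table_of_lt _ (show l < N by omega), table_of_lt _ (show k - (l + 1) < N by omega)]
    rw [yates]
    set L := R ^ l * S ^ (k - (l + 1)) with hL
    have hRL : R ^ (l + 1) * S ^ (k - (l + 1)) = R * L := by rw [hL, pow_succ]; ring
    have hcast : ((x : ℤ) < (R : ℤ) * (((R ^ l : ℕ) : ℤ) * ((S ^ (k - (l + 1)) : ℕ) : ℤ))) ↔
        x < R * L := by rw [hL]; norm_cast
    rw [hRL]
    by_cases hxL : x < R * L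
    · rw [if_pos (hcast.2 hxL), if_pos hxL, one_mul]
      refine Finset.sum_congr rfl fun y hy => ?_
      rw [Finset.mem_range] at hy
      have hsel : ∑ i ∈ Finset.range R,
          (if ((x % R : ℕ) : ℤ) = (i : ℤ) then (1 : ℤ) else 0) * M i y = M (x % R) y := by
        rw [Finset.sum_eq_single_of_mem (x % R) (Finset.mem_range.2 (Nat.mod_lt _ hR))]
        · simp
        · intro i _ hi
          rw [if_neg (by exact_mod_cast hi.symm), zero_mul]
      -- the address read lies in the segment of the previous level
      have hread : y * L + x / R < A := by
        have h5 : x / R < L := by rwa [Nat.div_lt_iff_lt_mul hR, mul_comm]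
        have h6 := hA l (by omega)
        rw [show k - l = (k - (l + 1)) + 1 by omega, pow_succ] at h6
        have h7 : S * L ≤ A := by rw [hL]; linarith
        nlinarith
      have haddr : (l : ℤ) * (A : ℤ) + ((y : ℤ) * (((R ^ l : ℕ) : ℤ) *
          ((S ^ (k - (l + 1)) : ℕ) : ℤ)) + ((x / R : ℕ) : ℤ)) =
          ((l * A + (y * L + x / R) : ℕ) : ℤ) := by
        rw [hL]; push_cast; ring
      rw [hsel, haddr, table_of_lt _ (by rw [hg']; nlinarith), mul_add_div_of_lt hread,
        Nat.mul_add_mod_of_lt hread]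
    · rw [if_neg (fun h => hxL (hcast.1 h)), if_neg hxL, zero_mul]

/-- Applies the `k`-th Kronecker power of the `R × S` matrix `M` to the vector in the array
`src`.  The vector after `l` levels is written to the array `dst` from address `l * r₄` on. -/
def yatesTable (M : ℕ → ℕ → ℤ) (R S pR pS src dst : ℕ) : Cmd :=
  forStore 3 dst (.reg 5) (yatesExpr M R S pR pS src dst)

theorem yatesTable_runs {s : State} {B X A k R S N pR pS src dst : ℕ} {M : ℕ → ℕ → ℤ}
    (hs : s.Bounded B) (hX : ((k + 1) * A + 1) * (B + 1) ^ 2 ≤ X) (h1 : s.reg 1 = k)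
    (h3 : s.reg 3 = ((k + 1) * A : ℕ)) (h4 : s.reg 4 = A) (hR : 0 < R)
    (hpR : s.arr pR = table (fun i => (R ^ i : ℕ)) N)
    (hpS : s.arr pS = table (fun i => (S ^ i : ℕ)) N) (hN : k < N)
    (hA : ∀ l ≤ k, R ^ l * S ^ (k - l) ≤ A) (hlow : pR < 100 ∧ pS < 100 ∧ src < 100 ∧ dst < 100)
    (hne : pR ≠ dst ∧ pS ≠ dst ∧ src ≠ dst) (h0 : s.arr dst = 0) (u : ℕ → ℤ)
    (hu : ∀ x < A, s.arr src x = u x) (hB : ∀ l ≤ k, ∀ x, bits (yates M R S k u l x) ≤ B) :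
    Runs (yatesTable M R S pR pS src dst) s ((yatesTable M R S pR pS src dst).factor * X)
      (s.step ((k + 1) * A) dst
        (table (fun g => yates M R S k u (g / A) (g % A)) ((k + 1) * A))) ∧
    (s.step ((k + 1) * A) dst
        (table (fun g => yates M R S k u (g / A) (g % A)) ((k + 1) * A))).Bounded B := by
  have hlk : ∀ j < (k + 1) * A, j / A ≤ k := fun j hj =>
    Nat.lt_succ_iff.1 (Nat.div_lt_of_lt_mul (by rwa [mul_comm] at hj))
  exact fill_runs hs hX (by norm_num) h3 (by norm_num) (low_yatesExpr M R S hlow) h0 _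
    (fun j hj => hB _ (hlk j hj) _)
    fun g hg => eval_yatesExpr h1 h4 hR hpR hpS hN hA hne u hu hg

/-- Reads off the coefficients of the product. -/
def readCoeffs : Cmd :=
  forStore 2 2 (.reg 5)
    (stringSignExpr * .cell 15 (.reg 1 * .reg 4 + stringIndexExpr) / .reg 6)

theorem readCoeffs_runs {s : State} {B N X k A D : ℕ} (hs : s.Bounded B)
    (hX : (N + 1) * (B + 1) ^ 2 ≤ X) (h1 : s.reg 1 = k) (hN : s.reg 2 = N) (h4 : s.reg 4 = A)
    (h6 : s.reg 6 = D) (h8 : s.arr 8 = table (fun a => oddCount a) N)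
    (h9 : s.arr 9 = table (fun a => pauliIndex a) N) (h0 : s.arr 2 = 0) (Y : ℕ → ℤ)
    (hY : ∀ a < N, s.arr 15 (k * A + stringIndex a : ℕ) = Y a) :
    Runs readCoeffs s (readCoeffs.factor * X)
      (s.step N 2 (table (fun a => stringSign a * Y a / D) N)) := by
  refine (fill_runs hs hX (by norm_num) hN (by norm_num) ?_ h0 _
    (fun j hj => ?_) fun j hj => ?_).1
  · simp [low_stringSignExpr, low_stringIndexExpr]
  · have h15 := hs.arr 15 (by norm_num) (k * A + stringIndex j : ℕ)
    rw [hY j hj] at h15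
    rw [bits_le_iff] at h15 ⊢
    refine (Int.natAbs_ediv_le_natAbs _ _).trans_lt ?_
    rwa [natAbs_stringSign_mul]
  · rw [Expr.eval_div, Expr.eval_mul, eval_stringSignExpr hj h8 (by norm_num), Expr.eval_cell,
      Expr.eval_add, eval_stringIndexExpr hj h8 h9 (by norm_num) (by norm_num)]
    simp only [Expr.eval_mul, Expr.eval_reg, State.step_reg, State.step_arr, h1, h4, h6,
      show ¬ (1 = 5) by norm_num, show ¬ (4 = 5) by norm_num, show ¬ (6 = 5) by norm_num,
      show ¬ (15 = 2) by norm_num, if_false]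
    rw [← hY j hj]
    push_cast
    rfl

end RAM

/-! ### Assembling the program -/

namespace RAM

/-- Computes the size parameters and the tables of powers. -/
def setupProg (e R S Q : ℕ) : Cmd :=
  .seq (.assign 1 ((.reg 0 / 2 + 2) / .lit e + 1)) <| .seq (.assign 8 (.reg 0 + .reg 1 + 1)) <|
  .seq (powTable 3 2) <| .seq (powTable 4 R) <| .seq (powTable 5 S) <| .seq (powTable 6 Q) <|
  .seq (.assign 2 (.cell 3 (.reg 0))) <| .seq (.assign 4 (.cell 4 (.reg 1))) <|
  .seq (.assign 6 (.cell 6 (.reg 1))) (.assign 3 ((.reg 1 + 1) * .reg 4))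

theorem setupProg_runs (e R S Q : ℕ) : ∀ (n k B X : ℕ) (s : State),
    s.Bounded B → s.reg 0 = n → (∀ x ≠ 0, s.reg x = 0) → (∀ a, 2 ≤ a → s.arr a = 0) →
    k = (n / 2 + 2) / e + 1 → (n + k + 2) * (B + 1) ^ 2 ≤ X → n + k + 1 < 2 ^ B →
    (k + 1) * R ^ k < 2 ^ B → (∀ j < n + k + 1, 2 ^ j < 2 ^ B) →
    (∀ j < n + k + 1, R ^ j < 2 ^ B) → (∀ j < n + k + 1, S ^ j < 2 ^ B) →
    (∀ j < n + k + 1, Q ^ j < 2 ^ B) →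
    ∃ s', Runs (setupProg e R S Q) s ((setupProg e R S Q).factor * X) s' ∧
      s'.Bounded B ∧ Setup s' n k R S Q ∧ s'.arr 0 = s.arr 0 ∧ s'.arr 1 = s.arr 1 ∧ s'.arr 2 = 0 ∧ (∀ a, 7 ≤ a → s'.arr a = 0) ∧
      (∀ x, 9 ≤ x → s'.reg x = 0) := by
  intro n k B X s hs h0 hreg harr hk hX hn hkR h2 hR hS hQ
  have hX0 : (B + 1) ^ 2 ≤ X := le_trans (Nat.le_mul_of_pos_left _ (by omega)) hX
  have hXN : (n + k + 1 + 1) * (B + 1) ^ 2 ≤ X := hX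
  have b1 : bits ((k : ℕ) : ℤ) ≤ B := bits_natCast_le (by omega)
  have r1 := runs_assign (s := s) (e := (.reg 0 / 2 + 2) / .lit e + 1) hX0 1
    (v := (k : ℤ)) (Expr.Low.small hs (by simp)) (by
      simp [h0, hk])
  have B1 := hs.set 1 b1
  have r2 := runs_assign (s := s.set 1 k) (e := .reg 0 + .reg 1 + 1) hX0 8
    (v := ((n + k + 1 : ℕ) : ℤ)) (Expr.Low.small B1 (by simp)) (by simp [h0])
  have B2 := B1.set 8 (bits_natCast_le hn)
  obtain ⟨r3, B3⟩ := powTable_runs B2 hXN (by simp) (b := 3) (by norm_num)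
    (by simp [harr]) 2 h2
  obtain ⟨r4, B4⟩ := powTable_runs B3 hXN (by simp) (b := 4) (by norm_num)
    (by simp [harr]) R hR
  obtain ⟨r5, B5⟩ := powTable_runs B4 hXN (by simp) (b := 5) (by norm_num)
    (by simp [harr]) S hS
  obtain ⟨r6, B6⟩ := powTable_runs B5 hXN (by simp) (b := 6) (by norm_num)
    (by simp [harr]) Q hQ
  have r7 := runs_assign (e := .cell 3 (.reg 0)) hX0 2 (v := ((2 ^ n : ℕ) : ℤ))
    (Expr.Low.small B6 (by simp)) (by
      simp only [Expr.eval_cell, Expr.eval_reg]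
      simp [h0, table_of_lt _ (show n < n + k + 1 by omega)])
  have B7 := B6.set 2 (bits_natCast_le (h2 n (by omega)))
  have r8 := runs_assign (e := .cell 4 (.reg 1)) hX0 4 (v := ((R ^ k : ℕ) : ℤ))
    (Expr.Low.small B7 (by simp)) (by
      simp only [Expr.eval_cell, Expr.eval_reg]
      simp [table_of_lt _ (show k < n + k + 1 by omega)])
  have B8 := B7.set 4 (bits_natCast_le (hR k (by omega)))
  have r9 := runs_assign (e := .cell 6 (.reg 1)) hX0 6 (v := ((Q ^ k : ℕ) : ℤ))
    (Expr.Low.small B8 (by simp)) (by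
      simp only [Expr.eval_cell, Expr.eval_reg]
      simp [table_of_lt _ (show k < n + k + 1 by omega)])
  have B9 := B8.set 6 (bits_natCast_le (hQ k (by omega)))
  have r10 := runs_assign (e := (.reg 1 + 1) * .reg 4) hX0 3
    (v := (((k + 1) * R ^ k : ℕ) : ℤ)) (Expr.Low.small B9 (by simp)) (by simp)
  have B10 := B9.set 3 (bits_natCast_le hkR)
  refine ⟨_, r1.seq_factor <| r2.seq_factor <| r3.seq_factor <| r4.seq_factor <| r5.seq_factor <|
    r6.seq_factor <| r7.seq_factor <| r8.seq_factor <| r9.seq_factor r10,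
    B10, ?_, ?_, ?_, ?_, ?_, ?_⟩
  · constructor <;> simp [h0]
  · simp
  · simp
  · simp [harr]
  · intro a ha
    simp [show a ≠ 3 by omega, show a ≠ 4 by omega, show a ≠ 5 by omega,
      show a ≠ 6 by omega, harr a (by omega)]
  · intro x hx
    simp [show x ≠ 1 by omega, show x ≠ 2 by omega, show x ≠ 3 by omega,
      show x ≠ 4 by omega, show x ≠ 5 by omega, show x ≠ 6 by omega, show x ≠ 8 by omega,
      hreg x (by omega)]

/-- The state before the multiplication proper: the transforms of `u` by the Kronecker powers
of `α` and of `v` by those of `β` are in the arrays `12` and `13`, from address `k * R ^ k`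
on. -/
structure Ready (s : State) (n k R S Q : ℕ) (α β : ℕ → ℕ → ℤ) (u v : ℕ → ℤ) : Prop
    extends Setup s n k R S Q where
  arr2 : s.arr 2 = 0
  arr8 : s.arr 8 = table (fun a => oddCount a) (2 ^ n)
  arr9 : s.arr 9 = table (fun a => pauliIndex a) (2 ^ n)
  arr12 : s.arr 12 =
    table (fun g => yates α R S k u (g / R ^ k) (g % R ^ k)) ((k + 1) * R ^ k)
  arr13 : s.arr 13 =
    table (fun g => yates β R S k v (g / R ^ k) (g % R ^ k)) ((k + 1) * R ^ k)
  arr_zero : ∀ a, 14 ≤ a → s.arr a = 0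
  reg_zero : ∀ x, 9 ≤ x → s.reg x = 0

/-- Passes from coefficients to Pauli strings and applies the transforms. -/
def frontProg (R S : ℕ) (α β : ℕ → ℕ → ℤ) : Cmd :=
  .seq parityTable <| .seq oddCountTable <| .seq pauliIndexTable <|
  .seq (scatterStrings 0 10) <| .seq (scatterStrings 1 11) <|
  .seq (yatesTable α R S 4 5 10 12) (yatesTable β R S 4 5 11 13)

/-- The vector of the Pauli strings of the element with coefficients `F`. -/
def stringVector (n : ℕ) (F : ℕ → ℤ) (x : ℕ) : ℤ :=
  ∑ a ∈ Finset.range (2 ^ n), if stringIndex a = x then stringSign a * F a else 0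

theorem frontProg_runs {R S : ℕ} (hR : 0 < R) (α β : ℕ → ℕ → ℤ) :
    ∀ (n k B X Q : ℕ) (s : State) (F G : ℕ → ℤ),
    s.Bounded B → Setup s n k R S Q → s.arr 2 = 0 → (∀ a, 7 ≤ a → s.arr a = 0) →
    (∀ x, 9 ≤ x → s.reg x = 0) → (∀ a < 2 ^ n, s.arr 0 (a : ℕ) = F a) →
    (∀ a < 2 ^ n, s.arr 1 (a : ℕ) = G a) →
    (2 ^ n + 1) * (B + 1) ^ 2 ≤ X → ((k + 1) * R ^ k + 1) * (B + 1) ^ 2 ≤ X → 1 < B →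
    (∀ j < 2 ^ n, pauliIndex j < 2 ^ B) → (∀ l ≤ k, R ^ l * S ^ (k - l) ≤ R ^ k) →
    (∀ l ≤ k, ∀ x, bits (yates α R S k (stringVector n F) l x) ≤ B) →
    (∀ l ≤ k, ∀ x, bits (yates β R S k (stringVector n G) l x) ≤ B) →
    ∃ s', Runs (frontProg R S α β) s ((frontProg R S α β).factor * X) s' ∧ s'.Bounded B ∧
      Ready s' n k R S Q α β (stringVector n F) (stringVector n G) := by
  intro n k B X Q s F G hs hset h2 harr hreg hF hG hX hXk hB hidx hA hyα hyβ
  obtain ⟨r1, B1⟩ := parityTable_runs hs hX hset.reg2 (harr 7 le_rfl) hB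
  have S1 := hset.step (2 ^ n) (b := 7) (by norm_num) (table (fun a => parity a) (2 ^ n))
  obtain ⟨r2, B2⟩ := oddCountTable_runs B1 hX S1.reg2 (by simp [harr]) hB
  have S2 := S1.step (2 ^ n) (b := 8) (by norm_num) (table (fun a => oddCount a) (2 ^ n))
  obtain ⟨r3, B3⟩ := pauliIndexTable_runs B2 hX S2.reg2 (by simp [harr]) (by simp) hidx
  have S3 := S2.step (2 ^ n) (b := 9) (by norm_num) (table (fun a => pauliIndex a) (2 ^ n))
  obtain ⟨r4, B4⟩ := scatterStrings_runs (src := 0) (dst := 10) B3 hX S3.reg2 (by simp)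
    (by simp) (by norm_num) (by norm_num) (by simp [harr]) F (by simpa using hF)
  have S4 := S3.step (2 ^ n) (b := 10) (by norm_num)
    (scatter stringIndex (fun a => stringSign a * F a) (2 ^ n))
  obtain ⟨r5, B5⟩ := scatterStrings_runs (src := 1) (dst := 11) B4 hX S4.reg2 (by simp)
    (by simp) (by norm_num) (by norm_num) (by simp [harr]) G (by simpa using hG)
  have S5 := S4.step (2 ^ n) (b := 11) (by norm_num)
    (scatter stringIndex (fun a => stringSign a * G a) (2 ^ n))
  obtain ⟨r6, B6⟩ := yatesTable_runs (src := 10) (dst := 12) (M := α) B5 hXk S5.reg1 S5.reg3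
    S5.reg4 hR S5.arr4 S5.arr5 (by omega) hA (by norm_num) (by norm_num) (by simp [harr])
    (stringVector n F) (fun x _ => by simp [scatter_natCast, stringVector]) hyα
  have S6 := S5.step ((k + 1) * R ^ k) (b := 12) (by norm_num)
    (table (fun g => yates α R S k (stringVector n F) (g / R ^ k) (g % R ^ k))
      ((k + 1) * R ^ k))
  obtain ⟨r7, B7⟩ := yatesTable_runs (src := 11) (dst := 13) (M := β) B6 hXk S6.reg1 S6.reg3
    S6.reg4 hR S6.arr4 S6.arr5 (by omega) hA (by norm_num) (by norm_num) (by simp [harr])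
    (stringVector n G) (fun x _ => by simp [scatter_natCast, stringVector]) hyβ
  have S7 := S6.step ((k + 1) * R ^ k) (b := 13) (by norm_num)
    (table (fun g => yates β R S k (stringVector n G) (g / R ^ k) (g % R ^ k))
      ((k + 1) * R ^ k))
  refine ⟨_, r1.seq_factor <| r2.seq_factor <| r3.seq_factor <| r4.seq_factor <| r5.seq_factor <|
    r6.seq_factor r7, B7, ⟨S7, ?_, ?_, ?_, ?_, ?_, ?_, ?_⟩⟩
  · simp [h2]
  · simp
  · simp
  · simp
  · simp
  · intro a ha
    simp [show a ≠ 7 by omega, show a ≠ 8 by omega, show a ≠ 9 by omega,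
      show a ≠ 10 by omega, show a ≠ 11 by omega, show a ≠ 12 by omega,
      show a ≠ 13 by omega, harr a (by omega)]
  · intro x hx
    simp [show x ≠ 5 by omega, hreg x hx]

end RAM

/-! ### Running times and bit lengths -/

/-- `T n` is at most a polynomial in `n` times `2 ^ (τ n / 2)`. -/
def PolyTime (τ : ℝ) (T : ℕ → ℕ) : Prop :=
  ∃ q : Polynomial ℕ, ∀ n, (T n : ℝ) ≤ (q.eval n : ℕ) * (2 : ℝ) ^ (τ * n / 2)

namespace PolyTime

variable {τ : ℝ} {T₁ T₂ : ℕ → ℕ}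

theorem add (h₁ : PolyTime τ T₁) (h₂ : PolyTime τ T₂) : PolyTime τ (fun n => T₁ n + T₂ n) := by
  obtain ⟨q₁, h₁⟩ := h₁
  obtain ⟨q₂, h₂⟩ := h₂
  refine ⟨q₁ + q₂, fun n => ?_⟩
  have := add_le_add (h₁ n) (h₂ n)
  rw [Polynomial.eval_add]
  push_cast
  linarith

theorem of_le_mul (h₁ : PolyTime τ T₁) (q : Polynomial ℕ) (h : ∀ n, T₂ n ≤ q.eval n * T₁ n) :
    PolyTime τ T₂ := by
  obtain ⟨q₁, h₁⟩ := h₁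
  refine ⟨q * q₁, fun n => ?_⟩
  have h2 : (T₂ n : ℝ) ≤ (q.eval n : ℕ) * (T₁ n : ℝ) := by exact_mod_cast h n
  rw [Polynomial.eval_mul, Nat.cast_mul, mul_assoc]
  exact h2.trans (mul_le_mul_of_nonneg_left (h₁ n) (Nat.cast_nonneg _))

theorem mul_eval (h₁ : PolyTime τ T₁) (q : Polynomial ℕ) :
    PolyTime τ (fun n => q.eval n * T₁ n) :=
  h₁.of_le_mul q fun _ => le_rfl

theorem two_pow (hτ : 2 ≤ τ) : PolyTime τ (fun n => 2 ^ n) := by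
  refine ⟨1, fun n => ?_⟩
  rw [Polynomial.eval_one, Nat.cast_one, one_mul, Nat.cast_pow, Nat.cast_ofNat,
    ← Real.rpow_natCast]
  apply Real.rpow_le_rpow_of_exponent_le one_le_two
  have : (0 : ℝ) ≤ n := Nat.cast_nonneg n
  nlinarith

end PolyTime

/-- The number of levels in Yates' algorithm for blocks of `e` Pauli matrices.  The resulting
strings of length `e * levels e n` have room for one factor for each pair of generators and for
the additional factor of the signs. -/
def levels (e n : ℕ) : ℕ := (n / 2 + 2) / e + 1

theorem lt_mul_levels {e : ℕ} (he : 0 < e) (n : ℕ) : n / 2 + 2 < e * levels e n := by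
  rw [levels]
  have := Nat.lt_mul_div_succ (n / 2 + 2) he
  exact this

theorem mul_levels_le (e n : ℕ) : e * levels e n ≤ n / 2 + 2 + e := by
  rw [levels, mul_add, mul_one]
  have := Nat.mul_div_le (n / 2 + 2) e
  omega

theorem levels_le (e n : ℕ) : levels e n ≤ n + 3 := by
  rw [levels]
  have := Nat.div_le_self (n / 2 + 2) e
  omega

/-- Rounding up to a whole number of blocks changes the time only by a constant factor. -/
theorem polyTime_pow_levels {τ : ℝ} {e R : ℕ} (hτ : 0 ≤ τ) (hR : (R : ℝ) ≤ (2 : ℝ) ^ (τ * e)) :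
    PolyTime τ (fun n => R ^ levels e n) := by
  refine ⟨Polynomial.C ⌈(2 : ℝ) ^ (τ * (2 + e))⌉₊, fun n => ?_⟩
  rw [Polynomial.eval_C, Nat.cast_pow]
  have h1 : ((e * levels e n : ℕ) : ℝ) ≤ n / 2 + 2 + e := by
    have h2 : ((e * levels e n : ℕ) : ℝ) ≤ ((n / 2 + 2 + e : ℕ) : ℝ) := by
      exact_mod_cast mul_levels_le e n
    have h3 : ((n / 2 : ℕ) : ℝ) ≤ (n : ℝ) / 2 := by exact_mod_cast Nat.cast_div_le
    push_cast at h2 ⊢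
    linarith
  calc (R : ℝ) ^ levels e n ≤ ((2 : ℝ) ^ (τ * e)) ^ levels e n :=
        pow_le_pow_left₀ (Nat.cast_nonneg R) hR _
    _ = (2 : ℝ) ^ (τ * (e * levels e n : ℕ)) := by
        rw [← Real.rpow_natCast, ← Real.rpow_mul zero_le_two]
        push_cast
        ring_nf
    _ ≤ (2 : ℝ) ^ (τ * (2 + e) + τ * n / 2) := by
        apply Real.rpow_le_rpow_of_exponent_le one_le_two
        nlinarith
    _ = (2 : ℝ) ^ (τ * (2 + e)) * (2 : ℝ) ^ (τ * n / 2) := Real.rpow_add two_pos _ _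
    _ ≤ _ := mul_le_mul_of_nonneg_right (Nat.le_ceil _) (by positivity)

/-- A bound for the bit lengths of all integers in the computation: `n` generators, `k` levels,
coefficients of `p` bits, and constants of `c` bits. -/
def bitBound (c n k p : ℕ) : ℕ := (4 * c + 8) * (n + k + 1) + 3 * p

theorem pow_lt_two_pow_bitBound {c n k p b j : ℕ} (hb : b ≤ 2 ^ c) (hj : j < n + k + 1) :
    b ^ j < 2 ^ bitBound c n k p := by
  refine (Nat.pow_le_pow_left hb j).trans_lt ?_
  rw [← pow_mul]
  apply Nat.pow_lt_pow_right one_lt_two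
  rw [bitBound]
  nlinarith

theorem bits_le_bitBound {c n k p a : ℕ} {z : ℤ} (hz : |z| ≤ 2 ^ a)
    (ha : a ≤ 3 * (c * k) + 3 * p + k) : RAM.bits z ≤ bitBound c n k p := by
  refine RAM.bits_le_of_abs (hz.trans_lt ?_)
  apply pow_lt_pow_right₀ one_lt_two
  rw [bitBound]
  nlinarith [Nat.zero_le (c * n), Nat.zero_le (c * k)]

theorem bits_yates_le_bitBound {M : ℕ → ℕ → ℤ} {R S c n k p w : ℕ} (hR : 0 < R)
    (hM : ∀ x < R, ∑ y ∈ Finset.range S, |M x y| ≤ (2 ^ c : ℕ)) {u : ℕ → ℤ}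
    (hu : ∀ x, |u x| ≤ 2 ^ w) (hw : w ≤ 2 * (c * k + p) + k) {l : ℕ} (hl : l ≤ k) (x : ℕ) :
    RAM.bits (yates M R S k u l x) ≤ bitBound c n k p := by
  refine bits_le_bitBound (a := c * k + w) ?_ (by omega)
  refine (abs_yates_le hR hM k hu l x).trans ?_
  push_cast
  rw [← pow_mul, ← pow_add]
  apply pow_le_pow_right₀ one_le_two
  have := Nat.mul_le_mul_left c hl
  omega

/-! ### The Clifford product from a bilinear algorithm -/

/-- A bilinear algorithm with `R` multiplications for products of Pauli strings of length `e`,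
with common denominator `D` and constants of at most `c` bits. -/
structure BilinearAlgorithm where
  e : ℕ
  R : ℕ
  c : ℕ
  D : ℕ
  α : ℕ → ℕ → ℤ
  β : ℕ → ℕ → ℤ
  γ : ℕ → ℕ → ℤ

/-- The size conditions on a bilinear algorithm: `R` is between `4 ^ e` and `2 ^ (τ e)`, and the
constants fit into `c` bits. -/
structure BilinearAlgorithm.Bounded (d : BilinearAlgorithm) (τ : ℝ) : Prop where
  e_pos : 0 < d.e
  D_pos : 0 < d.D
  four_pow_le : 4 ^ d.e ≤ d.R
  R_le : d.R ≤ 2 ^ d.c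
  Q_le : d.D * 2 ^ d.e ≤ 2 ^ d.c
  α_le : ∀ i < d.R, ∑ x ∈ Finset.range (4 ^ d.e), |d.α i x| ≤ (2 ^ d.c : ℕ)
  β_le : ∀ i < d.R, ∑ x ∈ Finset.range (4 ^ d.e), |d.β i x| ≤ (2 ^ d.c : ℕ)
  γ_le : ∀ x < 4 ^ d.e, ∑ i ∈ Finset.range d.R, |d.γ x i| ≤ (2 ^ d.c : ℕ)
  time : (d.R : ℝ) ≤ (2 : ℝ) ^ (τ * d.e)

/-- The program `mid` performs the multiplication between the transforms: from the transforms of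
`u` and `v` it computes a vector `W` in the array `14` whose transform by the Kronecker power
of `γ` is a multiple of the product of `u` and `v` in the Pauli basis. -/
def BilinearAlgorithm.IsMid (d : BilinearAlgorithm) (τ : ℝ) (mid : RAM.Cmd) : Prop :=
  ∀ p : Polynomial ℕ, ∃ T, PolyTime τ T ∧
    ∀ (n k B : ℕ) (s : RAM.State) (u v : ℕ → ℤ), k = levels d.e n →
      B = bitBound d.c n k (p.eval n) → s.Bounded B →
      RAM.Ready s n k d.R (4 ^ d.e) (d.D * 2 ^ d.e) d.α d.β u v →
      (∀ x, |u x| ≤ 2 ^ p.eval n) → (∀ x, |v x| ≤ 2 ^ p.eval n) →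
      ∃ (s' : RAM.State) (W : ℕ → ℤ), RAM.Runs mid s (T n) s' ∧ s'.Bounded B ∧
        RAM.Setup s' n k d.R (4 ^ d.e) (d.D * 2 ^ d.e) ∧ s'.arr 2 = 0 ∧
        s'.arr 8 = s.arr 8 ∧ s'.arr 9 = s.arr 9 ∧ s'.arr 15 = 0 ∧
        (∀ x < d.R ^ k, s'.arr 14 (x : ℕ) = W x) ∧
        (∀ x, |W x| ≤ 2 ^ (2 * (d.c * k + p.eval n) + k)) ∧
        ∀ z, ∑ i ∈ Finset.range (d.R ^ k), kronPow d.γ (4 ^ d.e) d.R k z i * W i =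
          (d.D : ℤ) ^ k * pauliConv (d.e * k) u v z

theorem BilinearAlgorithm.Bounded.two_le {d : BilinearAlgorithm} {τ : ℝ} (h : d.Bounded τ) :
    2 ≤ τ := by
  have h1 : ((4 ^ d.e : ℕ) : ℝ) ≤ (2 : ℝ) ^ (τ * d.e) :=
    le_trans (by exact_mod_cast h.four_pow_le) h.time
  have h2 : ((4 ^ d.e : ℕ) : ℝ) = (2 : ℝ) ^ ((2 : ℝ) * d.e) := by
    rw [Real.rpow_mul zero_le_two, Real.rpow_natCast]
    norm_num
  rw [h2, Real.rpow_le_rpow_left_iff one_lt_two] at h1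
  have : (0 : ℝ) < d.e := by exact_mod_cast h.e_pos
  exact le_of_mul_le_mul_right h1 this

theorem RAM.place_addr {ι : Type} [Fintype ι] {addr : ι → ℕ} (h : Function.Injective addr)
    (v : ι → ℤ) (i : ι) : place addr v (addr i : ℕ) = v i := by
  rw [place, Finset.sum_eq_single i (fun j _ hj => ?_) (by simp), if_pos rfl]
  rw [if_neg]
  exact fun hh => hj (h (by exact_mod_cast hh))

theorem RAM.bits_place {ι : Type} [Fintype ι] {addr : ι → ℕ} (h : Function.Injective addr)
    {v : ι → ℤ} {B : ℕ} (hv : ∀ i, bits (v i) ≤ B) (z : ℤ) : bits (place addr v z) ≤ B := by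
  by_cases hz : ∃ i, (addr i : ℤ) = z
  · obtain ⟨i, rfl⟩ := hz
    rw [place_addr h]
    exact hv i
  · push Not at hz
    rw [place, Finset.sum_eq_zero fun i _ => if_neg (hz i)]
    simp

theorem abs_stringVector_le {n p : ℕ} {F : ℕ → ℤ} (hF : ∀ a, RAM.bits (F a) ≤ p) (x : ℕ) :
    |RAM.stringVector n F x| ≤ 2 ^ p := by
  have h := RAM.bits_scatter (v := fun a => stringSign a * F a) (N := 2 ^ n) (B := p)
    stringIndex_injective.injOn (fun a _ => by
      rw [RAM.bits, RAM.natAbs_stringSign_mul]; exact hF a) le_rfl (x : ℤ)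
  rw [RAM.scatter_natCast, RAM.bits_le_iff] at h
  rw [RAM.stringVector, Int.abs_eq_natAbs]
  exact_mod_cast h.le

theorem phaseCount_le {n k P : ℕ} (hk : k ≤ n + 3) (hP : 1 ≤ P) (Q : ℕ) :
    n + k + 2 + P + (k + 1) * Q ≤ (3 * n + 9) * (P + Q) := by
  have h1 := Nat.mul_le_mul_right Q hk
  have h2 := Nat.mul_le_mul_left (2 * n + 5) hP
  nlinarith [Nat.zero_le (n * P), Nat.zero_le (n * Q), Nat.zero_le Q]

/-- The whole program, around the multiplication `mid`. -/
def cliffordProg (d : BilinearAlgorithm) (mid : RAM.Cmd) : RAM.Cmd :=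
  .seq (RAM.setupProg d.e d.R (4 ^ d.e) (d.D * 2 ^ d.e)) <|
  .seq (RAM.frontProg d.R (4 ^ d.e) d.α d.β) <| .seq mid <|
  .seq (RAM.yatesTable d.γ (4 ^ d.e) d.R 5 4 14 15) RAM.readCoeffs

/-- The Clifford product is a product of Pauli strings up to signs, so a method for the latter
gives one for the former. -/
theorem cliffordMulInTime_of_isMid {d : BilinearAlgorithm} {τ : ℝ} (hd : d.Bounded τ)
    {mid : RAM.Cmd} (hmid : d.IsMid τ mid) : CliffordMulInTime τ := by
  have hτ := hd.two_le
  have hRpos : 0 < d.R := lt_of_lt_of_le (by positivity) hd.four_pow_le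
  refine ⟨cliffordProg d mid, fun p => ?_⟩
  obtain ⟨Tm, hTm, hmid⟩ := hmid p
  -- every phase except `mid` takes time at most a constant times `X n`
  let X : ℕ → ℕ := fun n => (n + levels d.e n + 2 + 2 ^ n + (levels d.e n + 1) *
    d.R ^ levels d.e n) * (bitBound d.c n (levels d.e n) (p.eval n) + 1) ^ 2
  have hX : PolyTime τ X := by
    refine PolyTime.of_le_mul ((PolyTime.two_pow hτ).add
      (polyTime_pow_levels (by linarith) hd.time))
      ((3 * Polynomial.X + 9) *
        (Polynomial.C (4 * d.c + 8) * (2 * Polynomial.X + 4) + 3 * p + 1) ^ 2) fun n => ?_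
    have hk := levels_le d.e n
    have h1 : bitBound d.c n (levels d.e n) (p.eval n) ≤
        (4 * d.c + 8) * (2 * n + 4) + 3 * p.eval n := by
      rw [bitBound]
      exact Nat.add_le_add_right (Nat.mul_le_mul_left _ (by omega)) _
    have h2 : 1 ≤ 2 ^ n := Nat.one_le_two_pow
    have h3 := phaseCount_le hk h2 (d.R ^ levels d.e n)
    have h4 := Nat.mul_le_mul h3 (Nat.pow_le_pow_left (Nat.add_le_add_right h1 1) 2)
    simp only [Polynomial.eval_mul, Polynomial.eval_add, Polynomial.eval_pow,
      Polynomial.eval_ofNat, Polynomial.eval_X, Polynomial.eval_C, Polynomial.eval_one]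
    calc _ ≤ _ := h4
      _ = _ := by ring
  obtain ⟨q, hq⟩ := ((hX.mul_eval (Polynomial.C
    ((RAM.setupProg d.e d.R (4 ^ d.e) (d.D * 2 ^ d.e)).factor +
      (RAM.frontProg d.R (4 ^ d.e) d.α d.β).factor +
      (RAM.yatesTable d.γ (4 ^ d.e) d.R 5 4 14 15).factor + RAM.readCoeffs.factor))).add hTm)
  refine ⟨q, fun n f g hf hg => ?_⟩
  specialize hq n
  specialize hmid n
  set k := levels d.e n with hk
  set B := bitBound d.c n k (p.eval n) with hB
  have hc : 1 ≤ d.c := by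
    by_contra h0
    have h1 := hd.four_pow_le.trans hd.R_le
    rw [show d.c = 0 by omega] at h1
    have := Nat.one_lt_pow hd.e_pos.ne' (show 1 < 4 by norm_num)
    omega
  have hS2 : 4 ^ d.e ≤ 2 ^ d.c := hd.four_pow_le.trans hd.R_le
  have htwo : 2 ≤ 2 ^ d.c := Nat.le_self_pow (by omega) 2
  have h2n : 1 ≤ 2 ^ n := Nat.one_le_two_pow
  have hkk : n / 2 + 2 < d.e * k := lt_mul_levels hd.e_pos n
  have hXn : ∀ N ≤ n + k + 2 + 2 ^ n + (k + 1) * d.R ^ k, N * (B + 1) ^ 2 ≤ X n :=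
    fun N hN => Nat.mul_le_mul_right _ hN
  have hB8 : 8 * (n + k + 1) + 3 * p.eval n ≤ B := by
    rw [hB, bitBound]
    nlinarith [Nat.zero_le (d.c * (n + k + 1))]
  have hsegment : ∀ l ≤ k, d.R ^ l * (4 ^ d.e) ^ (k - l) ≤ d.R ^ k := by
    intro l hl
    calc d.R ^ l * (4 ^ d.e) ^ (k - l) ≤ d.R ^ l * d.R ^ (k - l) :=
          Nat.mul_le_mul_left _ (Nat.pow_le_pow_left hd.four_pow_le _)
      _ = d.R ^ k := by rw [← pow_add]; congr 1; omega
  -- the coefficient vectors as functions of the address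
  let F : ℕ → ℤ := fun a => RAM.place subsetAddr f (a : ℕ)
  let G : ℕ → ℤ := fun a => RAM.place subsetAddr g (a : ℕ)
  have hFb : ∀ a, RAM.bits (F a) ≤ p.eval n := fun a => RAM.bits_place subsetAddr_injective hf _
  have hGb : ∀ a, RAM.bits (G a) ≤ p.eval n := fun a => RAM.bits_place subsetAddr_injective hg _
  have hu := abs_stringVector_le (n := n) hFb
  have hv := abs_stringVector_le (n := n) hGb
  have hin : (RAM.input n subsetAddr f g).Bounded B := by
    constructor
    · intro x _
      simp only [RAM.input]
      split_ifs
      · refine RAM.bits_natCast_le (Nat.lt_two_pow_self.trans_le ?_)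
        exact Nat.pow_le_pow_right two_pos (by omega)
      · simp
    · intro a _ z
      simp only [RAM.input]
      split_ifs
      · exact (RAM.bits_place subsetAddr_injective hf z).trans (by omega)
      · exact (RAM.bits_place subsetAddr_injective hg z).trans (by omega)
      · simp
  obtain ⟨s₁, r₁, B₁, S₁, h₁0, h₁1, h₁2, h₁a, h₁r⟩ := RAM.setupProg_runs d.e d.R (4 ^ d.e)
    (d.D * 2 ^ d.e) n k B (X n) _ hin (by simp [RAM.input]) (fun x hx => by simp [RAM.input, hx])
    (fun a ha => by
      simp [RAM.input, show a ≠ 0 by omega, show a ≠ 1 by omega])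
    rfl (hXn _ (by omega))
    (Nat.lt_two_pow_self.trans_le (Nat.pow_le_pow_right two_pos (by omega)))
    (by
      calc (k + 1) * d.R ^ k ≤ 2 ^ k * (2 ^ d.c) ^ k :=
            Nat.mul_le_mul Nat.lt_two_pow_self (Nat.pow_le_pow_left hd.R_le k)
        _ = 2 ^ (k + d.c * k) := by rw [← pow_mul, ← pow_add]
        _ < 2 ^ B := by
            apply Nat.pow_lt_pow_right one_lt_two
            rw [hB, bitBound]
            nlinarith [Nat.zero_le (d.c * n), Nat.zero_le (d.c * k)])
    (fun j hj => pow_lt_two_pow_bitBound htwo hj)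
    (fun j hj => pow_lt_two_pow_bitBound hd.R_le hj)
    (fun j hj => pow_lt_two_pow_bitBound hS2 hj)
    (fun j hj => pow_lt_two_pow_bitBound hd.Q_le hj)
  obtain ⟨s₂, r₂, B₂, S₂⟩ := RAM.frontProg_runs hRpos d.α d.β n k B (X n) _ s₁ F G B₁ S₁ h₁2
    h₁a h₁r (fun a _ => by rw [h₁0]; rfl) (fun a _ => by rw [h₁1]; rfl) (hXn _ (by omega))
    (hXn _ (by omega)) (by omega)
    (fun j hj => by
      have h1 : j < 4 ^ n := hj.trans_le (Nat.pow_le_pow_left (by norm_num) n)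
      refine (pauliIndex_lt n h1).trans_le ?_
      rw [show 4 = 2 ^ 2 by norm_num, ← pow_mul]
      exact Nat.pow_le_pow_right two_pos (by omega))
    hsegment (fun l hl x => bits_yates_le_bitBound hRpos hd.α_le hu (by omega) hl x)
    (fun l hl x => bits_yates_le_bitBound hRpos hd.β_le hv (by omega) hl x)
  obtain ⟨s₃, W, r₃, B₃, S₃, h₃2, h₃8, h₃9, h₃15, hW, hWb, hconv⟩ :=
    hmid k B s₂ _ _ rfl rfl B₂ S₂ hu hv
  obtain ⟨r₄, B₄⟩ := RAM.yatesTable_runs (M := d.γ) (R := 4 ^ d.e) (S := d.R) (A := d.R ^ k)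
    (pR := 5) (pS := 4) (src := 14) (dst := 15) B₃
    (hXn _ (by omega)) S₃.reg1 S₃.reg3 S₃.reg4
    (by positivity) S₃.arr5 S₃.arr4 (by omega)
    (fun l hl => by
      have := hsegment (k - l) (by omega)
      rwa [show k - (k - l) = l by omega, mul_comm] at this)
    (by norm_num) (by norm_num) h₃15 W hW
    (fun l hl x => bits_yates_le_bitBound (by positivity) hd.γ_le hWb le_rfl hl x)
  have S₄ := S₃.step ((k + 1) * d.R ^ k) (b := 15) (by norm_num)
    (RAM.table (fun g => yates d.γ (4 ^ d.e) d.R k W (g / d.R ^ k) (g % d.R ^ k))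
      ((k + 1) * d.R ^ k))
  -- one tensor factor of the strings is for the signs, so `m` factors are left
  obtain ⟨m, hm⟩ : ∃ m, d.e * k = m + 1 :=
    ⟨d.e * k - 1, by omega⟩
  have hnm : 2 ^ n ≤ 4 ^ m := by
    rw [show 4 = 2 ^ 2 by norm_num, ← pow_mul]
    exact Nat.pow_le_pow_right two_pos (by omega)
  have hidx : ∀ a < 2 ^ n, stringIndex a < (4 ^ d.e) ^ k := fun a ha => by
    rw [← pow_mul, hm]
    exact stringIndex_lt m (ha.trans_le hnm)
  have hSk : (4 ^ d.e) ^ k ≤ d.R ^ k := Nat.pow_le_pow_left hd.four_pow_le k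
  have r₅ := RAM.readCoeffs_runs (N := 2 ^ n) (k := k) (A := d.R ^ k)
    (D := (d.D * 2 ^ d.e) ^ k) B₄ (hXn _ (by omega)) S₄.reg1
    S₄.reg2 S₄.reg4 S₄.reg6 (by simp [h₃8, S₂.arr8]) (by simp [h₃9, S₂.arr9]) (by simp [h₃2])
    (fun a => yates d.γ (4 ^ d.e) d.R k W k (stringIndex a)) (fun a ha => by
      have h1 := (hidx a ha).trans_le hSk
      rw [RAM.State.step_arr, if_pos rfl, RAM.table_of_lt _ (by nlinarith),
        mul_add_div_of_lt h1, Nat.mul_add_mod_of_lt h1])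
  obtain ⟨t, ht, hex⟩ := r₁.seq (r₂.seq (r₃.seq (r₄.seq r₅)))
  refine ⟨t, _, hex, ?_, ?_⟩
  · have hf' : Cl.ofCoeffs f = Cl.ofCoeffs (fun A => F (subsetAddr A)) := by
      congr 1; funext A; exact (RAM.place_addr subsetAddr_injective f A).symm
    have hg' : Cl.ofCoeffs g = Cl.ofCoeffs (fun A => G (subsetAddr A)) := by
      congr 1; funext A; exact (RAM.place_addr subsetAddr_injective g A).symm
    rw [hf', hg', ← Cl.ofCoeffs_mul_ofCoeffs F G (fun a => RAM.table (fun a => stringSign a *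
      yates d.γ (4 ^ d.e) d.R k W k (stringIndex a) / ((d.D * 2 ^ d.e) ^ k : ℕ)) (2 ^ n) (a : ℕ))]
    · simp
    · intro c hc'
      rw [RAM.table_of_lt _ hc', yates_eq_sum _ _ _ _ _ (hidx c hc'), hconv, hm,
        mul_left_comm]
      erw [stringSign_mul_pauliConv hnm F G hc']
      have hQ : (((d.D * 2 ^ d.e) ^ k : ℕ) : ℤ) = (d.D : ℤ) ^ k * 2 ^ (m + 1) := by
        rw [← hm, mul_pow, ← pow_mul]; push_cast; rfl
      rw [hQ, ← mul_assoc]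
      apply Int.mul_ediv_cancel_left
      have : (d.D : ℤ) ≠ 0 := by exact_mod_cast hd.D_pos.ne'
      positivity
  · refine le_trans (Nat.cast_le.2 (ht.trans (le_of_eq ?_))) hq
    beta_reduce
    rw [Polynomial.eval_C]
    generalize X n = x
    ring

/-! ### The upper bound from the exponent of matrix multiplication -/

theorem BilinearAlgorithm.Bounded.polyTime {d : BilinearAlgorithm} {τ : ℝ} (hd : d.Bounded τ)
    (C : ℕ) (p : Polynomial ℕ) :
    PolyTime τ (fun n => C * ((d.R ^ levels d.e n + 1) *
      (bitBound d.c n (levels d.e n) (p.eval n) + 1) ^ 2)) := by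
  have hτ := hd.two_le
  have hRpos : 0 < d.R := lt_of_lt_of_le (by positivity) hd.four_pow_le
  refine (polyTime_pow_levels (by linarith) hd.time).of_le_mul (Polynomial.C (2 * C) *
    (Polynomial.C (4 * d.c + 8) * (2 * Polynomial.X + 4) + 3 * p + 1) ^ 2) fun n => ?_
  simp only [Polynomial.eval_mul, Polynomial.eval_add, Polynomial.eval_pow,
    Polynomial.eval_ofNat, Polynomial.eval_X, Polynomial.eval_C, Polynomial.eval_one]
  have h1 : bitBound d.c n (levels d.e n) (p.eval n) ≤
      (4 * d.c + 8) * (2 * n + 4) + 3 * p.eval n := by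
    rw [bitBound]
    have hk := levels_le d.e n
    exact Nat.add_le_add_right (Nat.mul_le_mul_left _ (by omega)) _
  have h2 : d.R ^ levels d.e n + 1 ≤ 2 * d.R ^ levels d.e n := by
    have : 0 < d.R ^ levels d.e n := by positivity
    omega
  calc _ ≤ C * (2 * d.R ^ levels d.e n * _) := Nat.mul_le_mul_left _
        (Nat.mul_le_mul h2 (Nat.pow_le_pow_left (Nat.add_le_add_right h1 1) 2))
    _ = _ := by ring

/-- Multiplies the transforms entry by entry. -/
def pointwiseProg : RAM.Cmd :=
  RAM.forStore 4 14 (.reg 5) (.cell 12 (.reg 1 * .reg 4 + .reg 5) *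
    .cell 13 (.reg 1 * .reg 4 + .reg 5))

/-- The result of Yates' algorithm is the last of the `k + 1` segments of the table. -/
theorem table_last_segment {k A : ℕ} {y : ℕ → ℕ → ℤ} {j : ℕ} (hj : j < A) :
    RAM.table (fun g => y (g / A) (g % A)) ((k + 1) * A) ((k : ℤ) * A + j) = y k j := by
  have : ((k : ℤ) * A + j) = ((k * A + j : ℕ) : ℤ) := by push_cast; rfl
  rw [this, RAM.table_of_lt _ (by nlinarith), mul_add_div_of_lt hj, Nat.mul_add_mod_of_lt hj]

theorem BilinearAlgorithm.Bounded.isMid_pointwiseProg {d : BilinearAlgorithm} {τ : ℝ}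
    (hd : d.Bounded τ)
    (h : ∀ x < 4 ^ d.e, ∀ y < 4 ^ d.e, ∀ z < 4 ^ d.e,
      ∑ i ∈ Finset.range d.R, d.γ z i * (d.α i x * d.β i y) =
        (d.D : ℤ) * digitProd pauliTrace 4 4 4 d.e x y z) :
    d.IsMid τ pointwiseProg := by
  have hRpos : 0 < d.R := lt_of_lt_of_le (by positivity) hd.four_pow_le
  intro p
  refine ⟨_, hd.polyTime pointwiseProg.factor p, ?_⟩
  rintro n k B s u v rfl rfl hs hr hu hv
  set k := levels d.e n
  have hU := abs_yates_le hRpos hd.α_le k hu k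
  have hV := abs_yates_le hRpos hd.β_le k hv k
  set U := yates d.α d.R (4 ^ d.e) k u k with hUdef
  set V := yates d.β d.R (4 ^ d.e) k v k with hVdef
  have hW : ∀ x, |U x * V x| ≤ 2 ^ (2 * (d.c * k + p.eval n)) := fun x => by
    rw [abs_mul]
    calc _ ≤ _ := mul_le_mul (hU x) (hV x) (abs_nonneg _) (by positivity)
      _ = _ := by push_cast; ring
  have hWb : ∀ x, RAM.bits (U x * V x) ≤ bitBound d.c n k (p.eval n) := fun x =>
    bits_le_bitBound (hW x) (by omega)
  obtain ⟨r, b⟩ := RAM.fill_runs (s := s) (len := 4) (b := 14) (N := d.R ^ k)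
    (ev := .cell 12 (.reg 1 * .reg 4 + .reg 5) * .cell 13 (.reg 1 * .reg 4 + .reg 5)) hs le_rfl
    (by norm_num) hr.reg4 (by norm_num) (by simp) (hr.arr_zero 14 le_rfl) (fun x => U x * V x)
    (fun x _ => hWb x) (fun j hj => by
      simp only [RAM.Expr.eval_mul, RAM.Expr.eval_cell, RAM.Expr.eval_add, RAM.Expr.eval_reg,
        RAM.State.step_reg, RAM.State.step_arr]
      norm_num only [if_true, if_false]
      rw [hr.arr12, hr.arr13, hr.reg1, hr.reg4, table_last_segment hj, table_last_segment hj])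
  refine ⟨_, fun x => U x * V x, r, b, hr.toSetup.step _ (by norm_num) _, ?_, ?_, ?_, ?_,
    fun x hx => ?_, fun x => ?_, fun z => ?_⟩
  · simp [hr.arr2]
  · simp
  · simp
  · simp [hr.arr_zero]
  · simp [RAM.table_of_lt _ hx]
  · exact (hW x).trans (pow_le_pow_right₀ one_le_two (by omega))
  · rw [← sum_kronPow_mul_eq_pauliConv h]
    refine Finset.sum_congr rfl fun i hi => ?_
    rw [Finset.mem_range] at hi
    beta_reduce
    rw [hUdef, hVdef, yates_eq_sum _ _ _ _ _ hi, yates_eq_sum _ _ _ _ _ hi]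

theorem cliffordMulInTime_of_matMulExponent_lt {τ : ℝ} (hτ : matMulExponent < τ) :
    CliffordMulInTime τ := by
  obtain ⟨e, r, he, hr, hrτ⟩ := exists_bilinear_of_matMulExponent_lt hτ
  obtain ⟨α, β, γ, D, hD, h⟩ := hr.exists_pauli
  have h4 : 4 ^ e ≤ r := by
    have := hr.sq_le
    rwa [← pow_mul, mul_comm, pow_mul, show 2 ^ 2 = 4 by norm_num] at this
  -- a crude bound for all constants
  let rowSums : (ℕ → ℕ → ℤ) → ℕ → ℕ → ℕ := fun M R S =>
    ∑ i ∈ Finset.range R, ∑ x ∈ Finset.range S, (M i x).natAbs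
  have hrow : ∀ (M : ℕ → ℕ → ℤ) (R S : ℕ), ∀ i < R,
      ∑ x ∈ Finset.range S, |M i x| ≤ (rowSums M R S : ℕ) := by
    intro M R S i hi
    have h1 := Finset.single_le_sum (f := fun i => ∑ x ∈ Finset.range S, (M i x).natAbs)
      (fun _ _ => Nat.zero_le _) (Finset.mem_range.2 hi)
    calc ∑ x ∈ Finset.range S, |M i x| = ((∑ x ∈ Finset.range S, (M i x).natAbs : ℕ) : ℤ) := by
          push_cast; simp
      _ ≤ _ := by exact_mod_cast h1
  let c := r + D * 2 ^ e + rowSums α r (4 ^ e) + rowSums β r (4 ^ e) + rowSums γ (4 ^ e) r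
  have hc : ∀ a ≤ c, a ≤ 2 ^ c := fun a ha => ha.trans Nat.lt_two_pow_self.le
  let d : BilinearAlgorithm := ⟨e, r, c, D, α, β, γ⟩
  have hd : d.Bounded τ :=
    { e_pos := he
      D_pos := hD
      four_pow_le := h4
      R_le := hc _ (by simp only [c, d]; omega)
      Q_le := hc _ (by simp only [c, d]; omega)
      α_le := fun i hi => (hrow α r (4 ^ e) i hi).trans
        (Nat.cast_le.2 (hc _ (by simp only [c]; omega)))
      β_le := fun i hi => (hrow β r (4 ^ e) i hi).trans
        (Nat.cast_le.2 (hc _ (by simp only [c]; omega)))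
      γ_le := fun i hi => (hrow γ (4 ^ e) r i hi).trans
        (Nat.cast_le.2 (hc _ (by simp only [c]; omega)))
      time := hrτ }
  exact cliffordMulInTime_of_isMid hd (hd.isMid_pointwiseProg h)

/-! ### Reduction to integer matrix multiplication -/

namespace RAM

/-- A matrix in row-major order as a table. -/
theorem place_entryAddr (N : ℕ) (v : ℕ → ℕ → ℤ) :
    place entryAddr (fun ij : Fin N × Fin N => v ij.1 ij.2) =
      table (fun w => v (w / N) (w % N)) (N * N) := by
  funext z
  by_cases hz : 0 ≤ z ∧ z < (N * N : ℕ)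
  · obtain ⟨w, rfl⟩ := Int.eq_ofNat_of_zero_le hz.1
    have hw : w < N * N := by exact_mod_cast hz.2
    have hN : 0 < N := Nat.pos_of_mul_pos_left (Nat.zero_lt_of_lt hw)
    have h1 := place_addr (entryAddr_injective (N := N)) (fun ij => v ij.1 ij.2)
      (⟨w / N, (Nat.div_lt_iff_lt_mul hN).2 hw⟩, ⟨w % N, Nat.mod_lt _ hN⟩)
    have h2 : entryAddr ((⟨w / N, (Nat.div_lt_iff_lt_mul hN).2 hw⟩, ⟨w % N, Nat.mod_lt _ hN⟩) :
        Fin N × Fin N) = w := by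
      simp only [entryAddr]
      rw [mul_comm]
      exact Nat.div_add_mod w N
    rw [h2] at h1
    rw [table_of_lt _ hw]
    exact h1
  · rw [table, if_neg hz, place]
    refine Finset.sum_eq_zero fun ij _ => if_neg fun h => hz ?_
    subst h
    exact ⟨Int.natCast_nonneg _, by exact_mod_cast mul_add_lt_of_lt ij.1.2 ij.2.2⟩

theorem abs_scatter_le {addr : ℕ → ℕ} {v : ℕ → ℤ} {N : ℕ} {C : ℤ}
    (hinj : Set.InjOn addr (Set.Iio N)) (hC : 0 ≤ C) (hv : ∀ i < N, |v i| ≤ C) :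
    ∀ {j : ℕ}, j ≤ N → ∀ z, |scatter addr v j z| ≤ C := by
  intro j
  induction j with
  | zero => intro _ z; simpa [scatter] using hC
  | succ j ih =>
    intro hj z
    rw [scatter_succ hj hinj, Function.update_apply]
    split_ifs
    · exact hv j hj
    · exact ih (by omega) z

theorem Setup.set {s : State} {n k R S Q : ℕ} (h : Setup s n k R S Q) {x : ℕ} (hx : 7 ≤ x)
    (v : ℤ) : Setup (s.set x v) n k R S Q := by
  constructor <;> simp [h.reg0, h.reg1, h.reg2, h.reg3, h.reg4, h.reg6, h.arr3, h.arr4, h.arr5,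
    show 0 ≠ x by omega, show 1 ≠ x by omega, show 2 ≠ x by omega, show 3 ≠ x by omega,
    show 4 ≠ x by omega, show 6 ≠ x by omega]

theorem Setup.graft {s : State} {n k R S Q : ℕ} (h : Setup s n k R S Q) (u : State) :
    Setup (s.graft 100 u) n k R S Q := by
  constructor <;> simp [State.graft, h.reg0, h.reg1, h.reg2, h.reg3, h.reg4, h.reg6, h.arr3,
    h.arr4, h.arr5]

theorem State.Bounded.graft {s : State} {B : ℕ} (h : s.Bounded B) (u : State) :
    (s.graft 100 u).Bounded B where
  reg x hx := by simpa [State.graft, hx] using h.reg x hx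
  arr a ha := by simpa [State.graft, ha] using h.arr a ha

/-- Tabulates `spread` in the array `16`. -/
def spreadTable : Cmd := forStore 9 16 (.reg 5) (4 * .cell 16 (.reg 5 / 2) + .reg 5 % 2)

theorem spreadTable_runs {s : State} {B N X : ℕ} (hs : s.Bounded B)
    (hX : (N + 1) * (B + 1) ^ 2 ≤ X) (hN : s.reg 9 = N) (h0 : s.arr 16 = 0)
    (hB : ∀ x < N, spread x < 2 ^ B) :
    Runs spreadTable s (spreadTable.factor * X)
      (s.step N 16 (table (fun x => spread x) N)) ∧
    (s.step N 16 (table (fun x => spread x) N)).Bounded B := by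
  refine fill_runs hs hX (by norm_num) hN (by norm_num) (by simp) h0 _
    (fun j hj => bits_natCast_le (hB j hj)) fun j hj => ?_
  have h1 : spread 0 = 0 := by simp [spread]
  have h2 := table_div (v := fun x => (spread x : ℤ)) (by simp [h1]) j one_lt_two
  have h3 : ((spread j : ℕ) : ℤ) = 4 * (spread (j / 2) : ℕ) + (j % 2 : ℕ) := by
    exact_mod_cast spread_eq j
  simp only [Expr.eval_add, Expr.eval_mul, Expr.eval_cell, Expr.eval_div, Expr.eval_mod,
    Expr.eval_reg, Expr.eval_ofNat, State.step_reg, State.step_arr, if_true]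
  rw [h3, ← h2]
  push_cast
  rfl

/-- The position of the entry `r₅`, in row-major order, of a matrix with `r₉` columns in the
interleaved order. -/
def interleaveExpr : Expr := 2 * .cell 16 (.reg 5 / .reg 9) + .cell 16 (.reg 5 % .reg 9)

theorem low_interleaveExpr : interleaveExpr.Low := by simp [interleaveExpr]

theorem eval_interleaveExpr {s : State} {N j : ℕ} (h5 : s.reg 5 = j) (h9 : s.reg 9 = N)
    (h16 : s.arr 16 = table (fun x => spread x) N) (hj : j < N * N) :
    interleaveExpr.eval s = interleave (j / N) (j % N) := by
  have hN : 0 < N := Nat.pos_of_mul_pos_left (Nat.zero_lt_of_lt hj)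
  simp only [interleaveExpr, Expr.eval_add, Expr.eval_mul, Expr.eval_cell, Expr.eval_div,
    Expr.eval_mod, Expr.eval_reg, Expr.eval_ofNat]
  rw [h5, h9, h16, ← Int.natCast_div, ← Int.natCast_mod,
    table_of_lt _ ((Nat.div_lt_iff_lt_mul hN).2 hj), table_of_lt _ (Nat.mod_lt _ hN), interleave]
  push_cast
  rfl

/-- The entry of the transform in the array `src` at the position `interleaveExpr`. -/
def entryExpr (src : ℕ) : Expr := .cell src (.reg 1 * .reg 4 + interleaveExpr)

theorem low_entryExpr {src : ℕ} (h : src < 100) : (entryExpr src).Low := by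
  simp [entryExpr, h, low_interleaveExpr]

end RAM

theorem eval_mono_of_le (q : Polynomial ℕ) {a b : ℕ} (h : a ≤ b) : q.eval a ≤ q.eval b := by
  rw [Polynomial.eval_eq_sum_range, Polynomial.eval_eq_sum_range]
  exact Finset.sum_le_sum fun i _ => Nat.mul_le_mul_left _ (Nat.pow_le_pow_left h i)

/-- Blocks of one Pauli matrix with the transforms between coordinates in the Pauli basis and
matrix entries.  It serves as the frame for `matrixProg`, which replaces the entrywise
multiplication by a matrix multiplication. -/
def entryAlgorithm : BilinearAlgorithm :=
  ⟨1, 4, 2, 1, pauliToEntry, pauliToEntry, fun x i => pauliToEntry i x⟩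

theorem entryAlgorithm_bounded {τ : ℝ} (hτ : 2 ≤ τ) : entryAlgorithm.Bounded τ where
  e_pos := by decide
  D_pos := by decide
  four_pow_le := by decide
  R_le := by decide
  Q_le := by decide
  α_le := by decide
  β_le := by decide
  γ_le := by decide
  time := by
    have h : ((4 : ℕ) : ℝ) = (2 : ℝ) ^ (2 : ℝ) := by norm_num
    simp only [entryAlgorithm]
    rw [h]
    exact Real.rpow_le_rpow_of_exponent_le one_le_two (by push_cast; linarith)

/-- Passes the transforms as matrices to the program `P` for matrix multiplication, which works
on the registers and arrays from `100` on, and reads off its result. -/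
def matrixProg (P : RAM.Cmd) : RAM.Cmd :=
  .seq (.assign 9 (.cell 3 (.reg 1))) <| .seq RAM.spreadTable <|
  .seq (RAM.forStore 4 100 (.reg 5) (RAM.entryExpr 12)) <|
  .seq (RAM.forStore 4 101 (.reg 5) (RAM.entryExpr 13)) <|
  .seq (.assign 100 (.reg 1)) <| .seq (P.shift 100) <|
  RAM.forStore 4 14 RAM.interleaveExpr (.cell 102 (.reg 5))

theorem polyTime_intMatMul {τ : ℝ} (hτ : 2 ≤ τ) (q : Polynomial ℕ) :
    PolyTime τ (fun n => ⌊((q.eval (levels 1 n) : ℕ) : ℝ) * (2 : ℝ) ^ (τ * levels 1 n)⌋₊) := by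
  refine ⟨Polynomial.C ⌈(2 : ℝ) ^ (τ * 3)⌉₊ * q.comp (Polynomial.X + 3), fun n => ?_⟩
  refine (Nat.floor_le (by positivity)).trans ?_
  have h1 : q.eval (levels 1 n) ≤ q.eval (n + 3) := eval_mono_of_le q (levels_le 1 n)
  have h2 : (levels 1 n : ℝ) ≤ n / 2 + 3 := by
    have h3 : ((n / 2 : ℕ) : ℝ) ≤ (n : ℝ) / 2 := by exact_mod_cast Nat.cast_div_le
    rw [levels]
    push_cast [Nat.div_one]
    linarith
  have h4 : (2 : ℝ) ^ (τ * levels 1 n) ≤ (2 : ℝ) ^ (τ * 3) * (2 : ℝ) ^ (τ * n / 2) := by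
    rw [← Real.rpow_add two_pos]
    apply Real.rpow_le_rpow_of_exponent_le one_le_two
    nlinarith
  have h5 : (2 : ℝ) ^ (τ * 3) ≤ (⌈(2 : ℝ) ^ (τ * 3)⌉₊ : ℝ) := Nat.le_ceil _
  simp only [Polynomial.eval_mul, Polynomial.eval_C, Polynomial.eval_comp, Polynomial.eval_add,
    Polynomial.eval_X, Polynomial.eval_ofNat]
  calc _ ≤ ((q.eval (n + 3) : ℕ) : ℝ) * ((⌈(2 : ℝ) ^ (τ * 3)⌉₊ : ℝ) * (2 : ℝ) ^ (τ * n / 2)) :=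
        mul_le_mul (by exact_mod_cast h1) (h4.trans (mul_le_mul_of_nonneg_right h5 (by positivity)))
          (by positivity) (by positivity)
    _ = _ := by push_cast; ring

/-- The syntactic factor of `matrixProg` without the program for matrix multiplication. -/
def matrixFactor : ℕ :=
  (RAM.Cmd.assign 9 (.cell 3 (.reg 1))).factor + RAM.spreadTable.factor +
  (RAM.forStore 4 100 (.reg 5) (RAM.entryExpr 12)).factor +
  (RAM.forStore 4 101 (.reg 5) (RAM.entryExpr 13)).factor +
  (RAM.Cmd.assign 100 (.reg 1)).factor +
  (RAM.forStore 4 14 RAM.interleaveExpr (.cell 102 (.reg 5))).factor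

theorem isMid_matrixProg {τ : ℝ} (hτ : 2 ≤ τ) {P : RAM.Cmd}
    (hP : ∀ p : Polynomial ℕ, ∃ q : Polynomial ℕ,
      ∀ (m : ℕ) (A B : Matrix (Fin (2 ^ m)) (Fin (2 ^ m)) ℤ),
        (∀ i j, RAM.bits (A i j) ≤ p.eval m) → (∀ i j, RAM.bits (B i j) ≤ p.eval m) →
        ∃ (t : ℕ) (s : RAM.State),
          RAM.Exec P
            (RAM.input m entryAddr (fun ij => A ij.1 ij.2) (fun ij => B ij.1 ij.2)) t s ∧
          (∀ i j, s.arr 2 (entryAddr (i, j)) = (A * B) i j) ∧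
          (t : ℝ) ≤ ((q.eval m : ℕ) : ℝ) * (2 : ℝ) ^ (τ * m)) :
    entryAlgorithm.IsMid τ (matrixProg P) := by
  have hd := entryAlgorithm_bounded hτ
  intro p
  -- a bound for the bits of the entries: the matrices have `2 ^ k` rows with `n ≤ 2 * k`
  obtain ⟨q, hq⟩ := hP (2 * Polynomial.X + p.comp (2 * Polynomial.X) + 1)
  refine ⟨_, (hd.polyTime matrixFactor p).add (polyTime_intMatMul hτ q), ?_⟩
  rintro n k B s u v hk hBdef hs hr hu hv
  have hU := abs_yates_le (show 0 < 4 by norm_num) hd.α_le k hu k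
  have hV := abs_yates_le (show 0 < 4 by norm_num) hd.β_le k hv k
  simp only [entryAlgorithm] at hk hBdef hr hU hV ⊢
  rw [← hk]
  simp only [pow_one, one_mul] at hr hU hV ⊢
  set U := yates pauliToEntry 4 4 k u k with hUdef
  set V := yates pauliToEntry 4 4 k v k with hVdef
  have hn : n ≤ 2 * k := by rw [hk, levels, Nat.div_one]; omega
  have h22 : (((2 ^ 2 : ℕ) : ℤ)) ^ k = 2 ^ (2 * k) := by rw [pow_mul]; norm_num
  have hUle : ∀ x, |U x| ≤ 2 ^ (2 * k + p.eval n) := fun x =>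
    (hU x).trans_eq (by rw [h22, ← pow_add])
  have hVle : ∀ x, |V x| ≤ 2 ^ (2 * k + p.eval n) := fun x =>
    (hV x).trans_eq (by rw [h22, ← pow_add])
  have hent : ∀ z : ℤ, |z| ≤ 2 ^ (2 * k + p.eval n) →
      RAM.bits z ≤ (2 * Polynomial.X + p.comp (2 * Polynomial.X) + 1).eval k := by
    intro z hz
    refine RAM.bits_le_of_abs (hz.trans_lt (pow_lt_pow_right₀ one_lt_two ?_))
    simp only [Polynomial.eval_mul, Polynomial.eval_comp, Polynomial.eval_add,
      Polynomial.eval_X, Polynomial.eval_ofNat, Polynomial.eval_one]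
    have := eval_mono_of_le p hn
    omega
  have hentB : ∀ z : ℤ, |z| ≤ 2 ^ (2 * k + p.eval n) → RAM.bits z ≤ B := fun z hz => by
    rw [hBdef]
    exact bits_le_bitBound hz (by omega)
  let N := 2 ^ k
  have hNN : N * N = 4 ^ k := (mul_pow 2 2 k).symm
  have hN1 : 1 ≤ N := Nat.one_le_two_pow
  have hNle : N ≤ 4 ^ k := hNN ▸ Nat.le_mul_of_pos_left _ hN1
  have h4B : 4 ^ k < 2 ^ B := by
    rw [hBdef]
    exact pow_lt_two_pow_bitBound (by norm_num) (by omega)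
  set X := (4 ^ k + 1) * (B + 1) ^ 2 with hX
  have hX0 : (B + 1) ^ 2 ≤ X := Nat.le_mul_of_pos_left _ (by omega)
  have hXN : (N + 1) * (B + 1) ^ 2 ≤ X := Nat.mul_le_mul_right _ (by omega)
  have hdm : ∀ j < 4 ^ k, j / N < N ∧ j % N < N := fun j hj =>
    ⟨(Nat.div_lt_iff_lt_mul hN1).2 (hNN ▸ hj), Nat.mod_lt _ hN1⟩
  have hil : ∀ j < 4 ^ k, interleave (j / N) (j % N) < 4 ^ k := fun j hj =>
    interleave_lt k (hdm j hj).1 (hdm j hj).2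
  have r1 := RAM.runs_assign (e := .cell 3 (.reg 1)) hX0 9 (v := ((N : ℕ) : ℤ))
    (RAM.Expr.Low.small hs (by simp)) (by
      simp only [RAM.Expr.eval_cell, RAM.Expr.eval_reg]
      rw [hr.reg1, hr.arr3, RAM.table_of_lt _ (show k < n + k + 1 by omega)])
  have B1 := hs.set 9 (RAM.bits_natCast_le (hNle.trans_lt h4B))
  have S1 := hr.toSetup.set (x := 9) (by norm_num) (N : ℕ)
  obtain ⟨r2, B2⟩ := RAM.spreadTable_runs B1 hXN (by simp)
    (by simp [hr.arr_zero]) (fun x hx => by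
      have := spread_lt k hx
      omega)
  have S2 := S1.step N (b := 16) (by norm_num) (RAM.table (fun x => spread x) N)
  -- the transforms in the array `src`, read in row-major order
  have heval : ∀ (t : RAM.State) (src : ℕ) (M : ℕ → ℕ → ℤ) (w : ℕ → ℤ) (j : ℕ), j < 4 ^ k →
      t.reg 1 = k → t.reg 4 = (4 ^ k : ℕ) → t.reg 5 = j → t.reg 9 = N →
      t.arr 16 = RAM.table (fun x => spread x) N →
      t.arr src = RAM.table (fun g => yates M 4 4 k w (g / 4 ^ k) (g % 4 ^ k))
        ((k + 1) * 4 ^ k) →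
      (RAM.entryExpr src).eval t = yates M 4 4 k w k (interleave (j / N) (j % N)) := by
    intro t src M w j hj h1 h4 h5 h9 h16 hsrc
    rw [RAM.entryExpr, RAM.Expr.eval_cell, RAM.Expr.eval_add, RAM.Expr.eval_mul,
      RAM.Expr.eval_reg, RAM.Expr.eval_reg, RAM.eval_interleaveExpr h5 h9 h16 (hNN ▸ hj), h1, h4,
      hsrc, table_last_segment (hil j hj)]
  obtain ⟨r3, B3⟩ := RAM.fill_runs (len := 4) (b := 100) (N := 4 ^ k) (X := X) B2 le_rfl
    (by norm_num) S2.reg4 (by norm_num) (RAM.low_entryExpr (src := 12) (by norm_num))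
    (by simp [hr.arr_zero]) (fun w => U (interleave (w / N) (w % N)))
    (fun j _ => hentB _ (hUle _))
    (fun j hj => heval _ 12 _ u j hj (by simp [hr.reg1]) (by simp [hr.reg4]) (by simp)
      (by simp) (by simp) (by simp [hr.arr12]))
  have S3 := S2.step (4 ^ k) (b := 100) (by norm_num)
    (RAM.table (fun w => U (interleave (w / N) (w % N))) (4 ^ k))
  obtain ⟨r4, B4⟩ := RAM.fill_runs (len := 4) (b := 101) (N := 4 ^ k) (X := X) B3 le_rfl
    (by norm_num) S3.reg4 (by norm_num) (RAM.low_entryExpr (src := 13) (by norm_num))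
    (by simp [hr.arr_zero]) (fun w => V (interleave (w / N) (w % N)))
    (fun j _ => hentB _ (hVle _))
    (fun j hj => heval _ 13 _ v j hj (by simp [hr.reg1]) (by simp [hr.reg4]) (by simp)
      (by simp) (by simp) (by simp [hr.arr13]))
  have S4 := S3.step (4 ^ k) (b := 101) (by norm_num)
    (RAM.table (fun w => V (interleave (w / N) (w % N))) (4 ^ k))
  have r5 := RAM.runs_assign (e := .reg 1) hX0 100 (RAM.Expr.Low.small B4 (by simp)) S4.reg1
  have B5 := B4.set 100 (RAM.bits_natCast_le (show k < 2 ^ B by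
    exact (Nat.lt_pow_self (by norm_num)).trans h4B))
  have S5 := S4.set (x := 100) (by norm_num) (k : ℕ)
  -- from number `100` on, the state is now the initial state that `P` expects
  obtain ⟨t, w, hex, hw, ht⟩ := hq k
    (Matrix.of fun i j => U (interleave i j)) (Matrix.of fun i j => V (interleave i j))
    (fun i j => hent _ (hUle _)) (fun i j => hent _ (hVle _))
  have r6 := hex.shift 100 ((((((s.set 9 N).step N 16 (RAM.table (fun x => spread x) N)).step
    (4 ^ k) 100 (RAM.table (fun w => U (interleave (w / N) (w % N))) (4 ^ k))).step
    (4 ^ k) 101 (RAM.table (fun w => V (interleave (w / N) (w % N))) (4 ^ k))).set 100 k))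
  have hgraft : ∀ (σ : RAM.State) (I : RAM.State), (∀ x, 100 ≤ x → σ.reg x = I.reg (x - 100)) →
      (∀ a, 100 ≤ a → σ.arr a = I.arr (a - 100)) → σ.graft 100 I = σ := by
    rintro ⟨σr, σa⟩ I h1 h2
    simp only [RAM.State.graft, RAM.State.mk.injEq]
    constructor <;> funext x <;> split_ifs with hx
    · rfl
    · exact (h1 x (by omega)).symm
    · rfl
    · exact (h2 x (by omega)).symm
  rw [hgraft _ _ ?_ ?_] at r6
  · have B6 := B5.graft w
    have S6 := S5.graft w
    let C : ℕ → ℤ := fun z => ∑ i ∈ Finset.range N,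
      U (interleave (z / N) i) * V (interleave i (z % N))
    have hwC : ∀ j < 4 ^ k, w.arr 2 (j : ℕ) = C j := fun j hj => by
      have h1 := hw ⟨j / N, (hdm j hj).1⟩ ⟨j % N, (hdm j hj).2⟩
      have h2 : entryAddr ((⟨j / N, (hdm j hj).1⟩, ⟨j % N, (hdm j hj).2⟩) :
          Fin (2 ^ k) × Fin (2 ^ k)) = j := by
        simp only [entryAddr]
        rw [mul_comm]
        exact Nat.div_add_mod j N
      rw [h2, Matrix.mul_apply] at h1
      rw [h1]
      exact Fin.sum_univ_eq_sum_range
        (fun i => U (interleave (j / N) i) * V (interleave i (j % N))) N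
    have hCle : ∀ z, |C z| ≤ 2 ^ (2 * (2 * k + p.eval n) + k) := fun z => by
      calc |C z| ≤ ∑ i ∈ Finset.range N, |U (interleave (z / N) i) * V (interleave i (z % N))| :=
            Finset.abs_sum_le_sum_abs _ _
        _ ≤ ∑ _i ∈ Finset.range N, (2 : ℤ) ^ (2 * k + p.eval n) * 2 ^ (2 * k + p.eval n) :=
            Finset.sum_le_sum fun i _ => by
              rw [abs_mul]
              exact mul_le_mul (hUle _) (hVle _) (abs_nonneg _) (by positivity)
        _ = _ := by
            rw [Finset.sum_const, Finset.card_range, nsmul_eq_mul, Nat.cast_pow, Nat.cast_ofNat]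
            ring
    have hinj : Set.InjOn (fun z => interleave (z / N) (z % N)) (Set.Iio (4 ^ k)) :=
      hNN ▸ interleave_divMod_injOn k
    have hCB : ∀ j < 4 ^ k, RAM.bits (C j) ≤ B := fun j _ => by
      rw [hBdef]
      exact bits_le_bitBound (hCle j) (by omega)
    obtain ⟨r7, B7⟩ := RAM.scatter_runs (len := 4) (b := 14) (N := 4 ^ k) (X := X)
      (ea := RAM.interleaveExpr) (ev := .cell 102 (.reg 5)) B6 le_rfl (by norm_num) S6.reg4
      (by norm_num) RAM.low_interleaveExpr (by simp [RAM.State.graft, hr.arr_zero]) _ hinj C hCB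
      (fun j hj => RAM.eval_interleaveExpr (by simp) (by simp [RAM.State.graft])
        (by simp [RAM.State.graft]) (hNN ▸ hj))
      (fun j hj => by simp [RAM.State.graft, hwC j hj])
      (fun j hj hb => ⟨hb.reg 5 (by norm_num), by simpa [RAM.State.graft, hwC j hj] using hCB j hj⟩)
    obtain ⟨T, hT, hrun⟩ := r1.seq <| r2.seq <| r3.seq <| r4.seq <| r5.seq <|
      RAM.Runs.seq ⟨t, Nat.le_floor ht, r6⟩ r7
    refine ⟨_, fun x => RAM.scatter (fun z => interleave (z / N) (z % N)) C (4 ^ k) (x : ℕ),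
      ⟨T, hT.trans (le_of_eq ?_), hrun⟩, B7, S6.step _ (by norm_num) _, ?_, ?_, ?_, ?_, ?_, ?_, ?_⟩
    · rw [matrixFactor, ← hBdef, ← hX]
      generalize ⌊(_ : ℝ)⌋₊ = y
      ring
    · simp [RAM.State.graft, hr.arr2]
    · simp [RAM.State.graft]
    · simp [RAM.State.graft]
    · simp [RAM.State.graft, hr.arr_zero]
    · intro x _
      simp
    · exact fun x => RAM.abs_scatter_le hinj (by positivity) (fun i _ => hCle i) le_rfl _
    · intro z
      have key := sum_kronPow_matrix_eq_pauliConv k u v z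
      have h1 := sum_range_scatter (M := 4 ^ k) (fun z => interleave (z / N) (z % N)) C
        (fun i => kronPow (fun x i => pauliToEntry i x) 4 4 k z i) hil
      simp only [RAM.scatter_natCast, one_pow, one_mul, Nat.cast_one]
      rw [← key, ← Finset.sum_congr rfl fun x _ => mul_comm _ _, h1, ← hNN, sum_range_mul_eq]
      refine Finset.sum_congr rfl fun r hr => Finset.sum_congr rfl fun c hc => ?_
      rw [Finset.mem_range] at hr hc
      simp only [C]
      rw [mul_comm, mul_add_div_of_lt hc, Nat.mul_add_mod_of_lt hc]
      congr 1
      refine Finset.sum_congr rfl fun i hi => ?_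
      rw [Finset.mem_range] at hi
      rw [hNN, hUdef, hVdef, yates_eq_sum _ _ _ _ _ (interleave_lt k hr hi),
        yates_eq_sum _ _ _ _ _ (interleave_lt k hi hc)]
  · intro x hx
    by_cases h : x = 100
    · subst h; simp [RAM.input]
    · simp [RAM.input, h, show x - 100 ≠ 0 by omega, show x ≠ 5 by omega, show x ≠ 9 by omega,
        hr.reg_zero x (by omega)]
  · intro a ha
    by_cases h : a = 100
    · subst h
      have := RAM.place_entryAddr N (fun i j => U (interleave i j))
      simpa [RAM.input, hNN] using this.symm
    · by_cases h' : a = 101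
      · subst h'
        have := RAM.place_entryAddr N (fun i j => V (interleave i j))
        simpa [RAM.input, hNN] using this.symm
      · simp [RAM.input, h, h', show a - 100 ≠ 0 by omega, show a - 100 ≠ 1 by omega,
          show a ≠ 16 by omega, hr.arr_zero a (by omega)]

theorem cliffordMulInTime_of_intMatMulInTime {τ : ℝ} (h : IntMatMulInTime τ) :
    CliffordMulInTime τ := by
  have hτ := two_le_of_intMatMulInTime h
  obtain ⟨P, hP⟩ := h
  exact cliffordMulInTime_of_isMid (entryAlgorithm_bounded hτ) (isMid_matrixProg hτ hP)

theorem mainTheorem5 :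
    (∀ τ : ℝ, matMulExponent < τ → CliffordMulInTime τ) ∧
      (∀ τ : ℝ, IntMatMulInTime τ → CliffordMulInTime τ) :=
  ⟨fun _ => cliffordMulInTime_of_matMulExponent_lt,
    fun _ => cliffordMulInTime_of_intMatMulInTime⟩
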